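/- All graphs are finite and simple. For positive integers $a,b$, a graph $G$ is $(a,b)$-choosable if for every assignment $L$ of a set $L(v)$ of $a$ integers to each vertex $v$ there are sets $S(v)\subseteq L(v)$ with $|S(v)|=b$ for all $v$ such that $S(u)\cap S(v)=\emptyset$ whenever $u$ and $v$ are adjacent. For a real number $r$, $G$ is strongly fractional $r$-choosable if $G$ is $(a,b)$-choosable for all positive integers $a,b$ with $\frac ab\ge r$. The strong fractional choice number of $G$ is $$ch^s_f(G)=\inf\{r\in\mathbb{R}: G\text{ is strongly fractional } r\text{-choosable}\},$$ and that of a class $\mathcal{G}$ of graphs is $ch^s_f(\mathcal{G})=\sup\{ch^s_f(G): G\in\mathcal{G}\}$ (infimum and supremum in the extended reals). Let $\mathcal{P}_k$ be the class of planar graphs that contain no cycle of length $k$ (as a not necessarily induced subgraph). Then for every integer $k\ge 5$, the complete graph $K_4$ belongs to $\mathcal{P}_k$ and $ch^s_f(K_4)=4$, so that $ch^s_f(\mathcal{P}_k)\ge 4$. Moreover, $ch^s_f(\mathcal{P}_5)=ch^s_f(\mathcal{P}_6)=4$. -/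

import Mathlib

/-! ### Multiple list colouring -/

/-- `G` is `(f, g)`-choosable: for every assignment `L` of a set `L v` of `f v` permissible colours
(integers) to each vertex `v`, one can choose `g v` colours of `L v` for each vertex `v` such that
adjacent vertices receive disjoint sets. -/
def IsChoosableFor {V : Type*} (G : SimpleGraph V) (f g : V → ℕ) : Prop :=
  ∀ L : V → Finset ℤ, (∀ v, (L v).card = f v) →
    ∃ S : V → Finset ℤ, (∀ v, (S v).card = g v) ∧ (∀ v, S v ⊆ L v) ∧
      ∀ u v, G.Adj u v → Disjoint (S u) (S v)

/-- `G` is `(a, b)`-choosable. -/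
def IsMultiChoosable {V : Type*} (G : SimpleGraph V) (a b : ℕ) : Prop :=
  IsChoosableFor G (fun _ => a) (fun _ => b)

/-- `G` is strongly fractional `r`-choosable: it is `(a, b)`-choosable for all positive integers
`a, b` with `a / b ≥ r`. -/
def IsStronglyFractionalChoosable {V : Type*} (G : SimpleGraph V) (r : ℝ) : Prop :=
  ∀ a b : ℕ, 0 < a → 0 < b → r ≤ (a : ℝ) / (b : ℝ) → IsMultiChoosable G a b

/-- The strong fractional choice number of `G`: the infimum, taken in the extended reals, of all
real `r` such that `G` is strongly fractional `r`-choosable. -/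
noncomputable def strongFractionalChoiceNumber {V : Type*} (G : SimpleGraph V) : EReal :=
  sInf {x : EReal | ∃ r : ℝ, IsStronglyFractionalChoosable G r ∧ x = (r : EReal)}

/-! ### Planar graphs

A finite graph is planar if it has an embedding in the sphere. Embeddings are described
combinatorially, by rotation systems, as usual: a rotation system prescribes the cyclic order of
the edges around each vertex, face boundaries are traced by the face permutation, and the embedding
is one in the sphere when its Euler characteristic is that of the sphere. -/

/-- A rotation system of `G`: a permutation of the darts (oriented edges) whose cycles are exactly
the sets of all darts leaving a common vertex. -/
structure RotationSystem {V : Type*} (G : SimpleGraph V) where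
  rot : Equiv.Perm G.Dart
  rot_fst : ∀ d : G.Dart, (rot d).fst = d.fst
  sameCycle_of_fst_eq : ∀ d e : G.Dart, d.fst = e.fst → rot.SameCycle d e

/-- The face permutation: traverse the dart `d`, then leave its end vertex along the dart that
follows the reversal of `d` in the rotation there. -/
def RotationSystem.facePerm {V : Type*} {G : SimpleGraph V} (R : RotationSystem G) :
    Equiv.Perm G.Dart :=
  R.rot * SimpleGraph.Dart.symm_involutive.toPerm

/-- The facial boundary walks: the cycles of the face permutation. -/
def RotationSystem.FacialWalk {V : Type*} {G : SimpleGraph V} (R : RotationSystem G) : Type _ :=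
  Quotient (Equiv.Perm.SameCycle.setoid R.facePerm)

/-- The number of faces when every connected component is placed on a sphere of its own.
A component with an edge has as many faces as facial walks, and a component that consists of one
isolated vertex, which has no dart, has one face. -/
noncomputable def RotationSystem.numFaces {V : Type*} {G : SimpleGraph V}
    (R : RotationSystem G) : ℕ :=
  Nat.card R.FacialWalk + Nat.card {v : V // ∀ w, ¬ G.Adj v w}

/-- A finite graph is planar if it has a rotation system of genus zero. With `c` connected
components, of genera `g₁, …, g_c`, the Euler characteristic `|V| - |E| + |F|` is
`∑ i, (2 - 2 * gᵢ)`, so that it equals `2 * c` exactly when every component is embedded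
in a sphere. -/
def IsPlanar {V : Type*} (G : SimpleGraph V) : Prop :=
  ∃ R : RotationSystem G,
    Nat.card V + R.numFaces = Nat.card G.edgeSet + 2 * Nat.card G.ConnectedComponent

/-! ### Classes of graphs -/

/-- `G` contains a cycle of length `k` (as a not necessarily induced subgraph). -/
def HasCycleOfLength {V : Type*} (G : SimpleGraph V) (k : ℕ) : Prop :=
  ∃ (v : V) (p : G.Walk v v), p.IsCycle ∧ p.length = k

/-- A finite simple graph with its vertex type. -/
structure FiniteGraph where
  V : Type
  finite : Finite V
  graph : SimpleGraph V

/-- The strong fractional choice number of a class of finite graphs: the supremum, taken in the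
extended reals, of the strong fractional choice numbers of its members. -/
noncomputable def classStrongFractionalChoiceNumber (𝒢 : Set FiniteGraph) : EReal :=
  sSup {x : EReal | ∃ G ∈ 𝒢, x = strongFractionalChoiceNumber G.graph}

/-- The class of finite planar graphs without cycles of length `k`. -/
def planarWithoutCycle (k : ℕ) : Set FiniteGraph :=
  {G | IsPlanar G.graph ∧ ¬ HasCycleOfLength G.graph k}

/-- The complete graph on four vertices. -/
def graphK4 : FiniteGraph where
  V := Fin 4
  finite := inferInstance
  graph := SimpleGraph.completeGraph (Fin 4)

/-! Lower bound: give all vertices of $K_4$ the same list of $4n-1$ colours. Four disjoint $n$-sets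
do not fit into it, while $(4n-1)/n$ tends to 4. Upper bound: a graph in which every nonempty vertex
set induces a vertex of degree at most 3 is coloured greedily from lists of size $a\ge 4b$
(`exists_coloring_of_degenerate`). So the content is that a plane graph of minimum degree at least 4
has cycles of lengths 5 and 6.

Planarity is used in the homological form `RotationSystem.Exact`: every cycle modulo 2 bounds a set
of faces. A rank count derives it from Euler's formula (`exact_of_euler`). It passes to induced
subgraphs with no bookkeeping of components (`Exact.induce`), it still gives the inequality
$|E|+2\le|V|+|F|$ on which discharging rests, and it provides the two sides of a triangle
(`Exact.exists_sides`).

Length 5: with charges $2\deg v-6$ and $|f|-6$ the total is negative. Without 5-cycles there are no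
5-faces, triangles and quadrilaterals are never adjacent, and no three consecutive faces at a vertex
are triangles. Hence vertices can pay 1 per triangular corner and $1/2$ per quadrilateral corner.

Length 6: induction along separating triangles (`Exact.false_of_noSix`) reduces to a `Tame` graph,
in which all triangles are facial and only the vertices of one triangle $O$, possibly absent, may
have degree below 4. The charges $\deg v-4$ and $|f|-4$ have sum at most $-8$. There are no 6-faces,
quadrilaterals are neutral, and each triangle needs 1. It gets this from adjacent faces of size at
least 7; a triangle with three quadrilateral neighbours gets $1/3$ at each corner outside $O$
instead. Vertices of degree at least 5 relieve large faces that pay too much. The critical faces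
have size 7 and only 3 to spend (`Tame.sum_load_seven`): if no vertex helps, such a face is `Full`,
and one pattern of its surroundings would cost too much. The `Bad` edges of that pattern pay
nothing, and the two other large neighbours of the triangle make up for it. Adding 2 at each vertex
of $O$ and $1/3$ at each corner of the outer triangle costs at most 7, less than 8, so nonnegative
final charges are a contradiction (`Tame.not_exact`). -/

/-! ### A plane embedding of the complete graph on four vertices -/

/-- The successor of `w` in the rotation at `v` of the embedding of the tetrahedron. -/
def tetrahedronNext (v w : Fin 4) : Fin 4 :=
  (![![0, 2, 3, 1], ![3, 1, 0, 2], ![1, 3, 2, 0], ![2, 0, 1, 3]] : Fin 4 → Fin 4 → Fin 4) v w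

/-- The predecessor of `w` in the rotation at `v` of the embedding of the tetrahedron. -/
def tetrahedronPrev (v w : Fin 4) : Fin 4 :=
  (![![0, 3, 1, 2], ![2, 1, 3, 0], ![3, 0, 2, 1], ![1, 2, 0, 3]] : Fin 4 → Fin 4 → Fin 4) v w

/-- The rotation of the embedding of the tetrahedron. -/
def tetrahedronRot : Equiv.Perm (SimpleGraph.completeGraph (Fin 4)).Dart where
  toFun d := ⟨(d.fst, tetrahedronNext d.fst d.snd), by
    have : ∀ v w : Fin 4, v ≠ w → v ≠ tetrahedronNext v w := by decide
    exact this _ _ d.adj⟩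
  invFun d := ⟨(d.fst, tetrahedronPrev d.fst d.snd), by
    have : ∀ v w : Fin 4, v ≠ w → v ≠ tetrahedronPrev v w := by decide
    exact this _ _ d.adj⟩
  left_inv d := by
    have : ∀ v w : Fin 4, tetrahedronPrev v (tetrahedronNext v w) = w := by decide
    exact SimpleGraph.Dart.ext _ _ (Prod.ext rfl (this _ _))
  right_inv d := by
    have : ∀ v w : Fin 4, tetrahedronNext v (tetrahedronPrev v w) = w := by decide
    exact SimpleGraph.Dart.ext _ _ (Prod.ext rfl (this _ _))

/-- The embedding of the tetrahedron. -/
def tetrahedron : RotationSystem (SimpleGraph.completeGraph (Fin 4)) where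
  rot := tetrahedronRot
  rot_fst _ := rfl
  sameCycle_of_fst_eq d e h := by
    have : ∀ v w w' : Fin 4, v ≠ w → v ≠ w' → w' = w ∨ w' = tetrahedronNext v w ∨
        w' = tetrahedronNext v (tetrahedronNext v w) := by decide
    rcases this d.fst d.snd e.snd d.adj (h ▸ e.adj) with h' | h' | h'
    · exact ⟨0, SimpleGraph.Dart.ext _ _ (Prod.ext h h'.symm)⟩
    · exact ⟨1, SimpleGraph.Dart.ext _ _ (Prod.ext h h'.symm)⟩
    · exact ⟨2, SimpleGraph.Dart.ext _ _ (Prod.ext h h'.symm)⟩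

/-- The vertex that the facial triangle of a dart does not contain. -/
def tetrahedronOpposite (d : (SimpleGraph.completeGraph (Fin 4)).Dart) : Fin 4 :=
  tetrahedronPrev d.snd d.fst

theorem tetrahedronOpposite_facePerm (d : (SimpleGraph.completeGraph (Fin 4)).Dart) :
    tetrahedronOpposite (tetrahedron.facePerm d) = tetrahedronOpposite d := by
  have : ∀ v w : Fin 4, v ≠ w →
      tetrahedronPrev (tetrahedronNext w v) w = tetrahedronPrev w v := by decide
  exact this _ _ d.adj

theorem sameCycle_of_tetrahedronOpposite_eq {d e : (SimpleGraph.completeGraph (Fin 4)).Dart}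
    (h : tetrahedronOpposite d = tetrahedronOpposite e) : tetrahedron.facePerm.SameCycle d e := by
  have : ∀ v w v' w' : Fin 4, v ≠ w → v' ≠ w' → tetrahedronPrev w v = tetrahedronPrev w' v' →
      (v = v' ∧ w = w') ∨ (w = v' ∧ tetrahedronNext w v = w') ∨
        (tetrahedronNext w v = v' ∧ tetrahedronNext (tetrahedronNext w v) w = w') := by decide
  rcases this _ _ _ _ d.adj e.adj h with h' | h' | h'
  · exact ⟨0, SimpleGraph.Dart.ext _ _ (Prod.ext h'.1 h'.2)⟩
  · exact ⟨1, SimpleGraph.Dart.ext _ _ (Prod.ext h'.1 h'.2)⟩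
  · exact ⟨2, SimpleGraph.Dart.ext _ _ (Prod.ext h'.1 h'.2)⟩

/-- The vertex missed by a face is constant along the face and determines it, so faces correspond to
vertices. -/
theorem card_facialWalk_tetrahedron : Nat.card tetrahedron.FacialWalk = 4 := by
  have hs : ∀ d e, tetrahedron.facePerm.SameCycle d e →
      tetrahedronOpposite d = tetrahedronOpposite e := by
    intro d e h
    obtain ⟨n, rfl⟩ := h.exists_nat_pow_eq
    clear h
    induction n with
    | zero => rfl
    | succ n ih =>
      rw [ih, pow_succ', Equiv.Perm.mul_apply, tetrahedronOpposite_facePerm]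
  have hb : Function.Bijective
      (Quotient.lift tetrahedronOpposite hs : tetrahedron.FacialWalk → Fin 4) := by
    constructor
    · intro x y
      induction x, y using Quotient.inductionOn₂ with
      | _ d e => exact fun h => Quotient.sound (sameCycle_of_tetrahedronOpposite_eq h)
    · intro v
      have : ∀ v : Fin 4, ∃ a b : Fin 4, a ≠ b ∧ tetrahedronPrev b a = v := by decide
      obtain ⟨a, b, hab, h⟩ := this v
      exact ⟨⟦⟨(a, b), hab⟩⟧, h⟩
  rw [RotationSystem.FacialWalk, Nat.card_congr (Equiv.ofBijective _ hb), Nat.card_eq_fintype_card,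
    Fintype.card_fin]

theorem isPlanar_completeGraph_four : IsPlanar (SimpleGraph.completeGraph (Fin 4)) := by
  refine ⟨tetrahedron, ?_⟩
  have h1 : Nat.card {v : Fin 4 // ∀ w, ¬ (SimpleGraph.completeGraph (Fin 4)).Adj v w} = 0 := by
    have : IsEmpty {v : Fin 4 // ∀ w, ¬ (SimpleGraph.completeGraph (Fin 4)).Adj v w} :=
      ⟨fun v => v.2 (v.1 + 1) (by
        have : ∀ v : Fin 4, v ≠ v + 1 := by decide
        exact this _)⟩
    exact Nat.card_of_isEmpty
  have h2 : Nat.card (SimpleGraph.completeGraph (Fin 4)).edgeSet = 6 := by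
    rw [Nat.card_eq_fintype_card, ← SimpleGraph.edgeFinset_card,
      SimpleGraph.card_edgeFinset_top_eq_card_choose_two]
    rfl
  have h3 : Nat.card (SimpleGraph.completeGraph (Fin 4)).ConnectedComponent = 1 := by
    have := (SimpleGraph.connected_top (V := Fin 4)).preconnected.subsingleton_connectedComponent
    exact Nat.card_unique
  rw [RotationSystem.numFaces, card_facialWalk_tetrahedron, h1, h2, h3, Nat.card_eq_fintype_card,
    Fintype.card_fin]

/-! ### Cyclic binary words of length seven -/

theorem toNat_add_le_two_of_cyclic : ∀ a b c d e f g : Bool,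
    (!(a && b) && !(b && c) && !(c && d) && !(d && e) && !(e && f) && !(f && g) && !(g && a) &&
      (a || b || !c || !e || !g) && (b || c || !d || !f || !a) && (c || d || !e || !g || !b) &&
      (d || e || !f || !a || !c) && (e || f || !g || !b || !d) && (f || g || !a || !c || !e) &&
      (g || a || !b || !d || !f)) = true →
    a.toNat + b.toNat + c.toNat + d.toNat + e.toNat + f.toNat + g.toNat ≤ 2 := by
  decide

/-- Three pairwise nonadjacent positions on a 7-cycle have gaps 2, 2, 3, so up to rotation they are
2, 4, 6, the pattern that `h2` forbids; four such positions do not fit. Used for the small faces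
opposite to a seven-face at its vertices. -/
theorem toNat_add_le_two_of_periodic (b : ℕ → Bool) (h7 : ∀ i, b (i + 7) = b i)
    (h1 : ∀ i, (!(b i && b (i + 1))) = true)
    (h2 : ∀ i, (b i || b (i + 1) || !b (i + 2) || !b (i + 4) || !b (i + 6)) = true) :
    (b 0).toNat + (b 1).toNat + (b 2).toNat + (b 3).toNat + (b 4).toNat + (b 5).toNat +
      (b 6).toNat ≤ 2 := by
  apply toNat_add_le_two_of_cyclic
  have e0 := h7 0
  have e1 := h7 1
  have e2 := h7 2
  have e3 := h7 3
  have e4 := h7 4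
  have e5 := h7 5
  have a6 := h1 6
  have c1 := h2 1
  have c2 := h2 2
  have c3 := h2 3
  have c4 := h2 4
  have c5 := h2 5
  have c6 := h2 6
  simp only [Nat.reduceAdd, zero_add] at *
  rw [e0] at a6 c1 c3 c5 c6
  rw [e1] at c2 c4 c6
  rw [e2] at c3 c5
  rw [e3] at c4 c6
  rw [e4] at c5
  rw [e5] at c6
  simp only [Bool.and_eq_true]
  exact ⟨⟨⟨⟨⟨⟨⟨⟨⟨⟨⟨⟨⟨h1 0, h1 1⟩, h1 2⟩, h1 3⟩, h1 4⟩, h1 5⟩, a6⟩, h2 0⟩, c1⟩, c2⟩, c3⟩, c4⟩, c5⟩, c6⟩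

open scoped Classical

/-! ### First return maps -/

section FirstReturn

variable {α : Type*} [Finite α] (σ : Equiv.Perm α) (P : α → Prop)

theorem exists_pow_succ_mem (a : {a // P a}) : ∃ k : ℕ, P ((σ ^ (k + 1)) a) := by
  refine ⟨orderOf σ - 1, ?_⟩
  rw [Nat.sub_add_cancel (orderOf_pos σ), pow_orderOf_eq_one]
  exact a.2

/-- The first positive time at which the orbit of `a` under `σ` comes back to `P`. -/
noncomputable def returnTime (a : {a // P a}) : ℕ :=
  Nat.find (exists_pow_succ_mem σ P a) + 1

theorem returnTime_spec (a : {a // P a}) : P ((σ ^ returnTime σ P a) a) :=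
  Nat.find_spec (exists_pow_succ_mem σ P a)

theorem returnTime_pos (a : {a // P a}) : 0 < returnTime σ P a := Nat.succ_pos _

theorem returnTime_le (a : {a // P a}) {n : ℕ} (hn : 0 < n) (h : P ((σ ^ n) a)) :
    returnTime σ P a ≤ n := by
  obtain ⟨n, rfl⟩ : ∃ m, n = m + 1 := ⟨n - 1, by omega⟩
  exact Nat.succ_le_succ (Nat.find_min' (exists_pow_succ_mem σ P a) h)

/-- The permutation of `P` induced by `σ`, which sends a point to the next point of its orbit
that satisfies `P`. -/
noncomputable def firstReturn : Equiv.Perm {a // P a} :=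
  Equiv.ofBijective (fun a => ⟨(σ ^ returnTime σ P a) a, returnTime_spec σ P a⟩) <| by
    refine Finite.injective_iff_bijective.1 ?_
    -- If two points land in the same place, the one with the longer return time meets the other
    -- after the difference of the times; minimality forces this difference to be 0.
    have key : ∀ a b : {a // P a}, (σ ^ returnTime σ P a) a = (σ ^ returnTime σ P b) b →
        returnTime σ P a ≤ returnTime σ P b → a = b := by
      intro a b h hle
      have h2 : (a : α) = (σ ^ (returnTime σ P b - returnTime σ P a)) b := by
        apply (σ ^ returnTime σ P a).injective
        rw [h, ← Equiv.Perm.mul_apply, ← pow_add, Nat.add_sub_cancel' hle]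
      rcases Nat.eq_zero_or_pos (returnTime σ P b - returnTime σ P a) with h0 | h0
      · rw [h0] at h2
        exact Subtype.ext h2
      · have := returnTime_le σ P b h0 (h2 ▸ a.2)
        have := returnTime_pos σ P a
        omega
    intro a b h
    have h' := congrArg Subtype.val h
    rcases le_total (returnTime σ P a) (returnTime σ P b) with hle | hle
    · exact key a b h' hle
    · exact (key b a h'.symm hle).symm

theorem coe_firstReturn (a : {a // P a}) :
    (firstReturn σ P a : α) = (σ ^ returnTime σ P a) a := rfl

/-- The visits of an orbit to `P` are exactly the iterates of the first return, so return times can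
be peeled off the exponent. Hence deleting darts from a rotation leaves one cycle per vertex. -/
theorem sameCycle_firstReturn (a b : {a // P a}) (h : σ.SameCycle a b) :
    (firstReturn σ P).SameCycle a b := by
  obtain ⟨n, hn⟩ := h.exists_nat_pow_eq
  induction n using Nat.strong_induction_on generalizing a with
  | _ n ih =>
    rcases Nat.eq_zero_or_pos n with rfl | hpos
    · have : a = b := Subtype.ext hn
      rw [this]
    · have hle := returnTime_le σ P a hpos (hn ▸ b.2)
      have h1 : (σ ^ (n - returnTime σ P a)) (firstReturn σ P a : α) = b := by
        rw [coe_firstReturn, ← Equiv.Perm.mul_apply, ← pow_add, Nat.sub_add_cancel hle, hn]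
      have := ih _ (Nat.sub_lt hpos (returnTime_pos σ P a)) (firstReturn σ P a)
        ⟨_, by rw [zpow_natCast]; exact h1⟩ h1
      exact Equiv.Perm.sameCycle_apply_left.1 this

end FirstReturn

/-! ### Functions invariant under an equivalence relation -/

section Invariant

variable {α : Type*} [Finite α]

/-- The space of functions that are constant on the classes of `r`. -/
def invariantFunctions (r : Setoid α) : Submodule (ZMod 2) (α → ZMod 2) where
  carrier := {f | ∀ a b, r a b → f a = f b}
  add_mem' hf hg a b h := by simp [hf a b h, hg a b h]
  zero_mem' _ _ _ := rfl
  smul_mem' c f hf a b h := by simp [hf a b h]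

/-- Functions that are constant on classes are functions on the quotient. -/
noncomputable def invariantFunctionsEquiv (r : Setoid α) :
    invariantFunctions r ≃ₗ[ZMod 2] (Quotient r → ZMod 2) where
  toFun f := Quotient.lift f.1 f.2
  map_add' f g := by
    funext x
    induction x using Quotient.inductionOn
    rfl
  map_smul' c f := by
    funext x
    induction x using Quotient.inductionOn
    rfl
  invFun g := ⟨fun a => g ⟦a⟧, fun _ _ h => congrArg g (Quotient.sound h)⟩
  left_inv f := rfl
  right_inv g := by
    funext x
    induction x using Quotient.inductionOn
    rfl

/-- Turns the numbers of edges, faces and components into dimensions over the field with two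
elements. -/
theorem finrank_invariantFunctions (r : Setoid α) :
    Module.finrank (ZMod 2) (invariantFunctions r) = Nat.card (Quotient r) := by
  have := Fintype.ofFinite (Quotient r)
  rw [(invariantFunctionsEquiv r).finrank_eq, Module.finrank_fintype_fun_eq_card,
    Nat.card_eq_fintype_card]

end Invariant

/-! ### Homological planarity -/

namespace RotationSystem

variable {V : Type*} {G : SimpleGraph V}

/-- Symmetric functions on darts, that is, functions on edges. -/
def edgeFunctions (G : SimpleGraph V) : Submodule (ZMod 2) (G.Dart → ZMod 2) :=
  invariantFunctions (Setoid.ker SimpleGraph.Dart.edge)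

theorem mem_edgeFunctions {z : G.Dart → ZMod 2} :
    z ∈ edgeFunctions G ↔ ∀ d, z d.symm = z d := by
  refine ⟨fun h d => h _ _ (SimpleGraph.Dart.edge_symm d), fun h a b hab => ?_⟩
  rcases (SimpleGraph.dart_edge_eq_iff a b).1 hab with rfl | rfl
  · rfl
  · exact h b

/-- Functions on vertices that are constant on connected components. -/
def componentFunctions (G : SimpleGraph V) : Submodule (ZMod 2) (V → ZMod 2) :=
  invariantFunctions G.reachableSetoid

theorem mem_componentFunctions {x : V → ZMod 2} :
    x ∈ componentFunctions G ↔ ∀ v w, G.Adj v w → x v = x w := by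
  refine ⟨fun h v w hvw => h v w hvw.reachable, fun h v w hvw => ?_⟩
  obtain ⟨p⟩ := hvw
  induction p with
  | nil => rfl
  | cons h' _ ih => exact (h _ _ h').trans ih

variable (R : RotationSystem G)

theorem facePerm_apply (d : G.Dart) : R.facePerm d = R.rot d.symm := rfl

theorem facePerm_symm (d : G.Dart) : R.facePerm d.symm = R.rot d := by
  rw [facePerm_apply, SimpleGraph.Dart.symm_symm]

theorem facePerm_fst (d : G.Dart) : (R.facePerm d).fst = d.snd := R.rot_fst d.symm

variable [Fintype V]

/-- Every cycle modulo 2 bounds a set of faces. -/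
def Exact : Prop :=
  ∀ z : G.Dart → ZMod 2, (∀ d, z d.symm = z d) →
    (∀ v, ∑ d : G.Dart with d.fst = v, z d = 0) →
    ∃ c : G.Dart → ZMod 2, (∀ d, c (R.facePerm d) = c d) ∧ ∀ d, c d + c d.symm = z d


theorem finrank_edgeFunctions :
    Module.finrank (ZMod 2) (edgeFunctions G) = Nat.card G.edgeSet := by
  rw [edgeFunctions, finrank_invariantFunctions]
  refine Nat.card_congr ((Setoid.quotientKerEquivRange _).trans (Equiv.setCongr ?_))
  ext e
  induction e using Sym2.ind with
  | _ x y =>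
    constructor
    · rintro ⟨d, hd⟩
      rw [← hd]
      exact d.edge_mem
    · intro h
      exact ⟨⟨(x, y), h⟩, rfl⟩

/-- Functions that are constant on facial walks. -/
def faceFunctions : Submodule (ZMod 2) (G.Dart → ZMod 2) :=
  invariantFunctions (Equiv.Perm.SameCycle.setoid R.facePerm)

theorem mem_faceFunctions {c : G.Dart → ZMod 2} :
    c ∈ R.faceFunctions ↔ ∀ d, c (R.facePerm d) = c d := by
  refine ⟨fun h d => h _ _ (Equiv.Perm.sameCycle_apply_left.2 (Equiv.Perm.SameCycle.refl _ _)),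
    fun h a b hab => ?_⟩
  obtain ⟨n, rfl⟩ := Equiv.Perm.SameCycle.exists_nat_pow_eq hab
  induction n with
  | zero => rfl
  | succ n ih =>
    rw [pow_succ', Equiv.Perm.mul_apply, h]
    exact ih ⟨n, by simp⟩

theorem finrank_faceFunctions :
    Module.finrank (ZMod 2) R.faceFunctions = Nat.card R.FacialWalk :=
  finrank_invariantFunctions _

/-- The boundary of a function on faces. -/
def boundary : R.faceFunctions →ₗ[ZMod 2] edgeFunctions G where
  toFun c := ⟨fun d => c.1 d + c.1 d.symm, mem_edgeFunctions.2 fun d => by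
    rw [SimpleGraph.Dart.symm_symm, add_comm]⟩
  map_add' c c' := by
    ext d
    simp only [Submodule.coe_add, Pi.add_apply]
    ring
  map_smul' a c := by
    ext d
    simp only [Submodule.coe_smul, Pi.smul_apply, smul_eq_mul, RingHom.id_apply]
    ring

/-- The boundary of a function on edges. -/
noncomputable def edgeBoundary (G : SimpleGraph V) :
    edgeFunctions G →ₗ[ZMod 2] (V → ZMod 2) where
  toFun z v := ∑ d : G.Dart with d.fst = v, z.1 d
  map_add' z z' := by
    funext v
    simp [Finset.sum_add_distrib]
  map_smul' a z := by
    funext v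
    simp [Finset.mul_sum]

/-- A face function satisfies `c d.symm = c (R.rot d)`, and the rotation permutes the darts at `v`,
so both halves of the sum agree and cancel modulo 2. -/
theorem edgeBoundary_boundary (c : R.faceFunctions) : edgeBoundary G (R.boundary c) = 0 := by
  funext v
  have hc := R.mem_faceFunctions.1 c.2
  have h1 : ∀ d : G.Dart, c.1 d.symm = c.1 (R.rot d) := fun d => by
    rw [← hc d.symm, R.facePerm_symm]
  change ∑ d : G.Dart with d.fst = v, (c.1 d + c.1 d.symm) = 0
  rw [Finset.sum_add_distrib]
  have h2 : ∑ d : G.Dart with d.fst = v, c.1 d.symm = ∑ d : G.Dart with d.fst = v, c.1 d := by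
    refine Finset.sum_bij (fun d _ => R.rot d) ?_ (fun _ _ _ _ h => R.rot.injective h) ?_
      (fun d _ => h1 d)
    · intro d hd
      simpa [R.rot_fst] using hd
    · intro d hd
      refine ⟨R.rot.symm d, ?_, by simp⟩
      have := R.rot_fst (R.rot.symm d)
      simp only [Equiv.apply_symm_apply] at this
      simpa [← this] using hd
  rw [h2]
  exact CharTwo.add_self_eq_zero _

theorem range_boundary_le : LinearMap.range R.boundary ≤ LinearMap.ker (edgeBoundary G) := by
  rintro _ ⟨c, rfl⟩
  exact R.edgeBoundary_boundary c

theorem exact_iff : R.Exact ↔ LinearMap.ker (edgeBoundary G) ≤ LinearMap.range R.boundary := by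
  constructor
  · intro h z hz
    obtain ⟨c, hc, hcz⟩ := h z.1 (mem_edgeFunctions.1 z.2) fun v => congrFun hz v
    exact ⟨⟨c, R.mem_faceFunctions.2 hc⟩, Subtype.ext (funext hcz)⟩
  · intro h z hz hv
    obtain ⟨c, hc⟩ := h (show (⟨z, mem_edgeFunctions.2 hz⟩ : edgeFunctions G) ∈ _ from funext hv)
    exact ⟨c.1, R.mem_faceFunctions.1 c.2, fun d => congrFun (congrArg Subtype.val hc) d⟩

theorem finrank_componentFunctions :
    Module.finrank (ZMod 2) (componentFunctions G) = Nat.card G.ConnectedComponent :=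
  finrank_invariantFunctions _

/-- A function on faces without boundary is constant on the darts that leave a vertex. -/
theorem eq_of_fst_eq {c : G.Dart → ZMod 2} (hc : ∀ d, c (R.facePerm d) = c d)
    (hs : ∀ d, c d + c d.symm = 0) {d e : G.Dart} (h : d.fst = e.fst) : c d = c e := by
  obtain ⟨n, hn⟩ := (R.sameCycle_of_fst_eq d e h).exists_nat_pow_eq
  clear h
  induction n generalizing e with
  | zero => rw [← hn]; rfl
  | succ n ih =>
    rw [pow_succ', Equiv.Perm.mul_apply] at hn
    rw [ih rfl, ← hn, ← R.facePerm_symm, hc]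
    exact CharTwo.add_eq_zero.1 (hs _)

/-- A face function without boundary does not change around a vertex or across an edge, so it is a
function on the components that have an edge; values on isolated vertices can be prescribed
independently. -/
theorem finrank_ker_boundary_add_le :
    Module.finrank (ZMod 2) (LinearMap.ker R.boundary) +
      Nat.card {v : V // ∀ w, ¬ G.Adj v w} ≤ Nat.card G.ConnectedComponent := by
  have hk : ∀ c ∈ LinearMap.ker R.boundary, ∀ d, c.1 d + c.1 d.symm = 0 := fun c hc d =>
    congrFun (congrArg Subtype.val hc) d
  let f : (LinearMap.ker R.boundary × ({v : V // ∀ w, ¬ G.Adj v w} → ZMod 2)) →ₗ[ZMod 2]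
      componentFunctions G :=
    { toFun := fun p => ⟨fun v => if h : ∃ w, G.Adj v w
          then p.1.1.1 ⟨(v, h.choose), h.choose_spec⟩
          else p.2 ⟨v, fun w hw => h ⟨w, hw⟩⟩, mem_componentFunctions.2 fun v w hvw => by
        have hv : ∃ w, G.Adj v w := ⟨w, hvw⟩
        have hw : ∃ v, G.Adj w v := ⟨v, hvw.symm⟩
        rw [dif_pos hv, dif_pos hw]
        have hc := R.mem_faceFunctions.1 p.1.1.2
        have hs := hk _ p.1.2
        exact (R.eq_of_fst_eq hc hs (d := ⟨(v, _), hv.choose_spec⟩) (e := ⟨(v, w), hvw⟩) rfl).trans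
          ((CharTwo.add_eq_zero.1 (hs ⟨(v, w), hvw⟩)).trans
            (R.eq_of_fst_eq hc hs (d := ⟨(w, v), hvw.symm⟩) (e := ⟨(w, _), hw.choose_spec⟩) rfl))⟩
      map_add' := fun p q => by
        ext v
        simp only [Submodule.coe_add, Pi.add_apply, Prod.fst_add, Prod.snd_add]
        split_ifs <;> rfl
      map_smul' := fun a p => by
        ext v
        simp only [Submodule.coe_smul, Pi.smul_apply, Prod.smul_fst, Prod.smul_snd,
          RingHom.id_apply]
        split_ifs <;> rfl }
  have hf : Function.Injective f := by
    rw [← LinearMap.ker_eq_bot, LinearMap.ker_eq_bot']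
    rintro ⟨c, g⟩ h
    have hv : ∀ v, (f (c, g)).1 v = 0 := fun v => by rw [h]; rfl
    refine Prod.ext ?_ ?_
    · ext d
      have h1 := hv d.fst
      have hd : ∃ w, G.Adj d.fst w := ⟨_, d.adj⟩
      change (if h : ∃ w, G.Adj d.fst w then _ else _) = _ at h1
      rw [dif_pos hd] at h1
      refine Eq.trans ?_ h1
      exact R.eq_of_fst_eq (R.mem_faceFunctions.1 c.1.2) (hk _ c.2) rfl
    · funext v
      have h1 := hv v.1
      have hd : ¬ ∃ w, G.Adj v.1 w := fun ⟨w, hw⟩ => v.2 w hw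
      change (if h : ∃ w, G.Adj v.1 w then _ else _) = _ at h1
      rw [dif_neg hd] at h1
      exact h1
  have := LinearMap.finrank_le_finrank_of_injective hf
  rwa [Module.finrank_prod, Module.finrank_fintype_fun_eq_card, finrank_componentFunctions,
    ← Nat.card_eq_fintype_card] at this

/-- A functional that kills all edge boundaries takes equal values at the ends of each edge, so the
kernel of the dual map embeds into the component functions; rank-nullity for the dual map does the
rest. -/
theorem card_le_finrank_range_edgeBoundary_add :
    Nat.card V ≤ Module.finrank (ZMod 2) (LinearMap.range (edgeBoundary G)) +
      Nat.card G.ConnectedComponent := by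
  have h1 := LinearMap.finrank_range_dualMap_eq_finrank_range (edgeBoundary G)
  have h2 := LinearMap.finrank_range_add_finrank_ker (edgeBoundary G).dualMap
  rw [Subspace.dual_finrank_eq, Module.finrank_fintype_fun_eq_card, h1] at h2
  let f : LinearMap.ker (edgeBoundary G).dualMap →ₗ[ZMod 2] componentFunctions G :=
    { toFun := fun x => ⟨fun v => x.1 (Pi.single v 1), mem_componentFunctions.2 fun v w hvw => by
        have hx : x.1 ∘ₗ edgeBoundary G = 0 := x.2
        -- The indicator of the edge `vw`, whose boundary is `v + w`.
        let z : G.Dart → ZMod 2 := fun d => if d.edge = s(v, w) then 1 else 0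
        have hz : z ∈ edgeFunctions G := mem_edgeFunctions.2 fun d => by simp [z]
        have hb : edgeBoundary G ⟨z, hz⟩ = Pi.single v 1 + Pi.single w 1 := by
          funext u
          change ∑ d : G.Dart with d.fst = u, z d = _
          simp only [z, Finset.sum_boole, Finset.filter_filter]
          have hne := hvw.ne
          by_cases huv : u = v
          · subst huv
            have : ({d : G.Dart | d.fst = u ∧ d.edge = s(u, w)} : Finset G.Dart) =
                {⟨(u, w), hvw⟩} := by
              ext d
              simp only [Finset.mem_filter, Finset.mem_univ, true_and, Finset.mem_singleton,
                SimpleGraph.dart_edge_eq_mk'_iff', SimpleGraph.Dart.ext_iff, Prod.ext_iff]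
              grind
            simp [this, hne]
          · by_cases huw : u = w
            · subst huw
              have : ({d : G.Dart | d.fst = u ∧ d.edge = s(v, u)} : Finset G.Dart) =
                  {⟨(u, v), hvw.symm⟩} := by
                ext d
                simp only [Finset.mem_filter, Finset.mem_univ, true_and, Finset.mem_singleton,
                  SimpleGraph.dart_edge_eq_mk'_iff', SimpleGraph.Dart.ext_iff, Prod.ext_iff]
                grind
              simp [this, huv]
            · have : ({d : G.Dart | d.fst = u ∧ d.edge = s(v, w)} : Finset G.Dart) = ∅ := by
                ext d
                simp only [Finset.mem_filter, Finset.mem_univ, true_and, Finset.notMem_empty,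
                  SimpleGraph.dart_edge_eq_mk'_iff']
                grind
              simp [this, huv, huw]
        have h3 := LinearMap.congr_fun hx ⟨z, hz⟩
        simp only [LinearMap.comp_apply, hb, map_add, LinearMap.zero_apply] at h3
        exact CharTwo.add_eq_zero.1 h3⟩
      map_add' := fun x y => rfl
      map_smul' := fun a x => rfl }
  have hf : Function.Injective f := by
    intro x y h
    ext v
    have h' : x.1 (Pi.single v 1) = y.1 (Pi.single v 1) := congrFun (congrArg Subtype.val h) v
    simpa using h'
  have h3 := LinearMap.finrank_le_finrank_of_injective hf
  rw [finrank_componentFunctions] at h3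
  rw [Nat.card_eq_fintype_card]
  omega

/-- With $c$ components, the cycle space has dimension at most $|E|-|V|+c$ and the space of
boundaries dimension at least $|F|-c$. Euler's formula says that these bounds are equal, and
boundaries are cycles. -/
theorem exact_of_euler (h : Nat.card V + R.numFaces =
    Nat.card G.edgeSet + 2 * Nat.card G.ConnectedComponent) : R.Exact := by
  have h1 := LinearMap.finrank_range_add_finrank_ker R.boundary
  have h2 := LinearMap.finrank_range_add_finrank_ker (edgeBoundary G)
  have h3 := R.finrank_ker_boundary_add_le
  have h4 := card_le_finrank_range_edgeBoundary_add (G := G)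
  rw [finrank_faceFunctions] at h1
  rw [finrank_edgeFunctions] at h2
  unfold numFaces at h
  exact R.exact_iff.2 (Submodule.eq_of_le_of_finrank_le R.range_boundary_le (by omega)).ge

/-- Euler's inequality. -/
theorem Exact.card_edgeSet_add_two_le (h : R.Exact) [Nonempty G.Dart] :
    Nat.card G.edgeSet + 2 ≤ Nat.card V + Nat.card R.FacialWalk := by
  have h1 := LinearMap.finrank_range_add_finrank_ker R.boundary
  have h2 := LinearMap.finrank_range_add_finrank_ker (edgeBoundary G)
  rw [finrank_faceFunctions] at h1
  rw [finrank_edgeFunctions] at h2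
  have h3 := Submodule.finrank_mono (R.exact_iff.1 h)
  -- One unit of the 2: the constant function on faces has no boundary.
  have h4 : 0 < Module.finrank (ZMod 2) (LinearMap.ker R.boundary) := by
    rw [Module.finrank_pos_iff_exists_ne_zero]
    refine ⟨⟨⟨fun _ => 1, R.mem_faceFunctions.2 fun _ => rfl⟩, ?_⟩, ?_⟩
    · refine Subtype.ext (funext fun d => ?_)
      exact CharTwo.add_self_eq_zero _
    · intro h0
      have := congrFun (congrArg (fun x => x.1.1) h0) (Classical.arbitrary G.Dart)
      exact one_ne_zero this
  -- The other unit: the values of an edge boundary sum to 0, each edge being counted at both ends,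
  -- so a single vertex is not a boundary.
  have h5 : Module.finrank (ZMod 2) (LinearMap.range (edgeBoundary G)) < Nat.card V := by
    rw [Nat.card_eq_fintype_card, ← Module.finrank_fintype_fun_eq_card (ZMod 2) (η := V)]
    refine Submodule.finrank_lt fun htop => ?_
    obtain ⟨z, hz⟩ := (LinearMap.range_eq_top.1 htop)
      (Pi.single (Classical.arbitrary G.Dart).fst 1)
    have h6 : ∑ v, edgeBoundary G z v = 0 := by
      change ∑ v, ∑ d : G.Dart with d.fst = v, z.1 d = 0
      trans ∑ d, z.1 d
      · convert Finset.sum_fiberwise Finset.univ (fun d : G.Dart => d.fst) z.1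
      refine Finset.sum_involution (fun d _ => d.symm) ?_ ?_ ?_ ?_
      · intro d _
        rw [mem_edgeFunctions.1 z.2]
        exact CharTwo.add_self_eq_zero _
      · intro d _ _
        exact d.symm_ne
      · simp
      · simp
    rw [hz] at h6
    simp at h6
  omega

/-! ### Restriction to induced subgraphs -/

section Restrict

variable (s : Set V)

/-- The darts of an induced subgraph. -/
def inducedDartEquiv :
    {d : G.Dart // d.fst ∈ s ∧ d.snd ∈ s} ≃ (G.induce s).Dart where
  toFun d := ⟨(⟨d.1.fst, d.2.1⟩, ⟨d.1.snd, d.2.2⟩), d.1.adj⟩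
  invFun d := ⟨⟨(d.fst.1, d.snd.1), d.adj⟩, d.fst.2, d.snd.2⟩
  left_inv _ := rfl
  right_inv _ := rfl

/-- The rotation system of an induced subgraph. -/
noncomputable def induce : RotationSystem (G.induce s) where
  rot := (inducedDartEquiv s).permCongr (firstReturn R.rot fun d => d.fst ∈ s ∧ d.snd ∈ s)
  rot_fst d := by
    have h : ∀ (n : ℕ) (d : G.Dart), ((R.rot ^ n) d).fst = d.fst := by
      intro n d
      induction n with
      | zero => rfl
      | succ n ih => rw [pow_succ', Equiv.Perm.mul_apply, R.rot_fst, ih]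
    exact Subtype.ext (h _ _)
  sameCycle_of_fst_eq d e h := by
    obtain ⟨n, hn⟩ := sameCycle_firstReturn R.rot (fun d => d.fst ∈ s ∧ d.snd ∈ s)
      ((inducedDartEquiv s).symm d) ((inducedDartEquiv s).symm e)
      (R.sameCycle_of_fst_eq _ _ (congrArg Subtype.val h))
    refine ⟨n, ?_⟩
    rw [← Equiv.permCongrHom_coe, ← map_zpow, Equiv.permCongrHom_coe, Equiv.permCongr_apply, hn,
      Equiv.apply_symm_apply]

/-- Extend a cycle of the subgraph by zero and bound it in the whole graph. The face colouring does
not change across deleted darts, so it is also constant on the merged faces of the subgraph. -/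
theorem Exact.induce {R : RotationSystem G} (h : R.Exact) : (R.induce s).Exact := by
  intro z hz hv
  let P : G.Dart → Prop := fun d => d.fst ∈ s ∧ d.snd ∈ s
  let z' : G.Dart → ZMod 2 := fun d => if hd : P d then z (inducedDartEquiv s ⟨d, hd⟩) else 0
  have hz'P : ∀ d : {d // P d}, z' d = z (inducedDartEquiv s d) := fun d => dif_pos d.2
  obtain ⟨c, hc, hcz⟩ := h z' (by
    intro d
    by_cases hd : P d
    · have hd' : P d.symm := ⟨hd.2, hd.1⟩
      rw [hz'P ⟨d, hd⟩, hz'P ⟨_, hd'⟩, ← hz]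
      rfl
    · have hd' : ¬ P d.symm := fun h => hd ⟨h.2, h.1⟩
      simp [z', hd, hd']) (by
    intro v
    by_cases hvs : v ∈ s
    · rw [← hv ⟨v, hvs⟩]
      symm
      refine Finset.sum_bij_ne_zero (fun d _ _ => ((inducedDartEquiv s).symm d).1) ?_ ?_ ?_ ?_
      · intro d hd _
        have hd : d.fst = ⟨v, hvs⟩ := by simpa using hd
        simp only [Finset.mem_filter, Finset.mem_univ, true_and]
        exact congrArg Subtype.val hd
      · intro d _ _ e _ _ hde
        exact (inducedDartEquiv s).symm.injective (Subtype.ext hde)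
      · intro d hd hne
        have hP : P d := by
          by_contra hP
          exact hne (dif_neg hP)
        refine ⟨inducedDartEquiv s ⟨d, hP⟩, ?_, ?_, ?_⟩
        · have hd : d.fst = v := by simpa using hd
          simp only [Finset.mem_filter, Finset.mem_univ, true_and]
          exact Subtype.ext hd
        · rwa [← hz'P ⟨d, hP⟩]
        · rw [Equiv.symm_apply_apply]
      · intro d _ _
        rw [hz'P, Equiv.apply_symm_apply]
    · refine Finset.sum_eq_zero fun d hd => dif_neg fun hP => hvs ?_
      have hd : d.fst = v := by simpa using hd
      exact hd ▸ hP.1)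
  have hrot : ∀ d, c (R.rot d) = c d + z' d := by
    intro d
    rw [← R.facePerm_symm, hc, ← hcz, ← add_assoc, CharTwo.add_self_eq_zero, zero_add]
  -- The colour changes only in the first rotation step; all later darts before the return are
  -- deleted ones, where `z'` vanishes.
  have hpow : ∀ (d : {d // P d}) (n : ℕ), 0 < n → n ≤ returnTime R.rot P d →
      c ((R.rot ^ n) d) = c d + z' d := by
    intro d n hn
    induction n, hn using Nat.le_induction with
    | base => intro _; rw [pow_one, hrot]
    | succ n hn ih =>
      intro hle
      have hnP : ¬ P ((R.rot ^ n) d) := fun h => by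
        have := returnTime_le R.rot P d hn h
        omega
      rw [pow_succ', Equiv.Perm.mul_apply, hrot, ih (by omega)]
      simp [z', hnP]
  refine ⟨fun d => c ((inducedDartEquiv s).symm d).1, fun d => ?_, fun d => ?_⟩
  · have h1 := hpow ((inducedDartEquiv s).symm d.symm) _ (returnTime_pos _ _ _) le_rfl
    rw [← hcz] at h1
    change c ((inducedDartEquiv s).symm (inducedDartEquiv s _)).1 = _
    rw [Equiv.symm_apply_apply]
    refine h1.trans ?_
    rw [← add_assoc, CharTwo.add_self_eq_zero, zero_add]
    rfl
  · rw [← (inducedDartEquiv s).apply_symm_apply d, ← hz'P, ← hcz]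
    rfl

end Restrict

end RotationSystem

/-! ### Sums over the cycles of a permutation -/

section Orbits

open Function

variable {α : Type*} [Fintype α] (σ : Equiv.Perm α)

theorem minimalPeriod_perm_pos (a : α) : 0 < minimalPeriod σ a :=
  minimalPeriod_pos_of_mem_periodicPts (σ.injective.mem_periodicPts a)

theorem sum_sameCycle (x : α → ℚ) (a : α) :
    ∑ b with σ.SameCycle a b, x b = ∑ i ∈ Finset.range (minimalPeriod σ a), x (σ^[i] a) := by
  symm
  refine Finset.sum_bij (fun i _ => σ^[i] a) ?_ ?_ ?_ (fun _ _ => rfl)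
  · intro i _
    simp only [Finset.mem_filter, Finset.mem_univ, true_and]
    exact ⟨i, by rw [zpow_natCast, Equiv.Perm.iterate_eq_pow]⟩
  · intro i hi j hj h
    exact (iterate_eq_iterate_iff_of_lt_minimalPeriod (by simpa using hi) (by simpa using hj)).1 h
  · intro b hb
    simp only [Finset.mem_filter, Finset.mem_univ, true_and] at hb
    obtain ⟨n, hn⟩ := hb.exists_nat_pow_eq
    refine ⟨n % minimalPeriod σ a, ?_, ?_⟩
    · simpa using Nat.mod_lt _ (minimalPeriod_perm_pos σ a)
    · rw [iterate_mod_minimalPeriod_eq, Equiv.Perm.iterate_eq_pow, hn]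

theorem sum_nonneg_of_orbits (x : α → ℚ)
    (h : ∀ a, 0 ≤ ∑ i ∈ Finset.range (minimalPeriod σ a), x (σ^[i] a)) : 0 ≤ ∑ a, x a := by
  rw [← Finset.sum_fiberwise Finset.univ (fun a => (⟦a⟧ : Quotient (Equiv.Perm.SameCycle.setoid σ)))]
  refine Finset.sum_nonneg fun q _ => ?_
  induction q using Quotient.inductionOn with
  | _ a =>
    refine (h a).trans_eq ?_
    rw [← sum_sameCycle]
    refine Finset.sum_congr ?_ fun _ _ => rfl
    ext b
    simp only [Finset.mem_filter, Finset.mem_univ, true_and]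
    rw [Quotient.eq]
    exact Equiv.Perm.sameCycle_comm

/-- A cycle of length $n$ contributes $n\cdot\frac1n$. This allows face charges to be spread over
darts. -/
theorem sum_inv_minimalPeriod :
    ∑ a, (1 / minimalPeriod σ a : ℚ) = Nat.card (Quotient (Equiv.Perm.SameCycle.setoid σ)) := by
  rw [← Finset.sum_fiberwise Finset.univ (fun a => (⟦a⟧ : Quotient (Equiv.Perm.SameCycle.setoid σ)))]
  have : ∀ q : Quotient (Equiv.Perm.SameCycle.setoid σ),
      ∑ a with ⟦a⟧ = q, (1 / minimalPeriod σ a : ℚ) = 1 := by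
    intro q
    induction q using Quotient.inductionOn with
    | _ a =>
      have h1 : ({b | (⟦b⟧ : Quotient (Equiv.Perm.SameCycle.setoid σ)) = ⟦a⟧} : Finset α) =
          ({b | σ.SameCycle a b} : Finset α) := by
        ext b
        simp only [Finset.mem_filter, Finset.mem_univ, true_and]
        rw [Quotient.eq]
        exact Equiv.Perm.sameCycle_comm
      rw [h1, sum_sameCycle]
      have h2 : ∀ i, minimalPeriod σ (σ^[i] a) = minimalPeriod σ a := fun i =>
        minimalPeriod_apply_iterate (σ.injective.mem_periodicPts a) i
      have := minimalPeriod_perm_pos σ a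
      simp only [h2, Finset.sum_const, Finset.card_range, nsmul_eq_mul]
      field_simp
  rw [Finset.sum_congr rfl fun q _ => this q, Nat.card_eq_fintype_card]
  simp

end Orbits

namespace RotationSystem

open Function

variable {V : Type*} {G : SimpleGraph V} (R : RotationSystem G)

/-! ### Turns -/

/-- A face passes through `a`, `b`, `c` in this order. -/
def Turn (a b c : V) : Prop :=
  ∃ (h : G.Adj a b) (h' : G.Adj b c), R.rot ⟨(b, a), h.symm⟩ = ⟨(b, c), h'⟩

variable {R}

theorem Turn.adj_left {a b c : V} (h : R.Turn a b c) : G.Adj a b := h.1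

theorem Turn.adj_right {a b c : V} (h : R.Turn a b c) : G.Adj b c := h.2.1

theorem Turn.right_unique {a b c d : V} (h : R.Turn a b c) (h' : R.Turn a b d) : c = d := by
  obtain ⟨_, _, h⟩ := h
  obtain ⟨_, _, h'⟩ := h'
  have := h.symm.trans h'
  simpa using this

theorem Turn.left_unique {a b c d : V} (h : R.Turn a b d) (h' : R.Turn c b d) : a = c := by
  obtain ⟨_, _, h⟩ := h
  obtain ⟨_, _, h'⟩ := h'
  have := R.rot.injective (h.trans h'.symm)
  simpa using this

variable (R)

theorem turn_rot (d : G.Dart) : R.Turn d.snd d.fst (R.rot d).snd := by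
  have h := R.rot_fst d
  refine ⟨d.adj.symm, h ▸ (R.rot d).adj, ?_⟩
  change R.rot d = _
  exact SimpleGraph.Dart.ext _ _ (Prod.ext h rfl)

theorem turn_facePerm (d : G.Dart) : R.Turn d.fst d.snd (R.facePerm d).snd :=
  R.turn_rot d.symm

theorem turn_iff (d : G.Dart) (c : V) : R.Turn d.fst d.snd c ↔ (R.facePerm d).snd = c :=
  ⟨fun h => (R.turn_facePerm d).right_unique h, fun h => h ▸ R.turn_facePerm d⟩

theorem facePerm_ne (d : G.Dart) : R.facePerm d ≠ d := fun h => by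
  have := R.facePerm_fst d
  rw [h] at this
  exact d.fst_ne_snd this

/-- The length of the facial walk that contains `d`. -/
noncomputable def faceSize (d : G.Dart) : ℕ := minimalPeriod R.facePerm d

theorem iterate_faceSize (d : G.Dart) : R.facePerm^[R.faceSize d] d = d :=
  iterate_minimalPeriod

theorem turn_iterate (d : G.Dart) (n : ℕ) :
    R.Turn (R.facePerm^[n] d).fst (R.facePerm^[n + 1] d).fst (R.facePerm^[n + 2] d).fst := by
  have h := R.turn_facePerm (R.facePerm^[n] d)
  rw [iterate_succ_apply', iterate_succ_apply', iterate_succ_apply', R.facePerm_fst,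
    R.facePerm_fst]
  exact h

/-- `a`, `b`, `c` is a facial triangle. -/
def Tri (a b c : V) : Prop := R.Turn a b c ∧ R.Turn b c a ∧ R.Turn c a b

/-- `a`, `b`, `c`, `d` is a facial walk of length four. -/
def Quad (a b c d : V) : Prop := R.Turn a b c ∧ R.Turn b c d ∧ R.Turn c d a ∧ R.Turn d a b

/-- `a`, `b`, `c`, `d`, `e` is a facial walk of length five. -/
def Pent (a b c d e : V) : Prop :=
  R.Turn a b c ∧ R.Turn b c d ∧ R.Turn c d e ∧ R.Turn d e a ∧ R.Turn e a b

/-- `a`, `b`, `c`, `d`, `e`, `f` is a facial walk of length six. -/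
def Hex (a b c d e f : V) : Prop :=
  R.Turn a b c ∧ R.Turn b c d ∧ R.Turn c d e ∧ R.Turn d e f ∧ R.Turn e f a ∧ R.Turn f a b

theorem tri_of_faceSize {d : G.Dart} (h : R.faceSize d = 3) :
    R.Tri d.fst d.snd (R.facePerm d).snd := by
  have h0 := R.iterate_faceSize d
  rw [h] at h0
  have h1 := R.turn_iterate d 0
  have h2 := R.turn_iterate d 1
  have h3 := R.turn_iterate d 2
  simp only [iterate_succ_apply', iterate_zero, id, R.facePerm_fst] at h0 h1 h2 h3
  have e : (R.facePerm (R.facePerm d)).snd = d.fst := by rw [← R.facePerm_fst, h0]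
  rw [h0] at h3
  rw [e] at h2 h3
  exact ⟨h1, h2, h3⟩

theorem quad_of_faceSize {d : G.Dart} (h : R.faceSize d = 4) :
    R.Quad d.fst d.snd (R.facePerm d).snd (R.facePerm (R.facePerm d)).snd := by
  have h0 := R.iterate_faceSize d
  rw [h] at h0
  have h1 := R.turn_iterate d 0
  have h2 := R.turn_iterate d 1
  have h3 := R.turn_iterate d 2
  have h4 := R.turn_iterate d 3
  simp only [iterate_succ_apply', iterate_zero, id, R.facePerm_fst] at h0 h1 h2 h3 h4
  have e : (R.facePerm (R.facePerm (R.facePerm d))).snd = d.fst := by rw [← R.facePerm_fst, h0]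
  rw [h0] at h4
  rw [e] at h3 h4
  exact ⟨h1, h2, h3, h4⟩

theorem pent_of_faceSize {d : G.Dart} (h : R.faceSize d = 5) :
    R.Pent d.fst d.snd (R.facePerm d).snd (R.facePerm (R.facePerm d)).snd
      (R.facePerm (R.facePerm (R.facePerm d))).snd := by
  have h0 := R.iterate_faceSize d
  rw [h] at h0
  have h1 := R.turn_iterate d 0
  have h2 := R.turn_iterate d 1
  have h3 := R.turn_iterate d 2
  have h4 := R.turn_iterate d 3
  have h5 := R.turn_iterate d 4
  simp only [iterate_succ_apply', iterate_zero, id, R.facePerm_fst] at h0 h1 h2 h3 h4 h5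
  have e : (R.facePerm (R.facePerm (R.facePerm (R.facePerm d)))).snd = d.fst := by
    rw [← R.facePerm_fst, h0]
  rw [h0] at h5
  rw [e] at h4 h5
  exact ⟨h1, h2, h3, h4, h5⟩

theorem hex_of_faceSize {d : G.Dart} (h : R.faceSize d = 6) :
    R.Hex d.fst d.snd (R.facePerm d).snd (R.facePerm (R.facePerm d)).snd
      (R.facePerm (R.facePerm (R.facePerm d))).snd
      (R.facePerm (R.facePerm (R.facePerm (R.facePerm d)))).snd := by
  have h0 := R.iterate_faceSize d
  rw [h] at h0
  have h1 := R.turn_iterate d 0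
  have h2 := R.turn_iterate d 1
  have h3 := R.turn_iterate d 2
  have h4 := R.turn_iterate d 3
  have h5 := R.turn_iterate d 4
  have h6 := R.turn_iterate d 5
  simp only [iterate_succ_apply', iterate_zero, id, R.facePerm_fst] at h0 h1 h2 h3 h4 h5 h6
  have e : (R.facePerm (R.facePerm (R.facePerm (R.facePerm (R.facePerm d))))).snd = d.fst := by
    rw [← R.facePerm_fst, h0]
  rw [h0] at h6
  rw [e] at h5 h6
  exact ⟨h1, h2, h3, h4, h5, h6⟩

theorem faceSize_of_tri {d : G.Dart} {c : V} (h : R.Tri d.fst d.snd c) : R.faceSize d = 3 := by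
  obtain ⟨h1, h2, h3⟩ := h
  have e1 : R.facePerm d = ⟨(d.snd, c), h2.adj_left⟩ :=
    SimpleGraph.Dart.ext _ _ (Prod.ext (R.facePerm_fst d) ((R.turn_iff d c).1 h1))
  have e2 : R.facePerm (R.facePerm d) = ⟨(c, d.fst), h3.adj_left⟩ := by
    rw [e1]
    exact SimpleGraph.Dart.ext _ _ (Prod.ext (R.facePerm_fst _) ((R.turn_iff _ _).1 h2))
  have e3 : R.facePerm (R.facePerm (R.facePerm d)) = d := by
    rw [e2]
    exact SimpleGraph.Dart.ext _ _ (Prod.ext (R.facePerm_fst _) ((R.turn_iff _ _).1 h3))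
  have hdvd : R.faceSize d ∣ 3 := IsPeriodicPt.minimalPeriod_dvd (f := R.facePerm) (n := 3) e3
  rcases (Nat.dvd_prime Nat.prime_three).1 hdvd with h | h
  · exact absurd (minimalPeriod_eq_one_iff_isFixedPt.1 h) (R.facePerm_ne d)
  · exact h

variable [Fintype V]

theorem minimalPeriod_rot (d : G.Dart) : minimalPeriod R.rot d = G.degree d.fst := by
  have h := sum_sameCycle R.rot (fun _ => 1) d
  simp only [Finset.sum_const, Finset.card_range, nsmul_eq_mul, mul_one] at h
  have h' : ({e | R.rot.SameCycle d e} : Finset G.Dart) = ({e | e.fst = d.fst} : Finset G.Dart) := by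
    ext e
    simp only [Finset.mem_filter, Finset.mem_univ, true_and]
    refine ⟨fun he => ?_, fun he => R.sameCycle_of_fst_eq _ _ he.symm⟩
    obtain ⟨n, rfl⟩ := he.exists_nat_pow_eq
    clear he
    induction n with
    | zero => rfl
    | succ n ih => rw [pow_succ', Equiv.Perm.mul_apply, R.rot_fst, ih]
  rw [← Nat.cast_inj (R := ℚ), ← h, ← SimpleGraph.dart_fst_fiber_card_eq_degree]
  congr 2
  convert h'

theorem sum_darts_at (x : G.Dart → ℚ) (d : G.Dart) :
    ∑ e : G.Dart with e.fst = d.fst, x e =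
      ∑ i ∈ Finset.range (G.degree d.fst), x (R.rot^[i] d) := by
  rw [← R.minimalPeriod_rot, ← sum_sameCycle]
  refine Finset.sum_congr ?_ fun _ _ => rfl
  ext e
  simp only [Finset.mem_filter, Finset.mem_univ, true_and]
  refine ⟨fun he => R.sameCycle_of_fst_eq _ _ he.symm, fun he => ?_⟩
  obtain ⟨n, rfl⟩ := he.exists_nat_pow_eq
  clear he
  induction n with
  | zero => rfl
  | succ n ih => rw [pow_succ', Equiv.Perm.mul_apply, R.rot_fst, ih]

theorem faceSize_facePerm (d : G.Dart) : R.faceSize (R.facePerm d) = R.faceSize d :=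
  minimalPeriod_apply (R.facePerm.injective.mem_periodicPts d)

theorem faceSize_iterate (d : G.Dart) (n : ℕ) :
    R.faceSize (R.facePerm^[n] d) = R.faceSize d :=
  minimalPeriod_apply_iterate (R.facePerm.injective.mem_periodicPts d) n

theorem faceSize_rot (d : G.Dart) : R.faceSize (R.rot d) = R.faceSize d.symm := by
  rw [← R.facePerm_symm, faceSize_facePerm]

/-- The rotation at `b` closes up after two steps, and its cycle consists of all darts at `b`. With
its variants for one and three steps, this turns coincidences of vertices in face configurations
into low degree. -/
theorem degree_le_of_turn_two {a b c : V} (h : R.Turn a b c) (h' : R.Turn c b a) :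
    G.degree b ≤ 2 := by
  obtain ⟨h1, h2, h⟩ := h
  obtain ⟨_, _, h'⟩ := h'
  have := R.minimalPeriod_rot ⟨(b, a), h1.symm⟩
  rw [← this]
  refine IsPeriodicPt.minimalPeriod_le (by norm_num) ?_
  change R.rot (R.rot _) = _
  rw [h, h']

theorem degree_le_of_turn_one {a b : V} (h : R.Turn a b a) : G.degree b ≤ 1 := by
  obtain ⟨h1, h2, h⟩ := h
  have := R.minimalPeriod_rot ⟨(b, a), h1.symm⟩
  rw [← this]
  refine IsPeriodicPt.minimalPeriod_le (by norm_num) ?_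
  exact h

theorem degree_le_of_turn_three {a b c d : V} (h : R.Turn a b c) (h' : R.Turn c b d)
    (h'' : R.Turn d b a) : G.degree b ≤ 3 := by
  obtain ⟨h1, h2, h⟩ := h
  obtain ⟨_, _, h'⟩ := h'
  obtain ⟨_, _, h''⟩ := h''
  have := R.minimalPeriod_rot ⟨(b, a), h1.symm⟩
  rw [← this]
  refine IsPeriodicPt.minimalPeriod_le (by norm_num) ?_
  change R.rot (R.rot (R.rot _)) = _
  rw [h, h', h'']

theorem sum_one_div_faceSize :
    ∑ d, (1 / R.faceSize d : ℚ) = Nat.card R.FacialWalk :=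
  sum_inv_minimalPeriod R.facePerm

theorem card_dart : (Fintype.card G.Dart : ℚ) = 2 * Nat.card G.edgeSet := by
  rw [SimpleGraph.dart_card_eq_twice_card_edges, SimpleGraph.edgeFinset_card,
    Nat.card_eq_fintype_card]
  push_cast
  rfl

/-- Euler's inequality for the charges `p * deg v - q` on the vertices and
`r * |f| - q` on the faces. -/
theorem Exact.sum_charge_le {R : RotationSystem G} (h : R.Exact) [Nonempty G.Dart] {p q r : ℚ}
    (hq : 0 ≤ q) (hpq : 2 * p + 2 * r = q) :
    ∑ v, (p * G.degree v - q) + ∑ d, (r - q * (1 / R.faceSize d)) ≤ - (2 * q) := by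
  have h1 := h.card_edgeSet_add_two_le
  have h1' : (Nat.card G.edgeSet : ℚ) + 2 ≤ Nat.card V + Nat.card R.FacialWalk := by
    exact_mod_cast h1
  have h2 : ∑ v, (G.degree v : ℚ) = 2 * Nat.card G.edgeSet := by
    rw [← card_dart, SimpleGraph.dart_card_eq_sum_degrees]
    push_cast
    rfl
  rw [Finset.sum_sub_distrib, Finset.sum_sub_distrib, ← Finset.mul_sum, ← Finset.mul_sum, h2,
    R.sum_one_div_faceSize]
  simp only [Finset.sum_const, Finset.card_univ, nsmul_eq_mul, card_dart]
  rw [← Nat.card_eq_fintype_card (α := V)]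
  have h3 : (2 * p + 2 * r) * (Nat.card G.edgeSet : ℚ) = q * Nat.card G.edgeSet := by rw [hpq]
  nlinarith [mul_le_mul_of_nonneg_left h1' hq]

/-! ### Short faces -/

theorem faceSize_ge_three (h2 : ∀ v, 2 ≤ G.degree v) (d : G.Dart) : 3 ≤ R.faceSize d := by
  have h0 := minimalPeriod_perm_pos R.facePerm d
  have h := R.iterate_faceSize d
  change 0 < R.faceSize d at h0
  by_contra hlt
  have : R.faceSize d = 1 ∨ R.faceSize d = 2 := by omega
  rcases this with h1 | h1 <;> rw [h1] at h
  · exact R.facePerm_ne d h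
  · have h3 := R.turn_facePerm d
    have h4 := R.facePerm_fst (R.facePerm d)
    change R.facePerm (R.facePerm d) = d at h
    rw [h] at h4
    rw [← h4] at h3
    have := R.degree_le_of_turn_one h3
    have := h2 d.snd
    omega

end RotationSystem

/-! ### Short cycles -/

section Cycles

variable {V : Type*} {G : SimpleGraph V}

theorem hasCycleOfLength_five {a b c d e : V} (hab : G.Adj a b) (hbc : G.Adj b c) (hcd : G.Adj c d)
    (hde : G.Adj d e) (hea : G.Adj e a) (hac : a ≠ c) (had : a ≠ d) (hbd : b ≠ d) (hbe : b ≠ e)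
    (hce : c ≠ e) : HasCycleOfLength G 5 := by
  refine ⟨a, .cons hab (.cons hbc (.cons hcd (.cons hde (.cons hea .nil)))), ?_, rfl⟩
  rw [SimpleGraph.Walk.cons_isCycle_iff]
  have := hab.ne; have := hbc.ne; have := hcd.ne; have := hde.ne; have := hea.ne
  constructor
  · simp [SimpleGraph.Walk.isPath_def]
    grind
  · simp
    grind

theorem hasCycleOfLength_six {a b c d e f : V} (hab : G.Adj a b) (hbc : G.Adj b c)
    (hcd : G.Adj c d) (hde : G.Adj d e) (hef : G.Adj e f) (hfa : G.Adj f a)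
    (hac : a ≠ c) (had : a ≠ d) (hae : a ≠ e) (hbd : b ≠ d) (hbe : b ≠ e) (hbf : b ≠ f)
    (hce : c ≠ e) (hcf : c ≠ f) (hdf : d ≠ f) : HasCycleOfLength G 6 := by
  refine ⟨a, .cons hab (.cons hbc (.cons hcd (.cons hde (.cons hef (.cons hfa .nil))))), ?_, rfl⟩
  rw [SimpleGraph.Walk.cons_isCycle_iff]
  have := hab.ne; have := hbc.ne; have := hcd.ne; have := hde.ne; have := hef.ne; have := hfa.ne
  constructor
  · simp [SimpleGraph.Walk.isPath_def]
    grind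
  · simp
    grind

theorem HasCycleOfLength.of_induce {s : Set V} {k : ℕ} (h : HasCycleOfLength (G.induce s) k) :
    HasCycleOfLength G k := by
  obtain ⟨v, p, hp, hk⟩ := h
  exact ⟨v, p.map (SimpleGraph.Embedding.induce s).toHom,
    hp.map Subtype.val_injective, (p.length_map _).trans hk⟩

end Cycles

namespace RotationSystem

open Function

variable {V : Type*} {G : SimpleGraph V} (R : RotationSystem G)

theorem rot_iterate_fst (d : G.Dart) (n : ℕ) : (R.rot^[n] d).fst = d.fst := by
  induction n with
  | zero => rfl
  | succ n ih => rw [iterate_succ_apply', R.rot_fst, ih]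

variable [Fintype V]

theorem iterate_degree (d : G.Dart) : R.rot^[G.degree d.fst] d = d := by
  rw [← R.minimalPeriod_rot]
  exact iterate_minimalPeriod

theorem sum_darts_rot (v : V) (x : G.Dart → ℚ) :
    ∑ d : G.Dart with d.fst = v, x (R.rot d) = ∑ d : G.Dart with d.fst = v, x d := by
  refine Finset.sum_bij (fun d _ => R.rot d) ?_ (fun _ _ _ _ h => R.rot.injective h) ?_
    (fun d _ => rfl)
  · intro d hd
    simpa [R.rot_fst] using hd
  · intro d hd
    refine ⟨R.rot.symm d, ?_, by simp⟩
    have := R.rot_fst (R.rot.symm d)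
    simp only [Equiv.apply_symm_apply] at this
    simpa [← this] using hd

theorem card_darts_at (v : V) : ({d : G.Dart | d.fst = v} : Finset G.Dart).card = G.degree v := by
  rw [← SimpleGraph.dart_fst_fiber_card_eq_degree]

/-- A bound for the sums of three consecutive values bounds the sum around a vertex. -/
theorem sum_darts_at_le_of_triple {x : G.Dart → ℚ} {b : ℚ}
    (h : ∀ d, x d + x (R.rot d) + x (R.rot (R.rot d)) ≤ b) (v : V) :
    3 * ∑ d : G.Dart with d.fst = v, x d ≤ G.degree v * b := by
  have h1 := R.sum_darts_rot v x
  have h2 := R.sum_darts_rot v (fun d => x (R.rot d))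
  have h3 := Finset.sum_le_sum fun d (_ : d ∈ ({d : G.Dart | d.fst = v} : Finset G.Dart)) => h d
  rw [Finset.sum_add_distrib, Finset.sum_add_distrib, h2, h1, Finset.sum_const, nsmul_eq_mul,
    card_darts_at] at h3
  linarith

theorem exists_dart_fst {v : V} (h : 0 < G.degree v) : ∃ d : G.Dart, d.fst = v := by
  obtain ⟨w, hw⟩ := (G.degree_pos_iff_exists_adj v).1 h
  exact ⟨⟨(v, w), hw⟩, rfl⟩

theorem sum_darts_eq_sum_sum (x : G.Dart → ℚ) :
    ∑ d, x d = ∑ v, ∑ d : G.Dart with d.fst = v, x d := by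
  symm
  convert Finset.sum_fiberwise Finset.univ (fun d : G.Dart => d.fst) x

variable {R}

theorem Turn.ne (h2 : ∀ v, 2 ≤ G.degree v) {a b c : V} (h : R.Turn a b c) : a ≠ c := by
  rintro rfl
  have := R.degree_le_of_turn_one h
  have := h2 b
  omega

/-! ### Planar graphs without cycles of length five -/

section NoFive

variable (h5 : ¬ HasCycleOfLength G 5) (h4 : ∀ v, 4 ≤ G.degree v)

include h5 h4

/-- In a closed walk of length five, two nonconsecutive positions are at distance two. The vertices
there differ because no vertex has degree 1, so a 5-face would be a 5-cycle. -/
theorem faceSize_ne_five (d : G.Dart) : R.faceSize d ≠ 5 := by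
  intro hd
  obtain ⟨h1, h2, h3, h4', h5'⟩ := R.pent_of_faceSize hd
  have hd2 : ∀ v, 2 ≤ G.degree v := fun v => le_trans (by norm_num) (h4 v)
  exact h5 (hasCycleOfLength_five h1.adj_left h2.adj_left h3.adj_left h4'.adj_left h5'.adj_left
    (h1.ne hd2) (h4'.ne hd2).symm (h2.ne hd2) (h5'.ne hd2).symm (h3.ne hd2))

/-- Removing the common edge leaves a closed walk of length five. The apex of the triangle can
coincide with a further vertex of the quadrilateral only if an end of the common edge has degree at
most 2. -/
theorem not_tri_quad {d : G.Dart} (h3 : R.faceSize d = 3) (hq : R.faceSize d.symm = 4) : False := by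
  have hd2 : ∀ v, 2 ≤ G.degree v := fun v => le_trans (by norm_num) (h4 v)
  obtain ⟨t1, t2, t3⟩ := R.tri_of_faceSize h3
  obtain ⟨q1, q2, q3, q4⟩ := R.quad_of_faceSize hq
  change R.Turn d.snd d.fst _ at q1
  change R.Turn d.fst _ _ at q2
  change R.Turn _ _ d.snd at q3
  change R.Turn _ d.snd d.fst at q4
  generalize d.fst = a at *
  generalize d.snd = b at *
  generalize (R.facePerm d).snd = c at *
  generalize (R.facePerm d.symm).snd = x at *
  generalize (R.facePerm (R.facePerm d.symm)).snd = y at *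
  refine h5 (hasCycleOfLength_five t3.adj_left.symm t2.adj_left.symm q4.adj_left.symm
    q3.adj_left.symm q2.adj_left.symm t1.adj_left.ne (q2.ne hd2) ?_ ?_ (q1.ne hd2))
  · rintro rfl
    have := R.degree_le_of_turn_two t1 q4
    have := h4 b
    omega
  · rintro rfl
    have := R.degree_le_of_turn_two q1 t3
    have := h4 a
    omega

/-- The three triangles form a fan whose outer path closes up through the centre to a 5-cycle; a
coincidence on the path would make the degree of the centre at most 3. -/
theorem not_tri_tri_tri {d : G.Dart} (h1 : R.faceSize (R.rot d) = 3)
    (h2 : R.faceSize (R.rot (R.rot d)) = 3) (h3 : R.faceSize (R.rot (R.rot (R.rot d))) = 3) :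
    False := by
  rw [faceSize_rot] at h1 h2 h3
  have e1 := R.turn_rot d
  have e2 := R.turn_rot (R.rot d)
  have e3 := R.turn_rot (R.rot (R.rot d))
  obtain ⟨a1, a2, a3⟩ := R.tri_of_faceSize h1
  obtain ⟨b1, b2, b3⟩ := R.tri_of_faceSize h2
  obtain ⟨c1, c2, c3⟩ := R.tri_of_faceSize h3
  rw [R.facePerm_symm] at a1 a2 a3 b1 b2 b3 c1 c2 c3
  have f1 := R.rot_fst d
  have f2 := R.rot_fst (R.rot d)
  change R.Turn d.snd d.fst _ at a1
  change R.Turn _ _ d.snd at a2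
  change R.Turn (R.rot d).snd (R.rot d).fst _ at b1
  change R.Turn _ _ (R.rot d).snd at b2
  change R.Turn (R.rot (R.rot d)).snd (R.rot (R.rot d)).fst _ at c1
  change R.Turn _ _ (R.rot (R.rot d)).snd at c2
  rw [f2, f1] at c1
  rw [f1] at b1
  refine h5 (hasCycleOfLength_five d.adj a2.adj_right.symm b2.adj_right.symm c2.adj_right.symm
    c1.adj_right.symm ?_ ?_ ?_ ?_ ?_)
  · exact b1.adj_left.ne.symm
  · exact c1.adj_left.ne.symm
  · exact fun h => by
      rw [h] at a1
      have := R.degree_le_of_turn_two a1 b1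
      have := h4 d.fst
      omega
  · exact fun h => by
      rw [h] at a1
      have := R.degree_le_of_turn_three a1 b1 c1
      have := h4 d.fst
      omega
  · exact fun h => by
      rw [h] at b1
      have := R.degree_le_of_turn_two b1 c1
      have := h4 d.fst
      omega

end NoFive

theorem demand_triple {p q r : ℚ} (hp : p = 0 ∨ p = 1 / 2 ∨ p = 1) (hq : q = 0 ∨ q = 1 / 2 ∨ q = 1)
    (hr : r = 0 ∨ r = 1 / 2 ∨ r = 1) (h1 : ¬ (p = 1 ∧ q = 1 / 2)) (h2 : ¬ (p = 1 / 2 ∧ q = 1))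
    (h3 : ¬ (q = 1 ∧ r = 1 / 2)) (h4 : ¬ (q = 1 / 2 ∧ r = 1)) (h5 : ¬ (p = 1 ∧ q = 1 ∧ r = 1)) :
    p + q + r ≤ 2 := by
  rcases hp with rfl | rfl | rfl <;> rcases hq with rfl | rfl | rfl <;>
    rcases hr with rfl | rfl | rfl <;> norm_num at *

/-- At degree four, averaging the triple bound would allow $8/3$, more than the available charge
$2\cdot4-6=2$, so the four corners are checked together. -/
theorem demand_four {p q r s : ℚ} (hp : p = 0 ∨ p = 1 / 2 ∨ p = 1)
    (hq : q = 0 ∨ q = 1 / 2 ∨ q = 1) (hr : r = 0 ∨ r = 1 / 2 ∨ r = 1)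
    (hs : s = 0 ∨ s = 1 / 2 ∨ s = 1) (h1 : ¬ (p = 1 ∧ q = 1 / 2)) (h2 : ¬ (p = 1 / 2 ∧ q = 1))
    (h3 : ¬ (q = 1 ∧ r = 1 / 2)) (h4 : ¬ (q = 1 / 2 ∧ r = 1)) (h5 : ¬ (r = 1 ∧ s = 1 / 2))
    (h6 : ¬ (r = 1 / 2 ∧ s = 1)) (h7 : ¬ (s = 1 ∧ p = 1 / 2)) (h8 : ¬ (s = 1 / 2 ∧ p = 1))
    (h9 : ¬ (p = 1 ∧ q = 1 ∧ r = 1)) (h10 : ¬ (q = 1 ∧ r = 1 ∧ s = 1))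
    (h11 : ¬ (r = 1 ∧ s = 1 ∧ p = 1)) (h12 : ¬ (s = 1 ∧ p = 1 ∧ q = 1)) : p + q + r + s ≤ 2 := by
  rcases hp with rfl | rfl | rfl <;> rcases hq with rfl | rfl | rfl <;>
    rcases hr with rfl | rfl | rfl <;> rcases hs with rfl | rfl | rfl <;> norm_num at *

/-- The charge that a face takes from a corner in the case of cycles of length five. -/
noncomputable def cornerDemand (R : RotationSystem G) (d : G.Dart) : ℚ :=
  if R.faceSize d = 3 then 1 else if R.faceSize d = 4 then 1 / 2 else 0

/-- A nonempty plane graph of minimum degree at least four has a cycle of length five. -/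
theorem Exact.hasCycleOfLength_five (h : R.Exact) [Nonempty V] (h4 : ∀ v, 4 ≤ G.degree v) :
    HasCycleOfLength G 5 := by
  by_contra h5
  obtain ⟨d₀, -⟩ := exists_dart_fst (lt_of_lt_of_le (by norm_num) (h4 (Classical.arbitrary V)))
  have : Nonempty G.Dart := ⟨d₀⟩
  have hE := h.sum_charge_le (p := 2) (q := 6) (r := 1) (by norm_num) (by norm_num)
  set x := R.cornerDemand with hx
  have hval : ∀ d, x d = 0 ∨ x d = 1 / 2 ∨ x d = 1 := by
    intro d
    simp only [hx, cornerDemand]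
    split_ifs <;> simp
  have h1 : ∀ d, x d = 1 ↔ R.faceSize d = 3 := by
    intro d
    simp only [hx, cornerDemand]
    split_ifs <;> simp_all
  have h2 : ∀ d, x d = 1 / 2 ↔ R.faceSize d = 4 := by
    intro d
    simp only [hx, cornerDemand]
    split_ifs <;> simp_all
  have h12 : ∀ d, ¬ (x d = 1 ∧ x (R.rot d) = 1 / 2) := by
    rintro d ⟨ha, hb⟩
    rw [h1] at ha
    rw [h2, faceSize_rot] at hb
    exact not_tri_quad h5 h4 ha hb
  have h21 : ∀ d, ¬ (x d = 1 / 2 ∧ x (R.rot d) = 1) := by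
    rintro d ⟨ha, hb⟩
    rw [h2] at ha
    rw [h1, faceSize_rot] at hb
    exact not_tri_quad h5 h4 hb (by rwa [SimpleGraph.Dart.symm_symm])
  have h111 : ∀ d, ¬ (x d = 1 ∧ x (R.rot d) = 1 ∧ x (R.rot (R.rot d)) = 1) := by
    rintro d ⟨ha, hb, hc⟩
    rw [h1] at ha hb hc
    refine not_tri_tri_tri (R := R) (d := R.rot.symm d) h5 h4 ?_ ?_ ?_ <;>
      simpa only [Equiv.apply_symm_apply]
  have htriple : ∀ d, x d + x (R.rot d) + x (R.rot (R.rot d)) ≤ 2 := by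
    intro d
    exact demand_triple (hval _) (hval _) (hval _) (h12 d) (h21 d) (h12 _) (h21 _) (h111 d)
  -- From degree five on, averaging suffices: $\frac23\deg v\le 2\deg v-6$.
  have hvert : ∀ v, ∑ d : G.Dart with d.fst = v, x d ≤ 2 * G.degree v - 6 := by
    intro v
    rcases (h4 v).eq_or_lt with hv | hv
    · obtain ⟨d, rfl⟩ := exists_dart_fst (lt_of_lt_of_le (by norm_num) (h4 v))
      rw [R.sum_darts_at, ← hv]
      have hper := R.iterate_degree d
      rw [← hv] at hper
      simp only [Finset.sum_range_succ, Finset.sum_range_zero, iterate_succ_apply', iterate_zero,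
        id] at hper ⊢
      have c7 := h12 (R.rot (R.rot (R.rot d)))
      have c8 := h21 (R.rot (R.rot (R.rot d)))
      have c11 := h111 (R.rot (R.rot d))
      have c12 := h111 (R.rot (R.rot (R.rot d)))
      rw [hper] at c7 c8 c11 c12
      have := demand_four (hval _) (hval _) (hval _) (hval _) (h12 d) (h21 d) (h12 _) (h21 _) (h12 _)
        (h21 _) c7 c8 (h111 d) (h111 _) c11 c12
      norm_num
      linarith
    · have h3 := R.sum_darts_at_le_of_triple htriple v
      have : (5 : ℚ) ≤ G.degree v := by exact_mod_cast hv
      linarith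
  -- The demands are exact: a triangle lacks 3 and has three corners of demand 1, a quadrilateral
  -- lacks 2 and has four corners of demand $1/2$.
  have hface : ∀ d, 0 ≤ (1 - 6 * (1 / R.faceSize d) : ℚ) + x d := by
    intro d
    have h3 := R.faceSize_ge_three (fun v => le_trans (by norm_num) (h4 v)) d
    have h5' := faceSize_ne_five h5 h4 d (R := R)
    by_cases a3 : R.faceSize d = 3
    · rw [(h1 d).2 a3, a3]
      norm_num
    by_cases a4 : R.faceSize d = 4
    · rw [(h2 d).2 a4, a4]
      norm_num
    have h6 : (6 : ℚ) ≤ R.faceSize d := by exact_mod_cast (show 6 ≤ R.faceSize d by omega)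
    have hx0 : 0 ≤ x d := by rcases hval d with h | h | h <;> rw [h] <;> norm_num
    have : 6 * (1 / (R.faceSize d : ℚ)) ≤ 1 := by
      rw [mul_one_div, div_le_one (by linarith)]
      exact h6
    linarith
  have hs1 := Finset.sum_nonneg fun d (_ : d ∈ (Finset.univ : Finset G.Dart)) => hface d
  rw [Finset.sum_add_distrib, sum_darts_eq_sum_sum x] at hs1
  have hs2 := Finset.sum_le_sum fun v (_ : v ∈ (Finset.univ : Finset V)) => hvert v
  linarith

end RotationSystem

/-! ### Forbidden configurations in tame plane graphs -/

namespace RotationSystem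

open Function

variable {V : Type*} {G : SimpleGraph V} [Fintype V]

/-- A plane graph without cycles of length six in which all triangles are facial and all vertices
outside `O` have degree at least four, where `O` is empty or a triangle. -/
structure Tame (R : RotationSystem G) (O : Finset V) : Prop where
  noSix : ¬ HasCycleOfLength G 6
  facial : ∀ a b c, G.Adj a b → G.Adj b c → G.Adj c a → R.Tri a b c ∨ R.Tri c b a
  two_le : ∀ v, 2 ≤ G.degree v
  four_le : ∀ v, v ∉ O → 4 ≤ G.degree v
  clique : ∀ a ∈ O, ∀ b ∈ O, a ≠ b → G.Adj a b
  card_O : O = ∅ ∨ O.card = 3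
  three_le : O.Nonempty → ∃ v ∈ O, 3 ≤ G.degree v

namespace Tame

variable {R : RotationSystem G} {O : Finset V} (M : R.Tame O)

include M

theorem ne {a b c : V} (h : R.Turn a b c) : a ≠ c := h.ne M.two_le

/-- Only vertices of `O` may have degree below four, and the two other vertices of the triangle `O`
already exhaust the degree. -/
theorem erase_eq_neighborFinset {b : V} (h : G.degree b ≤ 2) :
    b ∈ O ∧ O.erase b = G.neighborFinset b := by
  have hb : b ∈ O := by
    by_contra hb
    have := M.four_le b hb
    omega
  refine ⟨hb, Finset.eq_of_subset_of_card_le (fun x hx => ?_) ?_⟩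
  · rw [SimpleGraph.mem_neighborFinset]
    exact M.clique b hb x (Finset.mem_of_mem_erase hx) (Finset.ne_of_mem_erase hx).symm
  · rw [G.card_neighborFinset_eq_degree, Finset.card_erase_of_mem hb]
    rcases M.card_O with h0 | h3
    · rw [h0] at hb
      simp at hb
    · omega

theorem two {a b c : V} (h : R.Turn a b c) (h' : R.Turn c b a) : a ∈ O ∧ b ∈ O ∧ c ∈ O := by
  obtain ⟨hb, he⟩ := M.erase_eq_neighborFinset (R.degree_le_of_turn_two h h')
  refine ⟨?_, hb, ?_⟩
  · exact Finset.mem_of_mem_erase (he ▸ (G.mem_neighborFinset _ _).2 h.adj_left.symm)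
  · exact Finset.mem_of_mem_erase (he ▸ (G.mem_neighborFinset _ _).2 h.adj_right)

theorem three {a b c d : V} (h : R.Turn a b c) (h' : R.Turn c b d) (h'' : R.Turn d b a) :
    b ∈ O := by
  by_contra hb
  have := M.four_le b hb
  have := R.degree_le_of_turn_three h h' h''
  omega

theorem facial_at {a b c : V} (hab : G.Adj a b) (hbc : G.Adj b c) (hca : G.Adj c a) :
    R.Turn c a b ∨ R.Turn b a c := by
  rcases M.facial a b c hab hbc hca with h | h
  · exact Or.inl h.2.2
  · exact Or.inr h.2.1

/-- The three triangles at `a` are facial, so each gives a turn at `a`. Coherent turns close the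
rotation after three steps, against degree at least four; incoherent ones contradict uniqueness of
turns. -/
theorem not_k4_of_notMem {a b c d : V} (ha : a ∉ O) (hab : G.Adj a b) (hac : G.Adj a c)
    (had : G.Adj a d) (hbc : G.Adj b c) (hbd : G.Adj b d) (hcd : G.Adj c d) : False := by
  have := hbc.ne; have := hbd.ne; have := hcd.ne
  rcases M.facial_at hab hbc hac.symm with h1 | h1 <;>
    rcases M.facial_at hac hcd had.symm with h2 | h2 <;>
    rcases M.facial_at had hbd.symm hab.symm with h3 | h3
  · exact ha (M.three h1 h3 h2)
  · exact hcd.ne (h1.left_unique h3)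
  · exact hbd.ne (h1.right_unique h2)
  · exact hbd.ne (h1.right_unique h2)
  · exact hbd.ne (h1.left_unique h2)
  · exact hbd.ne (h1.left_unique h2)
  · exact hcd.ne (h1.right_unique h3)
  · exact ha (M.three h1 h2 h3)

theorem not_k4 {a b c d : V} (hab : G.Adj a b) (hac : G.Adj a c)
    (had : G.Adj a d) (hbc : G.Adj b c) (hbd : G.Adj b d) (hcd : G.Adj c d) : False := by
  by_cases ha : a ∈ O
  · by_cases hb : b ∈ O
    · by_cases hc : c ∈ O
      · by_cases hd : d ∈ O
        · have h4 : ({a, b, c, d} : Finset V) ⊆ O := by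
            intro x hx
            simp only [Finset.mem_insert, Finset.mem_singleton] at hx
            rcases hx with rfl | rfl | rfl | rfl <;> assumption
          have h5 := Finset.card_le_card h4
          rw [Finset.card_insert_of_notMem (by simp [hab.ne, hac.ne, had.ne]),
            Finset.card_insert_of_notMem (by simp [hbc.ne, hbd.ne]),
            Finset.card_insert_of_notMem (by simp [hcd.ne]), Finset.card_singleton] at h5
          rcases M.card_O with h | h
          · simp [h] at ha
          · omega
        · exact M.not_k4_of_notMem hd had.symm hbd.symm hcd.symm hab hac hbc
      · exact M.not_k4_of_notMem hc hac.symm hbc.symm hcd hab had hbd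
    · exact M.not_k4_of_notMem hb hab.symm hbc hbd hac had hcd
  · exact M.not_k4_of_notMem ha hab hac had hbc hbd hcd

/-- A facial triangle outside `O` does not have three triangular neighbours. -/
theorem not_three_tri {a b c x y z : V} (h : R.Tri a b c) (hx : R.Tri b a x) (hy : R.Tri c b y)
    (hz : R.Tri a c z) (hO : ¬ (a ∈ O ∧ b ∈ O ∧ c ∈ O)) : False := by
  obtain ⟨h1, h2, h3⟩ := h
  obtain ⟨x1, x2, x3⟩ := hx
  obtain ⟨y1, y2, y3⟩ := hy
  obtain ⟨z1, z2, z3⟩ := hz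
  refine M.noSix (hasCycleOfLength_six x2.adj_left x3.adj_left y2.adj_left y3.adj_left
    z2.adj_left z3.adj_left h1.adj_left.ne ?_ h3.adj_left.ne.symm ?_ ?_ ?_ h2.adj_left.ne ?_ ?_)
  · rintro rfl
    have := M.two h1 y1
    tauto
  · rintro rfl
    exact M.not_k4 h1.adj_left h3.adj_left.symm x2.adj_left h2.adj_left x3.adj_left.symm
      y3.adj_left.symm
  · rintro rfl
    have := M.two h3 x1
    tauto
  · rintro rfl
    exact M.not_k4 h1.adj_left h3.adj_left.symm x2.adj_left h2.adj_left x3.adj_left.symm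
      z2.adj_left
  · rintro rfl
    have := M.two h2 z1
    tauto
  · rintro rfl
    exact M.not_k4 h1.adj_left h3.adj_left.symm z3.adj_left.symm h2.adj_left y2.adj_left
      y3.adj_left.symm

/-- Replacing the common edge by the path through `x` gives a closed walk of length six, so `x` lies
on the pentagon. If `x` is `c` or `e`, a vertex of degree two appears; if it is `d`, the triangles
cut off at `a` and at `b` are facial and both vertices have degree at most three. -/
theorem tri_pent {a b x e d c : V} (h : R.Tri a b x) (hp : R.Pent b a e d c) : a ∈ O ∧ b ∈ O := by
  obtain ⟨h1, h2, h3⟩ := h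
  obtain ⟨p1, p2, p3, p4, p5⟩ := hp
  by_cases hxc : x = c
  · subst hxc
    have := M.two h1 p5
    tauto
  by_cases hxe : x = e
  · subst hxe
    have := M.two h3 p1
    tauto
  by_cases hxd : x = d
  · subst hxd
    constructor
    · rcases M.facial_at p1.adj_right p2.adj_right h3.adj_left with t | t
      · exact absurd (h3.right_unique t) (M.ne p1)
      · exact M.three h3 p1 t
    · rcases M.facial_at p5.adj_left.symm p4.adj_left.symm h1.adj_right.symm with t | t
      · exact M.three h1 t p5
      · exact absurd (p5.right_unique t) h3.adj_left.ne'
  · exact absurd (hasCycleOfLength_six h3.adj_left.symm h2.adj_left.symm p4.adj_right.symm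
      p3.adj_right.symm p2.adj_right.symm p1.adj_right.symm h1.adj_left.ne (M.ne p5).symm
      (M.ne p2) hxc hxd hxe (M.ne p4).symm (M.ne p1) (M.ne p3).symm) M.noSix

/-- Removing the common edge leaves a closed walk of length six. Every coincidence on it creates a
triangle on the common edge; as that triangle is facial, it conflicts with the turns of the
quadrilaterals. -/
theorem not_quad_quad {a b c d x y : V} (h : R.Quad a b c d) (h' : R.Quad b a y x) : False := by
  obtain ⟨h1, h2, h3, h4⟩ := h
  obtain ⟨k1, k2, k3, k4⟩ := h'
  refine M.noSix (hasCycleOfLength_six k1.adj_right k2.adj_right k3.adj_right h1.adj_right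
    h2.adj_right h3.adj_right (M.ne k4).symm h1.adj_left.ne (M.ne h1) (M.ne k1).symm
    ?_ ?_ ?_ ?_ (M.ne h2))
  · rintro rfl
    rcases M.facial a b y h1.adj_left h1.adj_right k1.adj_right.symm with t | t
    · exact h3.adj_right.ne' (t.2.1.right_unique h2)
    · exact k2.adj_right.ne (t.1.left_unique k4)
  · rintro rfl
    obtain ⟨hb, ha, hd⟩ := M.two k1 h4
    rcases M.facial a b y h1.adj_left (M.clique b hb y hd (M.ne k1)) h4.adj_left with t | t
    · exact h2.adj_right.ne (h1.right_unique t.1)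
    · exact k3.adj_right.ne (k2.right_unique t.2.2)
  · rintro rfl
    obtain ⟨ha, hb, hc⟩ := M.two h1 k4
    rcases M.facial a b x h1.adj_left h1.adj_right (M.clique x hc a ha (M.ne k4)) with t | t
    · exact h2.adj_right.ne (t.2.2.left_unique h4)
    · exact k2.adj_right.ne (k1.right_unique t.2.1)
  · rintro rfl
    rcases M.facial a b x h1.adj_left k3.adj_right.symm h4.adj_left with t | t
    · exact h2.adj_right.ne (h1.right_unique t.1)
    · exact k2.adj_right.ne (k1.right_unique t.2.1)

/-- Here and for opposite edges below, detours through the apexes `p` and `q` lengthen the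
quadrilateral to a 6-cycle; coincidences would give a vertex outside `O` degree at most 3 or
contradict a turn. -/
theorem not_tri_quad_tri {a b c d p q : V} (hb : b ∉ O) (h : R.Quad a b c d) (h' : R.Tri b a p)
    (h'' : R.Tri c b q) : False := by
  obtain ⟨h1, h2, h3, h4⟩ := h
  obtain ⟨t1, t2, t3⟩ := h'
  obtain ⟨u1, u2, u3⟩ := h''
  refine M.noSix (hasCycleOfLength_six t1.adj_right t2.adj_right u1.adj_right u2.adj_right
    h2.adj_right h3.adj_right h1.adj_left.ne ?_ (M.ne h1) ?_ ?_ ?_ h1.adj_right.ne (M.ne h2) ?_)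
  · rintro rfl
    exact hb (M.two h1 u1).2.1
  · rintro rfl
    exact hb (M.three t3 h1 u1)
  · rintro rfl
    exact hb (M.two h1 t3).2.1
  · rintro rfl
    exact hb (M.two t1 h4).1
  · rintro rfl
    exact hb (M.two h2 u3).1

theorem not_tri_quad_tri_of_opposite {a b c d p q : V} (ha : a ∉ O) (hd : d ∉ O)
    (h : R.Quad a b c d) (h' : R.Tri b a p) (h'' : R.Tri d c q) : False := by
  obtain ⟨h1, h2, h3, h4⟩ := h
  obtain ⟨t1, t2, t3⟩ := h'
  obtain ⟨u1, u2, u3⟩ := h''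
  refine M.noSix (hasCycleOfLength_six t1.adj_right t2.adj_right h1.adj_right u1.adj_right
    u2.adj_right h3.adj_right h1.adj_left.ne (M.ne h1) ?_ ?_ ?_ ?_ ?_ (M.ne h2) h2.adj_right.ne)
  · rintro rfl
    exact hd (M.two u3 h3).2.1
  · rintro rfl
    exact ha (M.two h1 t3).1
  · rintro rfl
    rcases M.facial_at h3.adj_right.symm u2.adj_right.symm t1.adj_right.symm with t | t
    · exact ha (M.three t h4 t1)
    · exact t3.adj_left.ne (t.right_unique h4)
  · rintro rfl
    exact ha (M.two t1 h4).2.1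
  · rintro rfl
    exact hd (M.two u1 h2).1

/-- The two triangles replace the edge `ab` of the quadrilateral by the path `a`, `p`, `q`, `b`. -/
theorem not_quad_tri_tri {a b c d p q : V} (hb : b ∉ O) (h : R.Quad a b c d) (h' : R.Tri b a p)
    (h'' : R.Tri b p q) : False := by
  obtain ⟨h1, h2, h3, h4⟩ := h
  obtain ⟨t1, t2, t3⟩ := h'
  obtain ⟨u1, u2, u3⟩ := h''
  refine M.noSix (hasCycleOfLength_six t1.adj_right u1.adj_right u2.adj_right h1.adj_right
    h2.adj_right h3.adj_right ?_ h1.adj_left.ne (M.ne h1) t3.adj_left.ne ?_ ?_ ?_ ?_ (M.ne h2))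
  · rintro rfl
    exact hb (M.two u3 t3).2.1
  · rintro rfl
    exact hb (M.two h1 t3).2.1
  · rintro rfl
    exact hb (M.two t1 h4).1
  · rintro rfl
    exact hb (M.three h1 u3 t3)
  · rintro rfl
    rcases M.facial a b q h1.adj_left u3.adj_left.symm h4.adj_left with t | t
    · exact h2.adj_right.ne (h1.right_unique t.1)
    · exact u1.adj_right.ne' (t.1.left_unique t3)

/-- There are no six-cycles `v`, `w`, `z'`, `z`, `x`, `y`. -/
theorem not_fan {v w z x y z' : V} (hv : v ∉ O) (h1 : R.Turn w v z) (h2 : R.Turn z v x)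
    (h3 : R.Turn x v y) (hwz : G.Adj w z) (hzx : G.Adj z x) (hxy : G.Adj x y) (hw : G.Adj z' w)
    (hz : G.Adj z' z) (hne : z' ≠ v) : False := by
  refine M.noSix (hasCycleOfLength_six h1.adj_left.symm hw.symm hz hzx hxy h3.adj_right.symm
    hne.symm h1.adj_right.ne h2.adj_right.ne hwz.ne ?_ ?_ ?_ ?_ ?_)
  · rintro rfl
    exact hv (M.two h1 h2).2.1
  · rintro rfl
    exact hv (M.three h1 h2 h3)
  · rintro rfl
    exact M.not_k4 h1.adj_left.symm h1.adj_right h2.adj_right hwz hw.symm hzx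
  · rintro rfl
    exact M.not_k4 h1.adj_right h2.adj_right h3.adj_right hzx hz.symm hxy
  · rintro rfl
    exact hv (M.two h2 h3).2.1

theorem eq_of_mem {a b c x : V} (ha : a ∈ O) (hb : b ∈ O) (hc : c ∈ O) (hx : x ∈ O)
    (hab : a ≠ b) (hac : a ≠ c) (hbc : b ≠ c) : x = a ∨ x = b ∨ x = c := by
  by_contra hne
  push Not at hne
  have h4 : ({x, a, b, c} : Finset V) ⊆ O := by
    intro y hy
    simp only [Finset.mem_insert, Finset.mem_singleton] at hy
    rcases hy with rfl | rfl | rfl | rfl <;> assumption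
  have h5 := Finset.card_le_card h4
  rw [Finset.card_insert_of_notMem (by simp [hne]),
    Finset.card_insert_of_notMem (by simp [hab, hac]),
    Finset.card_insert_of_notMem (by simp [hbc]), Finset.card_singleton] at h5
  rcases M.card_O with h | h
  · simp [h] at ha
  · omega

/-- If `a = d`, the walk splits into two triangles, both facial. One that is traversed against the
walk has a vertex of degree two and is therefore `O`. In every case the turns then yield the
excluded facial triangle. -/
theorem hex_ne {a b c d e f : V} (h : R.Hex a b c d e f) (ht : ¬ R.Tri a b c) : a ≠ d := by
  rintro rfl
  obtain ⟨h1, h2, h3, h4, h5, h6⟩ := h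
  rcases M.facial a b c h1.adj_left h1.adj_right h2.adj_right with t | t
  · exact ht t
  obtain ⟨ha, hb, hc⟩ := M.two h1 t.1
  rcases M.facial a e f h4.adj_left h4.adj_right h5.adj_right with u | u
  · obtain rfl := u.2.2.right_unique h6
    obtain rfl := u.1.right_unique h1
    exact ht u
  obtain ⟨-, he, hf⟩ := M.two h4 u.1
  have key : e = b := by
    rcases M.eq_of_mem ha hb hc he h1.adj_left.ne (M.ne h1) h1.adj_right.ne with h | h | h
    · exact absurd h h4.adj_left.ne'
    · exact h
    · exact absurd h.symm (M.ne h3)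
  subst key
  rcases M.eq_of_mem ha hb hc hf h1.adj_left.ne (M.ne h1) h1.adj_right.ne with h | h | h
  · exact absurd h h6.adj_left.ne
  · exact absurd h h4.adj_right.ne'
  · subst h
    exact ht ⟨h1, h2, h6⟩

end Tame

end RotationSystem

namespace RotationSystem

open Function

/-! ### Mirror images -/

section Mirror

variable {V : Type*} {G : SimpleGraph V} (R : RotationSystem G)

/-- The mirror image of a rotation system. -/
def mirror : RotationSystem G where
  rot := R.rot.symm
  rot_fst d := by
    have := R.rot_fst (R.rot.symm d)
    rw [Equiv.apply_symm_apply] at this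
    exact this.symm
  sameCycle_of_fst_eq d e h := Equiv.Perm.sameCycle_inv.2 (R.sameCycle_of_fst_eq d e h)

theorem mirror_rot (d : G.Dart) : R.mirror.rot (R.rot d) = d := Equiv.symm_apply_apply _ _

theorem turn_mirror {a b c : V} : R.mirror.Turn a b c ↔ R.Turn c b a := by
  constructor
  · rintro ⟨h, h', he⟩
    refine ⟨h'.symm, h.symm, ?_⟩
    change R.rot.symm _ = _ at he
    rw [Equiv.symm_apply_eq] at he
    exact he.symm
  · rintro ⟨h, h', he⟩
    refine ⟨h'.symm, h.symm, ?_⟩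
    change R.rot.symm _ = _
    rw [Equiv.symm_apply_eq]
    exact he.symm

variable {R}

theorem tri_mirror {a b c : V} : R.mirror.Tri a b c ↔ R.Tri c b a := by
  simp only [Tri, turn_mirror]
  tauto

theorem Tri.rotate {a b c : V} (h : R.Tri a b c) : R.Tri b c a := ⟨h.2.1, h.2.2, h.1⟩

theorem Quad.rotate {a b c d : V} (h : R.Quad a b c d) : R.Quad b c d a :=
  ⟨h.2.1, h.2.2.1, h.2.2.2, h.1⟩

theorem mirror_facePerm (d : G.Dart) : R.mirror.facePerm (R.facePerm d).symm = d.symm := by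
  change R.rot.symm (R.facePerm d).symm.symm = _
  rw [SimpleGraph.Dart.symm_symm, facePerm_apply, Equiv.symm_apply_apply]

/-- The mirror image traverses the same faces backwards, along the reversed darts. -/
theorem faceSize_mirror (d : G.Dart) : R.mirror.faceSize d.symm = R.faceSize d := by
  have key : ∀ n (d : G.Dart), R.mirror.facePerm^[n] (R.facePerm^[n] d).symm = d.symm := by
    intro n
    induction n with
    | zero => exact fun _ => rfl
    | succ n ih => intro d; rw [iterate_succ_apply, iterate_succ_apply', mirror_facePerm, ih]
  refine minimalPeriod_eq_minimalPeriod_iff.2 fun n => ?_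
  simp only [IsPeriodicPt, IsFixedPt]
  constructor
  · intro h
    have h' := key n d
    exact SimpleGraph.Dart.symm_involutive.injective
      ((R.mirror.facePerm.injective.iterate n) (h'.trans h.symm))
  · intro h
    have h' := key n d
    rwa [h] at h'

variable [Fintype V]

theorem faceSize_mirror_rot (d : G.Dart) : R.mirror.faceSize d = R.faceSize (R.rot d) := by
  rw [faceSize_rot, ← faceSize_mirror (d := d.symm), SimpleGraph.Dart.symm_symm]

theorem tri_corner {e : G.Dart} (h : R.faceSize (R.rot e) = 3) :
    R.Tri e.snd e.fst (R.rot e).snd := by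
  rw [faceSize_rot] at h
  have := R.tri_of_faceSize h
  rwa [facePerm_symm] at this

theorem quad_corner {e : G.Dart} (h : R.faceSize (R.rot e) = 4) :
    ∃ y, R.Quad e.snd e.fst (R.rot e).snd y := by
  rw [faceSize_rot] at h
  have := R.quad_of_faceSize h
  rw [facePerm_symm] at this
  exact ⟨_, this⟩

end Mirror

/-! ### The forbidden configurations in terms of face sizes -/

namespace Tame

variable {V : Type*} {G : SimpleGraph V} [Fintype V] {R : RotationSystem G} {O : Finset V}
  (M : R.Tame O)

include M

theorem mirror : R.mirror.Tame O where
  noSix := M.noSix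
  facial a b c h1 h2 h3 := by
    simp only [tri_mirror]
    exact (M.facial a b c h1 h2 h3).symm
  two_le := M.two_le
  four_le := M.four_le
  clique := M.clique
  card_O := M.card_O
  three_le := M.three_le

/-- A 6-face would be a 6-cycle: vertices at distance two differ by the degree condition, antipodal
ones by `hex_ne`. -/
theorem faceSize_ne_six (d : G.Dart) : R.faceSize d ≠ 6 := by
  intro hd
  have nt : ∀ e c, R.faceSize e = 6 → ¬ R.Tri e.fst e.snd c := fun e c he ht => by
    have := R.faceSize_of_tri ht
    omega
  have h := R.hex_of_faceSize hd
  have n1 := nt d (R.facePerm d).snd hd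
  have n2 := nt (R.facePerm d) (R.facePerm (R.facePerm d)).snd (by rwa [faceSize_facePerm])
  have n3 := nt (R.facePerm (R.facePerm d)) (R.facePerm (R.facePerm (R.facePerm d))).snd
    (by rwa [faceSize_facePerm, faceSize_facePerm])
  rw [facePerm_fst] at n2 n3
  obtain ⟨h1, h2, h3, h4, h5, h6⟩ := h
  exact M.noSix (hasCycleOfLength_six h1.adj_left h2.adj_left h3.adj_left h4.adj_left h5.adj_left
    h6.adj_left (M.ne h1) (M.hex_ne ⟨h1, h2, h3, h4, h5, h6⟩ n1) (M.ne h5).symm (M.ne h2)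
    (M.hex_ne ⟨h2, h3, h4, h5, h6, h1⟩ n2) (M.ne h6).symm (M.ne h3)
    (M.hex_ne ⟨h3, h4, h5, h6, h1, h2⟩ n3) (M.ne h4))

theorem three_le_faceSize (d : G.Dart) : 3 ≤ R.faceSize d := R.faceSize_ge_three M.two_le d

theorem four_four {d : G.Dart} (h : R.faceSize d = 4) (h' : R.faceSize (R.rot d) = 4) : False := by
  obtain ⟨y, hy⟩ := quad_corner h'
  exact M.not_quad_quad (R.quad_of_faceSize h) hy

theorem three_five {d : G.Dart} (h : R.faceSize d = 3) (h' : R.faceSize d.symm = 5) :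
    d.fst ∈ O ∧ d.snd ∈ O := by
  exact M.tri_pent (R.tri_of_faceSize h) (R.pent_of_faceSize h')

theorem three_four_three {e : G.Dart} (hv : e.fst ∉ O) (h1 : R.faceSize e = 3)
    (h2 : R.faceSize (R.rot e) = 4) (h3 : R.faceSize (R.rot (R.rot e)) = 3) : False := by
  obtain ⟨e, rfl⟩ := R.rot.surjective e
  obtain ⟨y, hy⟩ := quad_corner h2
  have t1 := tri_corner h1
  have t2 := tri_corner h3
  simp only [R.rot_fst] at *
  exact M.not_tri_quad_tri hv hy t1.rotate t2

theorem three_three_four {e : G.Dart} (hv : e.fst ∉ O) (h1 : R.faceSize e = 3)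
    (h2 : R.faceSize (R.rot e) = 3) (h3 : R.faceSize (R.rot (R.rot e)) = 4) : False := by
  obtain ⟨e, rfl⟩ := R.rot.surjective e
  obtain ⟨y, hy⟩ := quad_corner h3
  have t1 := tri_corner h1
  have t2 := tri_corner h2
  simp only [R.rot_fst] at *
  exact M.not_quad_tri_tri hv hy t2.rotate t1.rotate

theorem four_three_three {e : G.Dart} (hv : e.fst ∉ O) (h1 : R.faceSize e = 4)
    (h2 : R.faceSize (R.rot e) = 3) (h3 : R.faceSize (R.rot (R.rot e)) = 3) : False := by
  obtain ⟨e, rfl⟩ := R.rot.surjective e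
  refine M.mirror.three_three_four (e := R.rot (R.rot e)) ?_ ?_ ?_ ?_
  · simpa only [R.rot_fst] using hv
  all_goals simpa only [faceSize_mirror_rot, mirror_rot]

theorem four_opposite {d : G.Dart} (ha : d.fst ∉ O) (hb : (R.rot d).snd ∉ O)
    (h : R.faceSize (R.rot d) = 4) (h1 : R.faceSize d = 3)
    (h2 : R.faceSize (R.facePerm (R.rot d)).symm = 3) : False := by
  have q := R.quad_of_faceSize h
  have t := R.tri_of_faceSize h1
  have t' := R.tri_of_faceSize h2
  have e := (R.turn_rot d).left_unique (R.rot_fst d ▸ q.2.2.2)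
  rw [e, ← R.rot_fst d] at t
  rw [← R.rot_fst d] at ha
  change R.Tri _ (R.facePerm (R.rot d)).fst _ at t'
  rw [facePerm_fst] at t'
  exact M.not_tri_quad_tri_of_opposite hb ha q.rotate t' t

/-- A facial triangle outside `O` has a neighbour that is not a triangle. -/
theorem not_three_neighbors {t : G.Dart} (h : R.faceSize t = 3)
    (h1 : R.faceSize t.symm = 3) (h2 : R.faceSize (R.facePerm t).symm = 3)
    (h3 : R.faceSize (R.facePerm (R.facePerm t)).symm = 3)
    (hO : ¬ (t.fst ∈ O ∧ t.snd ∈ O ∧ (R.facePerm t).snd ∈ O)) : False := by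
  have t0 := R.tri_of_faceSize h
  have t1 := R.tri_of_faceSize h1
  have t2 := R.tri_of_faceSize h2
  have t3 := R.tri_of_faceSize h3
  have e := (R.turn_facePerm (R.facePerm t)).right_unique
    ((R.facePerm_fst t).symm ▸ t0.2.1)
  change R.Tri _ (R.facePerm t).fst _ at t2
  change R.Tri _ (R.facePerm (R.facePerm t)).fst _ at t3
  simp only [SimpleGraph.Dart.symm_toProd, Prod.fst_swap, facePerm_fst, e] at t1 t2 t3
  exact M.not_three_tri t0 t1 t2 t3 hO

/-- Three consecutive triangles at a vertex, and a triangle on the far side of the first one. -/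
theorem not_three_consecutive {e : G.Dart} (hv : e.fst ∉ O) (h1 : R.faceSize e = 3)
    (h2 : R.faceSize (R.rot e) = 3) (h3 : R.faceSize (R.rot (R.rot e)) = 3)
    (h4 : R.faceSize (R.facePerm e).symm = 3) : False := by
  have t4 := R.tri_of_faceSize h4
  have e1 := R.tri_of_faceSize h1
  obtain ⟨e, rfl⟩ := R.rot.surjective e
  have t1 := tri_corner h1
  have t2 := tri_corner h2
  have t3 := tri_corner h3
  have ev : (R.facePerm (R.rot e)).snd = e.snd := e1.2.2.left_unique (R.rot_fst e ▸ t1.1)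
  change R.Tri (R.facePerm (R.rot e)).snd (R.facePerm (R.rot e)).fst _ at t4
  rw [ev, facePerm_fst] at t4
  simp only [R.rot_fst] at *
  refine M.not_fan hv t1.1 t2.1 t3.1 t1.2.2.adj_left.symm t2.2.2.adj_left.symm
    t3.2.2.adj_left.symm t4.2.2.adj_left t4.2.1.adj_left.symm ?_
  intro he
  rw [he] at t4
  exact hv (M.two t1.2.1 t4.1).1

end Tame

end RotationSystem

/-! ### Rotation identities at triangles and at vertices of degree four -/

namespace RotationSystem

open Function

section

variable {V : Type*} {G : SimpleGraph V} {R : RotationSystem G}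

theorem rot_symm_facePerm (d : G.Dart) : R.rot.symm (R.facePerm d) = d.symm :=
  R.rot.symm_apply_apply _

theorem rot_symm_fst (d : G.Dart) : (R.rot.symm d).fst = d.fst := by
  rw [← R.rot_fst, Equiv.apply_symm_apply]

theorem facePerm_three {t : G.Dart} (h : R.faceSize t = 3) :
    R.facePerm (R.facePerm (R.facePerm t)) = t := by
  have := R.iterate_faceSize t
  rwa [h] at this

theorem facePerm_two_symm {t : G.Dart} (h : R.faceSize t = 3) :
    (R.facePerm (R.facePerm t)).symm = R.rot.symm t := by
  rw [Equiv.eq_symm_apply, ← facePerm_apply, facePerm_three h]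

theorem facePerm_two_snd {t : G.Dart} (h : R.faceSize t = 3) :
    (R.facePerm (R.facePerm t)).snd = t.fst := by
  rw [← R.facePerm_fst, facePerm_three h]

variable [Fintype V]

theorem rot_four {d : G.Dart} (h : G.degree d.fst = 4) :
    R.rot (R.rot (R.rot (R.rot d))) = d := by
  have := R.iterate_degree d
  rwa [h] at this

theorem rot_symm_of_degree {d : G.Dart} (h : G.degree d.fst = 4) :
    R.rot.symm d = R.rot (R.rot (R.rot d)) := by
  rw [Equiv.symm_apply_eq, rot_four h]

end

/-! ### Discharging rules -/

section Rules

variable {V : Type*} {G : SimpleGraph V} [Fintype V] (R : RotationSystem G) (O : Finset V)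

/-- The seven-faces surrounded by triangles at inner vertices of degree four. -/
def Full (d : G.Dart) : Prop :=
  R.faceSize d = 7 ∧ ∀ n, (R.facePerm^[n] d).fst ∉ O ∧ G.degree (R.facePerm^[n] d).fst = 4 ∧
    R.faceSize (R.facePerm^[n] d).symm = 3

/-- The edges of full faces that give no charge to their triangle. -/
def Bad (d : G.Dart) : Prop :=
  R.Full O d ∧ R.faceSize (R.rot (R.rot (R.facePerm^[2] d))) ≤ 4 ∧
    R.faceSize (R.rot (R.rot (R.facePerm^[4] d))) ≤ 4 ∧
    R.faceSize (R.rot (R.rot (R.facePerm^[6] d))) ≤ 4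

/-- The charge that the triangle containing `t` receives across the edge `t`. -/
noncomputable def pay (t : G.Dart) : ℚ :=
  if R.faceSize t = 3 ∧ 7 ≤ R.faceSize t.symm then
    if t.fst ∈ O ∨ t.snd ∈ O then 1 / 2
    else if (R.facePerm t).snd ∈ O then
      if 7 ≤ R.faceSize (R.facePerm t).symm ∨
        7 ≤ R.faceSize (R.facePerm (R.facePerm t)).symm then 0 else 1 / 2
    else if 7 ≤ R.faceSize (R.facePerm t).symm then
      if 7 ≤ R.faceSize (R.facePerm (R.facePerm t)).symm then
        if R.Bad O t.symm then 0
        else if R.Bad O (R.facePerm t).symm ∨ R.Bad O (R.facePerm (R.facePerm t)).symm then 1 / 2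
        else 1 / 3
      else 1 / 2
    else if 7 ≤ R.faceSize (R.facePerm (R.facePerm t)).symm then 1 / 2 else 1
  else 0

/-- The triangles with three quadrilateral neighbours. -/
def Special (t : G.Dart) : Prop :=
  R.faceSize t = 3 ∧ R.faceSize t.symm = 4 ∧ R.faceSize (R.facePerm t).symm = 4 ∧
    R.faceSize (R.facePerm (R.facePerm t)).symm = 4

/-- The charge that the face of `d` gives to the opposite triangle at a vertex of degree four. -/
noncomputable def oppositePay (d : G.Dart) : ℚ :=
  if d.fst ∉ O ∧ G.degree d.fst = 4 ∧ 5 ≤ R.faceSize d ∧ R.Special (R.rot (R.rot d)) then 1 / 3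
  else 0

/-- The triangles disjoint from `O`. -/
def Nontouching (t : G.Dart) : Prop := t.fst ∉ O ∧ t.snd ∉ O ∧ (R.facePerm t).snd ∉ O

/-- The vertex of `e` gives charge to the face preceding the triangle at `e`. -/
def ReliefL (e : G.Dart) : Prop :=
  5 ≤ G.degree e.fst ∧ R.faceSize e = 3 ∧ R.Nontouching O e ∧ 7 ≤ R.faceSize (R.rot.symm e) ∧
    R.faceSize (R.rot.symm (R.rot.symm e)) ≤ 4 ∧ R.faceSize (R.rot e) ≤ 4

/-- The vertex of `e` gives charge to the face following the triangle at `e`. -/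
def ReliefR (e : G.Dart) : Prop :=
  5 ≤ G.degree e.fst ∧ R.faceSize e = 3 ∧ R.Nontouching O e ∧ 7 ≤ R.faceSize (R.rot e) ∧
    R.faceSize (R.rot (R.rot e)) ≤ 4 ∧ R.faceSize (R.rot.symm e) ≤ 4

/-- The vertex of `e` gives charge to the special triangle at `e`. -/
def GiveSpecial (e : G.Dart) : Prop := e.fst ∉ O ∧ 5 ≤ G.degree e.fst ∧ R.Special e

/-- The vertex of `e` gives charge to the large face at `e` between two triangles. -/
def GiveBetween (e : G.Dart) : Prop :=
  e.fst ∉ O ∧ 5 ≤ G.degree e.fst ∧ 7 ≤ R.faceSize e ∧ R.faceSize (R.rot e) = 3 ∧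
    R.faceSize (R.rot.symm e) = 3 ∧ ¬ R.ReliefL O (R.rot e) ∧ ¬ R.ReliefR O (R.rot.symm e)

/-- `e` lies on a triangle with all vertices in `O`. -/
def Outer (e : G.Dart) : Prop :=
  R.faceSize e = 3 ∧ e.fst ∈ O ∧ e.snd ∈ O ∧ (R.facePerm e).snd ∈ O

/-- The charge that a vertex of `O` gives to the face at `e`. -/
noncomputable def outerPay (e : G.Dart) : ℚ :=
  if e.fst ∈ O ∧ 3 ≤ G.degree e.fst ∧ ¬ R.Outer O e then 1 / 2 else 0

/-- The charge that a vertex outside `O` gives at the corner `e`. -/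
noncomputable def innerPay (e : G.Dart) : ℚ :=
  1 / 2 * (if R.ReliefL O e then 1 else 0) + 1 / 2 * (if R.ReliefR O e then 1 else 0) +
    1 / 3 * (if R.GiveSpecial O e then 1 else 0) + 1 / 2 * (if R.GiveBetween O e then 1 else 0)

/-- The charge that the face of `d` gives away along `d`. -/
noncomputable def load (d : G.Dart) : ℚ :=
  R.pay O d.symm - 1 / 2 * (if R.ReliefL O (R.rot d) then 1 else 0) -
    1 / 2 * (if R.ReliefR O d.symm then 1 else 0) + R.oppositePay O d

end Rules

/-! ### Small faces around a triangle -/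

namespace Tame

variable {V : Type*} {G : SimpleGraph V} [Fintype V] {R : RotationSystem G} {O : Finset V}
  (M : R.Tame O)

include M

theorem three_or_four {d : G.Dart} (h : R.faceSize d ≤ 4) :
    R.faceSize d = 3 ∨ R.faceSize d = 4 := by
  have := M.three_le_faceSize d
  omega

/-- Sizes 5 and 6 are excluded next to such a triangle, so a neighbour that is not large has size 3
or 4. -/
theorem le_four {t : G.Dart} (h : R.faceSize t = 3) (h' : ¬ 7 ≤ R.faceSize t.symm)
    (hO : ¬ (t.fst ∈ O ∧ t.snd ∈ O)) : R.faceSize t.symm ≤ 4 := by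
  have h6 := M.faceSize_ne_six t.symm
  have h5 : R.faceSize t.symm ≠ 5 := fun h5 => hO (M.three_five h h5)
  omega

/-- A triangle with small neighbours followed by two small faces at one of its vertices. -/
theorem not_small_small {c : G.Dart} (hv : c.fst ∉ O) (hw : c.snd ∉ O) (h : R.faceSize c = 3)
    (h1 : R.faceSize (R.rot c) ≤ 4) (h2 : R.faceSize (R.rot (R.rot c)) ≤ 4)
    (h3 : R.faceSize (R.facePerm c).symm ≤ 4) : False := by
  have hv' : (R.rot c).fst ∉ O := by rwa [R.rot_fst]
  rcases M.three_or_four h1 with h1 | h1 <;> rcases M.three_or_four h2 with h2 | h2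
  · rcases M.three_or_four h3 with h3 | h3
    · exact M.not_three_consecutive hv h h1 h2 h3
    · refine M.three_three_four (e := c.symm) hw ?_ ?_ ?_
      · rwa [← faceSize_rot]
      · rwa [← facePerm_apply, faceSize_facePerm]
      · rwa [← facePerm_apply, faceSize_rot]
  · exact M.three_three_four hv h h1 h2
  · exact M.three_four_three hv h h1 h2
  · exact M.four_four h1 h2

theorem not_small_small' {c : G.Dart} (hv : c.fst ∉ O) (hw : (R.facePerm c).snd ∉ O)
    (h : R.faceSize c = 3) (h1 : R.faceSize (R.rot.symm c) ≤ 4)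
    (h2 : R.faceSize (R.rot.symm (R.rot.symm c)) ≤ 4)
    (h3 : R.faceSize (R.facePerm c).symm ≤ 4) : False := by
  refine M.mirror.not_small_small (c := R.rot.symm c) (by rwa [rot_symm_fst]) ?_ ?_ ?_ ?_ ?_
  · rw [← facePerm_two_symm h]
    simpa [facePerm_fst] using hw
  · rwa [faceSize_mirror_rot, Equiv.apply_symm_apply]
  · rw [faceSize_mirror_rot]
    change R.faceSize (R.rot (R.rot.symm (R.rot.symm c))) ≤ 4
    rwa [Equiv.apply_symm_apply]
  · rw [faceSize_mirror_rot]
    change R.faceSize (R.rot (R.rot.symm (R.rot.symm (R.rot.symm c)))) ≤ 4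
    rwa [Equiv.apply_symm_apply]
  · rw [faceSize_mirror]
    change R.faceSize (R.rot.symm (R.rot.symm c).symm) ≤ 4
    rwa [← facePerm_two_symm h, SimpleGraph.Dart.symm_symm, rot_symm_facePerm]

end Tame

end RotationSystem

/-! ### Charge given away along the edges of a face -/

namespace RotationSystem

open Function

theorem Nontouching.rotate {V : Type*} {G : SimpleGraph V} {R : RotationSystem G}
    {O : Finset V} {t : G.Dart} (h : R.faceSize t = 3) (ht : R.Nontouching O t) :
    R.Nontouching O (R.facePerm t) :=
  ⟨by rw [facePerm_fst]; exact ht.2.1, ht.2.2, by rw [facePerm_two_snd h]; exact ht.1⟩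

section Rules

variable {V : Type*} {G : SimpleGraph V} [Fintype V] {R : RotationSystem G} {O : Finset V}

theorem pay_nonneg (t : G.Dart) : 0 ≤ R.pay O t := by
  unfold pay
  split_ifs <;> norm_num

theorem pay_le_one (t : G.Dart) : R.pay O t ≤ 1 := by
  unfold pay
  split_ifs <;> norm_num

theorem pay_of_ne {t : G.Dart} (h : R.faceSize t ≠ 3) : R.pay O t = 0 := by
  simp [pay, h]

theorem pay_of_lt {t : G.Dart} (h : R.faceSize t.symm < 7) : R.pay O t = 0 := by
  simp [pay, h]

/-- A payment above $1/2$ arises only for a triangle disjoint from `O` with a single large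
neighbour. -/
theorem of_half_lt_pay {t : G.Dart} (h : 1 / 2 < R.pay O t) :
    R.faceSize t = 3 ∧ 7 ≤ R.faceSize t.symm ∧ R.Nontouching O t ∧
      ¬ 7 ≤ R.faceSize (R.facePerm t).symm ∧
      ¬ 7 ≤ R.faceSize (R.facePerm (R.facePerm t)).symm := by
  unfold pay at h
  split_ifs at h <;> norm_num at h
  unfold Nontouching
  tauto

theorem oppositePay_nonneg (d : G.Dart) : 0 ≤ R.oppositePay O d := by
  unfold oppositePay
  split_ifs <;> norm_num

theorem oppositePay_le (d : G.Dart) : R.oppositePay O d ≤ 1 / 3 := by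
  unfold oppositePay
  split_ifs <;> norm_num

theorem outerPay_nonneg (d : G.Dart) : 0 ≤ R.outerPay O d := by
  unfold outerPay
  split_ifs <;> norm_num

theorem of_oppositePay_pos {d : G.Dart} (h : 0 < R.oppositePay O d) :
    d.fst ∉ O ∧ G.degree d.fst = 4 ∧ R.Special (R.rot (R.rot d)) ∧ R.faceSize (R.rot d) = 4 ∧
      R.faceSize (R.rot.symm d) = 4 := by
  unfold oppositePay at h
  split_ifs at h with h'
  · obtain ⟨h1, h2, h3, h4⟩ := h'
    refine ⟨h1, h2, h4, ?_, ?_⟩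
    · have := h4.2.2.2
      rwa [facePerm_two_symm h4.1, Equiv.symm_apply_apply] at this
    · rw [rot_symm_of_degree h2, faceSize_rot]
      exact h4.2.1
  · norm_num at h

/-- The face across `d` is then a quadrilateral, so no payment to a triangle and no relief occurs
along `d`. -/
theorem load_of_oppositePay_pos {d : G.Dart} (h : 0 < R.oppositePay O d) :
    R.load O d = R.oppositePay O d := by
  obtain ⟨h1, h2, h3, h4, h5⟩ := of_oppositePay_pos h
  have h4' := h4
  rw [faceSize_rot] at h4'
  have hL : ¬ R.ReliefL O (R.rot d) := fun hL => by have := hL.2.1; omega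
  have hR : ¬ R.ReliefR O d.symm := fun hR => by have := hR.2.1; omega
  rw [load, if_neg hL, if_neg hR, pay_of_ne (by omega)]
  ring

theorem load_le_pay {d : G.Dart} (h : ¬ 0 < R.oppositePay O d) : R.load O d ≤ R.pay O d.symm := by
  unfold load
  split_ifs <;> linarith

theorem load_le_one (d : G.Dart) : R.load O d ≤ 1 := by
  by_cases h : 0 < R.oppositePay O d
  · rw [load_of_oppositePay_pos h]
    linarith [R.oppositePay_le (O := O) d]
  · exact (load_le_pay h).trans (pay_le_one _)

theorem le_four_of_load_pos {d : G.Dart} (h : 0 < R.load O d) : R.faceSize d.symm ≤ 4 := by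
  by_cases h' : 0 < R.oppositePay O d
  · have := (of_oppositePay_pos h').2.2.2.1
    rw [faceSize_rot] at this
    omega
  · by_contra h4
    have := load_le_pay h'
    rw [pay_of_ne (by omega)] at this
    linarith

end Rules

namespace Tame

variable {V : Type*} {G : SimpleGraph V} [Fintype V] {R : RotationSystem G} {O : Finset V}
  (M : R.Tame O)

include M

/-- The two other neighbours of the paid triangle are small. If the vertex had degree four, the
small face across the preceding edge would complete the configuration of `not_small_small`; so it
has degree at least five and gives relief. -/
theorem reliefL {d : G.Dart} (h : 1 / 2 < R.pay O d.symm) (h' : R.faceSize (R.rot.symm d) ≤ 4) :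
    R.ReliefL O (R.rot d) := by
  obtain ⟨h1, h2, h3, h4, h5⟩ := of_half_lt_pay h
  have n2 := h3.rotate h1
  have n3 := n2.rotate (by rwa [faceSize_facePerm])
  have l2 := M.le_four (by rwa [faceSize_facePerm]) h4 fun hO => n2.1 hO.1
  have l3 := M.le_four (by rwa [faceSize_facePerm, faceSize_facePerm]) h5 fun hO => n3.1 hO.1
  rw [SimpleGraph.Dart.symm_symm] at h2
  rw [← facePerm_symm]
  have e : R.faceSize (R.rot (R.facePerm d.symm)) ≤ 4 := by rwa [faceSize_rot]
  have e1 : R.faceSize (R.facePerm d.symm) = 3 := by rwa [faceSize_facePerm]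
  have hv : d.fst ∉ O := h3.2.1
  have hs : R.rot.symm (R.facePerm d.symm) = d := by
    rw [rot_symm_facePerm, SimpleGraph.Dart.symm_symm]
  refine ⟨?_, e1, n2, ?_, ?_, e⟩
  · have h4d := M.four_le d.fst hv
    rw [facePerm_fst]
    change 5 ≤ G.degree d.fst
    rcases h4d.eq_or_lt with hd | hd
    · exfalso
      refine M.not_small_small n2.1 n2.2.1 e1 e ?_ l3
      rwa [facePerm_symm, ← rot_symm_of_degree hd.symm]
    · exact hd
  · rwa [hs]
  · rwa [hs]

theorem reliefR {d : G.Dart} (h : 1 / 2 < R.pay O d.symm)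
    (h' : R.faceSize (R.facePerm d).symm ≤ 4) : R.ReliefR O d.symm := by
  obtain ⟨h1, h2, h3, h4, h5⟩ := of_half_lt_pay h
  have n2 := h3.rotate h1
  have n3 := n2.rotate (by rwa [faceSize_facePerm])
  have l2 := M.le_four (by rwa [faceSize_facePerm]) h4 fun hO => n2.1 hO.1
  have l3 := M.le_four (by rwa [faceSize_facePerm, faceSize_facePerm]) h5 fun hO => n3.1 hO.1
  rw [SimpleGraph.Dart.symm_symm] at h2
  rw [facePerm_two_symm h1] at l3
  have hr : R.faceSize (R.rot (R.rot d.symm)) ≤ 4 := by rwa [← facePerm_apply, faceSize_rot]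
  refine ⟨?_, h1, h3, ?_, hr, l3⟩
  · rcases (M.four_le _ h3.1).eq_or_lt with hd | hd
    · exfalso
      refine M.not_small_small' h3.1 h3.2.2 h1 l3 ?_ l2
      have : R.rot.symm (R.rot.symm d.symm) = R.rot (R.rot d.symm) := by
        rw [Equiv.symm_apply_eq, rot_symm_of_degree hd.symm]
      rwa [this]
    · exact hd
  · rwa [← facePerm_apply, faceSize_facePerm]

theorem load_le_half_left {d : G.Dart} (h : R.faceSize (R.rot.symm d) ≤ 4) :
    R.load O d ≤ 1 / 2 := by
  by_cases h' : 0 < R.oppositePay O d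
  · rw [load_of_oppositePay_pos h']
    linarith [R.oppositePay_le (O := O) d]
  by_cases hp : 1 / 2 < R.pay O d.symm
  · have := R.pay_le_one (O := O) d.symm
    rw [load, if_pos (M.reliefL hp h)]
    split_ifs <;> linarith
  · linarith [load_le_pay h']

theorem load_le_half_right {d : G.Dart} (h : R.faceSize (R.facePerm d).symm ≤ 4) :
    R.load O d ≤ 1 / 2 := by
  by_cases h' : 0 < R.oppositePay O d
  · rw [load_of_oppositePay_pos h']
    linarith [R.oppositePay_le (O := O) d]
  by_cases hp : 1 / 2 < R.pay O d.symm
  · have := R.pay_le_one (O := O) d.symm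
    rw [load, if_pos (M.reliefR hp h)]
    split_ifs <;> linarith
  · linarith [load_le_pay h']

/-- If both loads are positive, the faces across both edges are small; relief at the common vertex
then brings each load down to $1/2$. Otherwise one of them is at most 0 and the other at most 1. -/
theorem load_add_load_le (d : G.Dart) : R.load O d + R.load O (R.facePerm d) ≤ 1 := by
  have h1 := R.load_le_one (O := O) d
  have h2 := R.load_le_one (O := O) (R.facePerm d)
  by_cases p1 : 0 < R.load O d
  · by_cases p2 : 0 < R.load O (R.facePerm d)
    · have := M.load_le_half_right (le_four_of_load_pos p2)
      have := M.load_le_half_left (d := R.facePerm d) (by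
        rw [rot_symm_facePerm]
        exact le_four_of_load_pos p1)
      linarith
    · linarith
  · linarith

/-- The quadrilateral across `d` would have special triangles on two opposite edges. -/
theorem not_oppositePay {d : G.Dart} (h : 0 < R.oppositePay O d)
    (h' : 0 < R.oppositePay O (R.facePerm d)) : False := by
  obtain ⟨a1, a2, a3, a4, a5⟩ := of_oppositePay_pos h
  obtain ⟨b1, b2, b3, b4, b5⟩ := of_oppositePay_pos h'
  rw [facePerm_fst] at b2
  have e : R.rot (R.rot (R.rot (R.facePerm d))) = d.symm := by
    rw [← rot_symm_of_degree (by rwa [facePerm_fst]), rot_symm_facePerm]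
  refine M.four_opposite (d := R.rot (R.rot (R.facePerm d))) ?_ ?_ ?_ b3.1 ?_
  · rwa [R.rot_fst, R.rot_fst]
  · rw [e]
    exact a1
  · rw [e, ← faceSize_rot]
    exact a4
  · rw [e, facePerm_symm, ← faceSize_rot]
    exact a3.1

theorem oppositePay_add_le (d : G.Dart) :
    R.oppositePay O d + R.oppositePay O (R.facePerm d) ≤ 1 / 3 := by
  have h1 := R.oppositePay_le (O := O) d
  have h2 := R.oppositePay_le (O := O) (R.facePerm d)
  by_cases h : 0 < R.oppositePay O d
  · by_cases h' : 0 < R.oppositePay O (R.facePerm d)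
    · exact (M.not_oppositePay h h').elim
    · linarith
  · linarith

end Tame

end RotationSystem

/-! ### Bad edges of full seven-faces -/

namespace RotationSystem

open Function

theorem rot_symm_rot_symm_of_degree {V : Type*} {G : SimpleGraph V} {R : RotationSystem G}
    [Fintype V] {d : G.Dart} (h : G.degree d.fst = 4) :
    R.rot.symm (R.rot.symm d) = R.rot (R.rot d) := by
  rw [Equiv.symm_apply_eq, rot_symm_of_degree h]

theorem Full.apply {V : Type*} {G : SimpleGraph V} {R : RotationSystem G} [Fintype V]
    {O : Finset V} {d x : G.Dart} (h : R.Full O d) (n : ℕ) (hx : R.facePerm^[n] d = x) :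
    x.fst ∉ O ∧ G.degree x.fst = 4 ∧ R.faceSize x.symm = 3 :=
  hx ▸ h.2 n

namespace Tame

variable {V : Type*} {G : SimpleGraph V} [Fintype V] {R : RotationSystem G} {O : Finset V}
  (M : R.Tame O)

include M

/-- The face in question is opposite to the face of `d` at `d.snd`. If it were full, the apex
`c.fst` of the triangle across the next edge would have degree four and see the small face at
position 2 between two triangles. A quadrilateral cannot lie there, and a triangle would have three
triangular neighbours, the third being across the edge at position 2. -/
theorem not_full_of_bad_left {d : G.Dart} (hb : R.Bad O d) :
    ¬ R.Full O (R.facePerm (R.facePerm d.symm)).symm := by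
  intro hX
  obtain ⟨hF, h2, -, -⟩ := hb
  obtain ⟨i1, g1, s1⟩ := hF.apply 1 (x := R.facePerm d) rfl
  obtain ⟨i2, g2, s2⟩ := hF.apply 2 (x := R.facePerm (R.facePerm d)) rfl
  have s0 := (hF.2 0).2.2
  simp only [iterate_succ_apply', iterate_zero, id] at *
  set d1 := R.facePerm d with hd1
  set d2 := R.facePerm d1 with hd2
  have eX : (R.facePerm (R.facePerm d.symm)).symm = R.facePerm (R.rot d1).symm := by
    rw [facePerm_two_symm s0, facePerm_symm, ← rot_symm_rot_symm_of_degree g1, hd1,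
      rot_symm_facePerm]
  rw [eX] at hX
  have per := R.iterate_faceSize (R.facePerm (R.rot d1).symm)
  rw [hX.1] at per
  have a5 := hX.2 5
  simp only [iterate_succ_apply', iterate_zero, id] at per a5
  have per' := R.facePerm.injective per
  obtain ⟨ic, gc, -⟩ := hX.apply 6 per'
  have sc := a5.2.2
  rw [← rot_symm_facePerm, per', rot_symm_of_degree gc] at sc
  set c := (R.rot d1).symm with hc
  have r1 : R.rot c = R.facePerm (R.facePerm d1.symm) := by
    rw [hc, ← facePerm_apply, facePerm_symm]
  have r2 : R.rot.symm d1.symm = R.rot (R.rot d2) := by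
    rw [← rot_symm_rot_symm_of_degree g2, hd2, rot_symm_facePerm]
  have t1 : R.faceSize (R.rot c) = 3 := by
    rw [r1, faceSize_facePerm, faceSize_facePerm]
    exact s1
  have t2 : R.faceSize (R.rot (R.rot c)) = R.faceSize (R.rot (R.rot d2)) := by
    rw [faceSize_rot, r1, facePerm_two_symm s1, r2]
  rw [← t2] at h2
  have ic' : (R.rot c).fst ∉ O := by rwa [R.rot_fst]
  rcases M.three_or_four h2 with h2 | h2
  · refine M.not_three_neighbors h2 ?_ ?_ ?_ ?_
    · rwa [← faceSize_rot]
    · have e : (R.facePerm (R.rot (R.rot c))).symm = R.rot d2 := by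
        apply R.rot.injective
        rw [← facePerm_apply, ← (R.facePerm (R.facePerm (R.rot (R.rot c)))).symm_symm,
          facePerm_two_symm h2, Equiv.symm_apply_apply, r1, facePerm_two_symm s1, r2]
      rw [e, faceSize_rot]
      exact s2
    · rw [facePerm_two_symm h2, Equiv.symm_apply_apply]
      exact t1
    · intro hO
      rw [R.rot_fst] at hO
      exact ic' hO.1
  · exact M.three_four_three ic' t1 h2 sc

/-- The same argument on the other side: the apex is `k.fst`, above the edge at position 6, and the
small face is the one at position 6. -/
theorem not_full_of_bad_right {d : G.Dart} (hb : R.Bad O d) :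
    ¬ R.Full O (R.facePerm d.symm).symm := by
  intro hX
  obtain ⟨hF, -, -, h6⟩ := hb
  obtain ⟨i0, g0, s0⟩ := hF.2 0
  have s6 := (hF.2 6).2.2
  have s5 := (hF.2 5).2.2
  have per := R.iterate_faceSize d
  rw [hF.1] at per
  obtain ⟨-, -, u1⟩ := hX.2 1
  obtain ⟨j2, k2, u2⟩ := hX.apply 2 (x := R.facePerm (R.rot (R.rot d)))
    (by simp only [iterate_succ_apply', iterate_zero, id, facePerm_symm])
  simp only [iterate_succ_apply', iterate_zero, id] at *
  set d5 := R.facePerm (R.facePerm (R.facePerm (R.facePerm (R.facePerm d)))) with hd5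
  set d6 := R.facePerm d5 with hd6
  have g6 := (hF.apply 6 (x := d6) rfl).2.1
  have e1 : R.rot (R.rot d) = R.rot.symm d6.symm := by
    rw [← rot_symm_rot_symm_of_degree g0, ← rot_symm_facePerm, per]
  set g := R.facePerm (R.rot (R.rot d)) with hg
  have e2 : R.rot.symm g = (R.rot.symm d6.symm).symm := by
    rw [hg, rot_symm_facePerm, e1]
  have e3 : (R.rot.symm d6.symm).symm = R.rot (R.rot d6).symm := by
    rw [← facePerm_two_symm s6, SimpleGraph.Dart.symm_symm, facePerm_symm, facePerm_apply]
  set k := (R.rot d6).symm with hk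
  have e4 : R.rot (R.rot k) = g := by
    rw [← e3, ← e2, Equiv.apply_symm_apply]
  have gk : G.degree k.fst = 4 := by
    rw [← e4, R.rot_fst, R.rot_fst] at k2
    exact k2
  have ik : k.fst ∉ O := by
    rw [← e4, R.rot_fst, R.rot_fst] at j2
    exact j2
  have t0 : R.faceSize k = R.faceSize (R.rot (R.rot d6)) := by
    rw [hk, ← faceSize_rot]
  have t1 : R.faceSize (R.rot k) = 3 := by
    rw [← e3, ← facePerm_two_symm s6, SimpleGraph.Dart.symm_symm, faceSize_facePerm,
      faceSize_facePerm]
    exact s6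
  have t3 : R.faceSize (R.rot.symm k) = 3 := by
    rw [rot_symm_of_degree gk, e4, faceSize_rot]
    exact u2
  rw [← t0] at h6
  rcases M.three_or_four h6 with h6 | h6
  · refine M.not_three_neighbors h6 ?_ ?_ ?_ fun hO => ik hO.1
    · rwa [← faceSize_rot]
    · rw [hk, facePerm_symm, ← faceSize_rot, ← rot_symm_of_degree g6, hd6, rot_symm_facePerm]
      exact s5
    · rwa [facePerm_two_symm h6]
  · refine M.three_four_three (e := R.rot.symm k) (by rwa [rot_symm_fst]) t3 ?_ ?_ <;>
      rwa [Equiv.apply_symm_apply]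

end Tame

end RotationSystem

/-! ### Seven-faces spend at most their charge -/

namespace RotationSystem

open Function

section

variable {V : Type*} {G : SimpleGraph V} {R : RotationSystem G}

theorem two_mul_sum_face_le {f : G.Dart → ℚ} {b : ℚ} (h : ∀ d, f d + f (R.facePerm d) ≤ b)
    (d : G.Dart) :
    2 * ∑ i ∈ Finset.range (R.faceSize d), f (R.facePerm^[i] d) ≤ R.faceSize d * b := by
  have h1 : ∑ i ∈ Finset.range (R.faceSize d), f (R.facePerm^[i + 1] d) =
      ∑ i ∈ Finset.range (R.faceSize d), f (R.facePerm^[i] d) := by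
    have h2 := Finset.sum_range_succ (fun i => f (R.facePerm^[i] d)) (R.faceSize d)
    rw [Finset.sum_range_succ', R.iterate_faceSize] at h2
    exact add_right_cancel h2
  have h2 := Finset.sum_le_sum fun i (_ : i ∈ Finset.range (R.faceSize d)) =>
    h (R.facePerm^[i] d)
  simp only [← iterate_succ_apply' (f := R.facePerm)] at h2
  rw [Finset.sum_add_distrib, h1, Finset.sum_const, Finset.card_range, nsmul_eq_mul] at h2
  linarith

variable [Fintype V] {O : Finset V}

theorem Full.facePerm_apply {d : G.Dart} (h : R.Full O d) : R.Full O (R.facePerm d) :=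
  ⟨by rw [faceSize_facePerm, h.1], fun n => h.2 (n + 1)⟩

theorem rot_rot_of_full {d : G.Dart} (h : R.Full O d) :
    (R.facePerm (R.facePerm d.symm)).symm = R.rot (R.rot (R.facePerm d)) := by
  obtain ⟨a, g, s⟩ := h.apply 1 (x := R.facePerm d) rfl
  rw [facePerm_two_symm (h.apply 0 (x := d) rfl).2.2, ← rot_symm_facePerm,
    rot_symm_rot_symm_of_degree g]

/-- The darts of large faces that pay and whose vertex does not give charge to the face. -/
def Unaided (R : RotationSystem G) (O : Finset V) (d : G.Dart) : Prop :=
  R.faceSize d = 7 ∧ 0 < R.load O d ∧ ¬ R.GiveBetween O d ∧ R.outerPay O d = 0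

end

namespace Tame

variable {V : Type*} {G : SimpleGraph V} [Fintype V] {R : RotationSystem G} {O : Finset V}
  (M : R.Tame O)

include M

theorem oppositePay_eq_zero {d : G.Dart} (h : R.Unaided O d) :
    ¬ 0 < R.oppositePay O (R.facePerm d) := by
  intro hp
  by_cases h0 : 0 < R.oppositePay O d
  · exact M.not_oppositePay h0 hp
  have h4 := (of_oppositePay_pos hp).2.2.2.2
  rw [rot_symm_facePerm] at h4
  have := load_le_pay h0
  rw [pay_of_ne (by omega)] at this
  linarith [h.2.1]

theorem degree_le_two {d : G.Dart} (h : R.Unaided O d) (hO : d.fst ∈ O) :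
    G.degree d.fst ≤ 2 ∧ d.snd ∈ O := by
  have h2 : G.degree d.fst ≤ 2 := by
    by_contra h3
    have h0 := h.2.2.2
    rw [outerPay, if_pos ⟨hO, by omega, fun ho => by have := ho.1; have := h.1; omega⟩] at h0
    norm_num at h0
  refine ⟨h2, ?_⟩
  have := (G.mem_neighborFinset _ _).2 d.adj
  rw [← (M.erase_eq_neighborFinset h2).2] at this
  exact Finset.mem_of_mem_erase this

/-- Otherwise three consecutive vertices of the face would lie in `O` with degree at most two. They
exhaust `O`, against `three_le`. -/
theorem fst_notMem {d : G.Dart} (h : ∀ n, R.Unaided O (R.facePerm^[n] d)) : d.fst ∉ O := by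
  intro hO
  obtain ⟨a1, b1⟩ := M.degree_le_two (d := d) (h 0) hO
  obtain ⟨a2, b2⟩ := M.degree_le_two (d := R.facePerm d) (h 1) (by rwa [facePerm_fst])
  obtain ⟨a3, -⟩ := M.degree_le_two (d := R.facePerm (R.facePerm d)) (h 2) (by rwa [facePerm_fst])
  obtain ⟨v, hv, h3⟩ := M.three_le ⟨_, hO⟩
  have e1 := R.facePerm_fst d
  have e2 := R.facePerm_fst (R.facePerm d)
  rcases M.eq_of_mem hO b1 b2 hv d.adj.ne (M.ne (R.turn_facePerm d))
    (e1 ▸ (R.facePerm d).adj.ne) with rfl | rfl | rfl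
  · omega
  · rw [e1] at a2
    omega
  · rw [e2] at a3
    omega

/-- Every edge pays a triangle, so the faces across both adjacent edges are small. A payment above
$1/2$ would therefore be relieved at both ends and leave no positive load. Once all payments are at
most $1/2$, a single relief would also cancel the load, so there is none; and then a vertex of
degree at least five would give charge by `GiveBetween`. -/
theorem full_of_unaided {d : G.Dart} (h : ∀ n, R.Unaided O (R.facePerm^[n] d)) :
    R.Full O d ∧ R.pay O d.symm ≤ 1 / 2 ∧ 0 < R.pay O d.symm ∧
      R.load O d ≤ R.pay O d.symm := by
  have h7 : R.faceSize d = 7 := (h 0).1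
  have shift : ∀ n, R.facePerm^[n + 7] d = R.facePerm^[n] d := by
    intro n
    have := R.iterate_faceSize d
    rw [h7] at this
    rw [iterate_add_apply, this]
  have key : ∀ n, ¬ 0 < R.oppositePay O (R.facePerm^[n] d) := by
    intro n
    -- Position `n + 6` precedes position `n` on a seven-face.
    have := M.oppositePay_eq_zero (h (n + 6))
    rwa [← iterate_succ_apply' (f := R.facePerm), shift] at this
  have keyp : ∀ n, 0 < R.pay O (R.facePerm^[n] d).symm := fun n =>
    (h n).2.1.trans_le (load_le_pay (key n))
  have key3 : ∀ n, R.faceSize (R.facePerm^[n] d).symm = 3 := by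
    intro n
    by_contra h3
    have := keyp n
    rw [pay_of_ne h3] at this
    exact lt_irrefl _ this
  have prev : ∀ n, R.rot.symm (R.facePerm^[n + 1] d) = (R.facePerm^[n] d).symm := fun n => by
    rw [iterate_succ_apply', rot_symm_facePerm]
  have keyl : ∀ n, R.pay O (R.facePerm^[n] d).symm ≤ 1 / 2 := by
    suffices H : ∀ n, R.pay O (R.facePerm^[n + 1] d).symm ≤ 1 / 2 from fun n =>
      shift n ▸ H (n + 6)
    intro n
    have k1 := key3 n
    have k3 := key3 (n + 2)
    rw [← prev] at k1
    rw [iterate_succ_apply'] at k3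
    by_contra hp
    push Not at hp
    have hlt := (h (n + 1)).2.1
    have := R.pay_le_one (O := O) (R.facePerm^[n + 1] d).symm
    have := key (n + 1)
    rw [load, if_pos (M.reliefL hp (by omega)), if_pos (M.reliefR hp (by omega))] at hlt
    linarith
  have keyr : ∀ n, ¬ R.ReliefL O (R.rot (R.facePerm^[n] d)) ∧
      ¬ R.ReliefR O (R.facePerm^[n] d).symm := by
    intro n
    have hlt := (h n).2.1
    have h1 := keyl n
    have h2 := key n
    constructor
    · intro hL
      rw [load, if_pos hL] at hlt
      split_ifs at hlt <;> linarith
    · intro hR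
      rw [load, if_pos hR] at hlt
      split_ifs at hlt <;> linarith
  have keyO : ∀ n, (R.facePerm^[n] d).fst ∉ O := fun n =>
    M.fst_notMem fun m => by
      rw [← iterate_add_apply]
      exact h _
  have keyd : ∀ n, G.degree (R.facePerm^[n] d).fst = 4 := by
    suffices H : ∀ n, G.degree (R.facePerm^[n + 1] d).fst = 4 from fun n => shift n ▸ H (n + 6)
    intro n
    rcases (M.four_le _ (keyO (n + 1))).eq_or_lt with h4 | h5
    · exact h4.symm
    · refine absurd ⟨keyO (n + 1), h5, (h (n + 1)).1.ge, ?_, ?_, (keyr (n + 1)).1, ?_⟩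
        (h (n + 1)).2.2.1
      · rw [faceSize_rot]
        exact key3 (n + 1)
      · rw [prev]
        exact key3 n
      · rw [prev]
        exact (keyr n).2
  exact ⟨⟨h7, fun n => ⟨keyO n, keyd n, key3 n⟩⟩, keyl 0, keyp 0, load_le_pay (key 0)⟩

theorem three_of_full {d : G.Dart} (h : R.Full O d) :
    R.faceSize (R.rot (R.rot (R.rot d))) = 3 ∧
      (R.faceSize (R.rot (R.rot d)) ≤ 4 → R.faceSize (R.rot (R.rot d)) = 3) := by
  obtain ⟨a, g, s⟩ := h.apply 0 (x := d) rfl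
  have s' := (h.2 6).2.2
  have e : R.facePerm (R.facePerm^[6] d) = d := by
    rw [← iterate_succ_apply' (f := R.facePerm), show Nat.succ 6 = R.faceSize d from h.1.symm,
      iterate_faceSize]
  rw [← rot_symm_facePerm, e, rot_symm_of_degree g] at s'
  refine ⟨s', fun h4 => ?_⟩
  rcases M.three_or_four h4 with h4 | h4
  · exact h4
  · exact (M.three_four_three (e := R.rot d) (by rwa [R.rot_fst]) (by rwa [faceSize_rot]) h4
      s').elim

/-- Small opposite faces at a full face are triangles. Two consecutive ones give three consecutive
triangles at a vertex with a further triangle beyond the first. -/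
theorem not_small_of_full {d : G.Dart} (h : R.Full O d)
    (h' : R.faceSize (R.rot (R.rot d)) ≤ 4 ∧ R.faceSize (R.rot (R.rot (R.facePerm d))) ≤ 4) :
    False := by
  obtain ⟨a, g, s⟩ := h.apply 0 (x := d) rfl
  refine M.not_three_consecutive (e := R.rot d) (by rwa [R.rot_fst]) (by rwa [faceSize_rot])
    ((M.three_of_full h).2 h'.1) (M.three_of_full h).1 ?_
  rw [← R.facePerm_symm, rot_rot_of_full h]
  exact (M.three_of_full h.facePerm_apply).2 h'.2

/-- The charge that a triangle receives from a full face. -/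
theorem pay_of_full {d : G.Dart} (h : R.Full O d) (hp : 0 < R.pay O d.symm)
    (h1 : ¬ R.faceSize (R.rot (R.rot d)) ≤ 4)
    (h2 : ¬ R.faceSize (R.rot (R.rot (R.facePerm d))) ≤ 4) :
    R.pay O d.symm = 1 / 3 ∧ ¬ R.Bad O d := by
  obtain ⟨a, g, s⟩ := h.apply 0 (x := d) rfl
  obtain ⟨b, -, -⟩ := h.apply 1 (x := R.facePerm d) rfl
  rw [facePerm_fst] at b
  have hs1 : R.faceSize (R.facePerm d.symm) = 3 := by rwa [faceSize_facePerm]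
  have hs2 : R.faceSize (R.facePerm (R.facePerm d.symm)) = 3 := by rwa [faceSize_facePerm]
  have big1 : 7 ≤ R.faceSize (R.facePerm d.symm).symm := by
    by_contra hlt
    have := M.le_four hs1 hlt fun hO => a (by rw [facePerm_fst] at hO; exact hO.1)
    rw [facePerm_symm, ← faceSize_rot] at this
    exact h1 this
  have big2 : 7 ≤ R.faceSize (R.facePerm (R.facePerm d.symm)).symm := by
    by_contra hlt
    have := M.le_four hs2 hlt fun hO => b (by rw [facePerm_two_snd s] at hO; exact hO.2)
    rw [rot_rot_of_full h] at this
    exact h2 this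
  have nb1 : ¬ R.Bad O (R.facePerm d.symm).symm := fun hb => M.not_full_of_bad_left hb (by
    rwa [SimpleGraph.Dart.symm_symm, facePerm_three s, SimpleGraph.Dart.symm_symm])
  have nb2 : ¬ R.Bad O (R.facePerm (R.facePerm d.symm)).symm := fun hb =>
    M.not_full_of_bad_right hb (by
      rwa [SimpleGraph.Dart.symm_symm, facePerm_three s, SimpleGraph.Dart.symm_symm])
  have hO : ¬ (d.symm.fst ∈ O ∨ d.symm.snd ∈ O) := fun hO => hO.elim b a
  rw [pay, if_neg hO, if_pos big1, if_pos big2, if_pos (Or.inl big1), if_neg (not_or.2 ⟨nb1, nb2⟩),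
    SimpleGraph.Dart.symm_symm] at hp ⊢
  split_ifs at hp ⊢ with c1 c2 c3
  all_goals first | exact absurd hp (lt_irrefl _) | exact ⟨rfl, c3⟩

theorem sum_load_seven {d : G.Dart} (h7 : R.faceSize d = 7) :
    ∑ i ∈ Finset.range 7, R.load O (R.facePerm^[i] d) ≤
      3 + ∑ i ∈ Finset.range 7, (1 / 2 * (if R.GiveBetween O (R.facePerm^[i] d) then 1 else 0) +
        R.outerPay O (R.facePerm^[i] d)) := by
  have hsum := R.two_mul_sum_face_le (f := R.load O) M.load_add_load_le d
  rw [h7] at hsum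
  have hnn : ∀ i ∈ Finset.range 7,
      0 ≤ 1 / 2 * (if R.GiveBetween O (R.facePerm^[i] d) then 1 else 0) +
        R.outerPay O (R.facePerm^[i] d) := by
    intro i _
    have := R.outerPay_nonneg (O := O) (R.facePerm^[i] d)
    split_ifs <;> linarith
  have hnn' := Finset.sum_nonneg hnn
  -- Loads of adjacent edges sum to at most 1, so the total is at most $7/2$; a gift of $1/2$ from a
  -- vertex settles the case.
  by_cases hgive : ∃ i ∈ Finset.range 7, 1 / 2 ≤
      1 / 2 * (if R.GiveBetween O (R.facePerm^[i] d) then 1 else 0) +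
        R.outerPay O (R.facePerm^[i] d)
  · obtain ⟨i, hi, h⟩ := hgive
    have := Finset.single_le_sum hnn hi
    push_cast at hsum
    linarith
  have shift : ∀ n, R.facePerm^[n + 7] d = R.facePerm^[n] d := by
    intro n
    have := R.iterate_faceSize d
    rw [h7] at this
    rw [iterate_add_apply, this]
  have shift' : ∀ n, R.facePerm^[n] d = R.facePerm^[n % 7] d := by
    intro n
    conv_lhs => rw [← Nat.mod_add_div n 7]
    generalize n / 7 = m
    induction m with
    | zero => rfl
    | succ m ih => rw [Nat.mul_succ, ← Nat.add_assoc, shift, ih]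
  -- If one edge has no load, the remaining six form three adjacent pairs of load at most 1.
  by_cases hpos : ∃ i ∈ Finset.range 7, R.load O (R.facePerm^[i] d) ≤ 0
  · obtain ⟨i, hi, h⟩ := hpos
    refine le_trans ?_ (le_add_of_nonneg_right hnn')
    have p := fun n => M.load_add_load_le (R.facePerm^[n] d)
    simp only [← iterate_succ_apply' (f := R.facePerm)] at p
    have p0 := p 0; have p1 := p 1; have p2 := p 2; have p3 := p 3
    have p4 := p 4; have p5 := p 5; have p6 := p 6
    have s7 := shift 0
    simp only [Nat.succ_eq_add_one, Nat.reduceAdd, zero_add] at p0 p1 p2 p3 p4 p5 p6 s7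
    rw [s7] at p6
    simp only [Finset.sum_range_succ, Finset.sum_range_zero]
    rw [Finset.mem_range] at hi
    interval_cases i <;> linarith
  refine le_trans ?_ (le_add_of_nonneg_right hnn')
  push Not at hgive hpos
  have hun : ∀ n, R.Unaided O (R.facePerm^[n] d) := by
    intro n
    rw [shift' n]
    have hn : n % 7 ∈ Finset.range 7 := Finset.mem_range.2 (Nat.mod_lt _ (by norm_num))
    have hg := hgive _ hn
    have h0 := R.outerPay_nonneg (O := O) (R.facePerm^[n % 7] d)
    refine ⟨by rw [faceSize_iterate, h7], hpos _ hn, fun hb => ?_, ?_⟩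
    · rw [if_pos hb] at hg
      linarith
    · have : 0 ≤ (if R.GiveBetween O (R.facePerm^[n % 7] d) then (1 : ℚ) else 0) := by
        split_ifs <;> norm_num
      unfold outerPay at hg ⊢
      split_ifs at hg ⊢ with hc
      all_goals first | rfl | linarith
  have hfull : ∀ n, R.Full O (R.facePerm^[n] d) ∧ R.pay O (R.facePerm^[n] d).symm ≤ 1 / 2 ∧
      0 < R.pay O (R.facePerm^[n] d).symm ∧
      R.load O (R.facePerm^[n] d) ≤ R.pay O (R.facePerm^[n] d).symm := fun n =>
    M.full_of_unaided fun m => by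
      rw [← iterate_add_apply]
      exact hun _
  -- In the remaining case the face is full; `b n` records whether the face opposite to it at the
  -- `n`-th vertex is small.
  set b : ℕ → Bool := fun n => decide (R.faceSize (R.rot (R.rot (R.facePerm^[n] d))) ≤ 4) with hb
  have hbt : ∀ n, b n = true ↔ R.faceSize (R.rot (R.rot (R.facePerm^[n] d))) ≤ 4 := fun n =>
    decide_eq_true_iff
  have hbf : ∀ n, b n = false ↔ ¬ R.faceSize (R.rot (R.rot (R.facePerm^[n] d))) ≤ 4 := fun n =>
    decide_eq_false_iff_not
  -- An edge pays at most $1/2$, and exactly $1/3$ if the opposite faces at both of its ends are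
  -- large. Summed around the face this is at most $\frac73+\frac13\sum b$, so it suffices that at
  -- most two values of `b` are true.
  have hload : ∀ n, R.load O (R.facePerm^[n] d) ≤
      1 / 3 + ((b n).toNat + (b (n + 1)).toNat) / 6 := by
    intro n
    obtain ⟨f1, f2, f3, f4⟩ := hfull n
    rcases Bool.eq_false_or_eq_true (b n) with u1 | u1
    · rw [u1, Bool.toNat_true]
      have : (0 : ℚ) ≤ (b (n + 1)).toNat := by positivity
      push_cast
      linarith
    rcases Bool.eq_false_or_eq_true (b (n + 1)) with u2 | u2
    · rw [u2, Bool.toNat_true]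
      have : (0 : ℚ) ≤ (b n).toNat := by positivity
      push_cast
      linarith
    have := (M.pay_of_full f1 f3 ((hbf _).1 u1)
      (by rw [← iterate_succ_apply' (f := R.facePerm)]; exact (hbf _).1 u2)).1
    rw [u1, u2, Bool.toNat_false]
    push_cast
    linarith
  have b7 : ∀ i, b (i + 7) = b i := fun i => by simp only [hb, shift]
  have hcard := toNat_add_le_two_of_periodic b b7 (fun i => by
      rw [Bool.not_eq_true', ← Bool.not_eq_true, Bool.and_eq_true, hbt, hbt]
      intro hi
      exact M.not_small_of_full (hfull i).1 ⟨hi.1, by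
        rw [← iterate_succ_apply' (f := R.facePerm)]
        exact hi.2⟩) (fun i => by
      -- The forbidden pattern would make the edge `Bad`, although it makes a positive payment.
      by_contra hne
      simp only [Bool.or_eq_true, Bool.not_eq_true', not_or, Bool.not_eq_true,
        Bool.not_eq_false] at hne
      obtain ⟨⟨⟨⟨h0, h1⟩, h2⟩, h4⟩, h6⟩ := hne
      rw [hbf] at h0 h1
      rw [hbt] at h2 h4 h6
      refine (M.pay_of_full (hfull i).1 (hfull i).2.2.1 h0
        (by rwa [← iterate_succ_apply' (f := R.facePerm)])).2 ⟨(hfull i).1, ?_, ?_, ?_⟩ <;>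
      · rw [← iterate_add_apply, Nat.add_comm]
        assumption)
  have l0 := hload 0
  have l1 := hload 1
  have l2 := hload 2
  have l3 := hload 3
  have l4 := hload 4
  have l5 := hload 5
  have l6 := hload 6
  rw [b7 0] at l6
  simp only [Nat.reduceAdd, zero_add] at l0 l1 l2 l3 l4 l5 l6
  have hcard' := (Nat.cast_le (α := ℚ)).2 hcard
  push_cast at hcard'
  simp only [Finset.sum_range_succ, Finset.sum_range_zero]
  linarith

end Tame

end RotationSystem

/-! ### Triangles receive at least 1 -/

namespace RotationSystem

open Function

section

variable {V : Type*} {G : SimpleGraph V} [Fintype V] {R : RotationSystem G} {O : Finset V}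

theorem Special.rotate {t : G.Dart} (h : R.Special t) : R.Special (R.facePerm t) := by
  obtain ⟨h1, h2, h3, h4⟩ := h
  refine ⟨by rwa [faceSize_facePerm], h3, h4, ?_⟩
  rwa [facePerm_three h1]

theorem pay_of_touching {t : G.Dart} (h : R.faceSize t = 3) (hb : 7 ≤ R.faceSize t.symm)
    (hO : t.fst ∈ O ∨ t.snd ∈ O) : R.pay O t = 1 / 2 := by
  rw [pay, if_pos ⟨h, hb⟩, if_pos hO]

/-- The charge that the triangle at `t` receives at the corner `t`. -/
noncomputable def gain (R : RotationSystem G) (O : Finset V) (t : G.Dart) : ℚ :=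
  R.pay O t + R.oppositePay O (R.rot.symm (R.rot.symm t)) +
    1 / 3 * (if R.GiveSpecial O t then 1 else 0) + R.outerPay O t +
    1 / 3 * (if R.Outer O t then 1 else 0)

theorem pay_le_gain (t : G.Dart) : R.pay O t ≤ R.gain O t := by
  have h1 := R.oppositePay_nonneg (O := O) (R.rot.symm (R.rot.symm t))
  have h2 := R.outerPay_nonneg (O := O) t
  unfold gain
  split_ifs <;> linarith

theorem gain_nonneg (t : G.Dart) : 0 ≤ R.gain O t := (pay_nonneg t).trans (pay_le_gain t)

theorem outerPay_le_gain (t : G.Dart) : R.outerPay O t ≤ R.gain O t := by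
  have h1 := R.oppositePay_nonneg (O := O) (R.rot.symm (R.rot.symm t))
  have h2 := R.pay_nonneg (O := O) t
  unfold gain
  split_ifs <;> linarith

theorem third_le_gain_of_outer {t : G.Dart} (h : R.Outer O t) : 1 / 3 ≤ R.gain O t := by
  have h1 := R.oppositePay_nonneg (O := O) (R.rot.symm (R.rot.symm t))
  have h2 := R.pay_nonneg (O := O) t
  have h3 := R.outerPay_nonneg (O := O) t
  rw [gain, if_pos h]
  split_ifs <;> linarith

theorem Outer.rotate {t : G.Dart} (h : R.Outer O t) : R.Outer O (R.facePerm t) := by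
  obtain ⟨h1, h2, h3, h4⟩ := h
  exact ⟨by rwa [faceSize_facePerm], by rwa [facePerm_fst], h4, by rwa [facePerm_two_snd h1]⟩

/-- The total gain of a triangle. -/
noncomputable def triangleGain (R : RotationSystem G) (O : Finset V) (t : G.Dart) : ℚ :=
  R.gain O t + R.gain O (R.facePerm t) + R.gain O (R.facePerm (R.facePerm t))

theorem triangleGain_facePerm {t : G.Dart} (h : R.faceSize t = 3) :
    R.triangleGain O (R.facePerm t) = R.triangleGain O t := by
  unfold triangleGain
  rw [facePerm_three h]
  ring

end

namespace Tame

variable {V : Type*} {G : SimpleGraph V} [Fintype V] {R : RotationSystem G} {O : Finset V}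
  (M : R.Tame O)

include M

/-- At degree four the opposite face has size at least 5, since a small one would touch
quadrilaterals on both sides; so it pays. At larger degree the vertex pays. -/
theorem third_le_gain_of_special {t : G.Dart} (h : R.Special t) (hO : t.fst ∉ O) :
    1 / 3 ≤ R.gain O t := by
  have h1 := R.oppositePay_nonneg (O := O) (R.rot.symm (R.rot.symm t))
  have h2 := R.pay_nonneg (O := O) t
  have h3 := R.outerPay_nonneg (O := O) t
  rcases (M.four_le _ hO).eq_or_lt with h4 | h5
  · have hs : R.oppositePay O (R.rot.symm (R.rot.symm t)) = 1 / 3 := by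
      have e : R.rot (R.rot (R.rot.symm (R.rot.symm t))) = t := by simp
      refine if_pos ⟨by rwa [rot_symm_fst, rot_symm_fst],
        by rw [rot_symm_fst, rot_symm_fst]; exact h4.symm, ?_, by rwa [e]⟩
      rw [rot_symm_rot_symm_of_degree h4.symm]
      by_contra hlt
      have h6 : R.faceSize (R.rot t) = 4 := by
        rw [faceSize_rot]
        exact h.2.1
      rcases M.three_or_four (d := R.rot (R.rot t)) (by omega) with h7 | h7
      · exact M.three_four_three hO h.1 h6 h7
      · exact M.four_four h6 h7
    unfold gain
    split_ifs <;> linarith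
  · rw [gain, if_pos ⟨hO, h5, h⟩]
    split_ifs <;> linarith

/-- Otherwise two triangles and a quadrilateral would be consecutive at `t.fst`. -/
theorem neighbors_eq {t : G.Dart} (h : R.faceSize t = 3) (hO : t.fst ∉ O)
    (h1 : R.faceSize t.symm ≤ 4) (h2 : R.faceSize (R.facePerm (R.facePerm t)).symm ≤ 4) :
    R.faceSize t.symm = R.faceSize (R.facePerm (R.facePerm t)).symm := by
  rw [facePerm_two_symm h] at h2 ⊢
  rw [← faceSize_rot] at h1 ⊢
  have hO' : (R.rot.symm t).fst ∉ O := by rwa [rot_symm_fst]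
  rcases M.three_or_four h1 with a | a <;> rcases M.three_or_four h2 with b | b
  · rw [a, b]
  · exact (M.four_three_three hO' b (by rwa [Equiv.apply_symm_apply])
      (by rwa [Equiv.apply_symm_apply])).elim
  · exact (M.three_three_four hO' b (by rwa [Equiv.apply_symm_apply])
      (by rwa [Equiv.apply_symm_apply])).elim
  · rw [a, b]

theorem special_of_small {t : G.Dart} (h : R.faceSize t = 3) (hO : t.fst ∉ O) (hO' : t.snd ∉ O)
    (h1 : R.faceSize t.symm ≤ 4) (h2 : R.faceSize (R.facePerm t).symm ≤ 4)
    (h3 : R.faceSize (R.facePerm (R.facePerm t)).symm ≤ 4) : R.Special t := by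
  have e1 := M.neighbors_eq h hO h1 h3
  have e2 := M.neighbors_eq (t := R.facePerm t) (by rwa [faceSize_facePerm])
    (by rwa [facePerm_fst]) h2 (by rwa [facePerm_three h])
  rw [facePerm_three h] at e2
  rcases M.three_or_four h1 with a | a
  · exact (M.not_three_neighbors h a (by omega) (by omega) fun hx => hO hx.1).elim
  · exact ⟨h, a, by omega, by omega⟩

/-- A vertex of `O` with a neighbour outside `O` has degree at least three. -/
theorem outerPay_eq {e : G.Dart} (he : e.fst ∈ O) {w : V} (hw : G.Adj e.fst w) (hwO : w ∉ O)
    (h : ¬ R.Outer O e) : R.outerPay O e = 1 / 2 := by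
  refine if_pos ⟨he, ?_, h⟩
  by_contra hlt
  have := (G.mem_neighborFinset _ _).2 hw
  rw [← (M.erase_eq_neighborFinset (by omega)).2] at this
  exact hwO (Finset.mem_of_mem_erase this)

theorem one_le_triangleGain_of_two {t : G.Dart} (h : R.faceSize t = 3) (ha : t.fst ∈ O)
    (hb : t.snd ∈ O) (hc : (R.facePerm t).snd ∉ O) : 1 ≤ R.triangleGain O t := by
  have e1 := M.outerPay_eq ha (w := (R.facePerm t).snd) (by
    rw [← facePerm_two_snd h, ← R.facePerm_fst (R.facePerm t)]
    exact (R.facePerm (R.facePerm t)).adj.symm) hc fun ho => hc ho.2.2.2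
  have e2 := M.outerPay_eq (e := R.facePerm t) (by rwa [facePerm_fst]) (R.facePerm t).adj hc
    fun ho => hc ho.2.2.1
  have h1 := R.outerPay_le_gain (O := O) t
  have h2 := R.outerPay_le_gain (O := O) (R.facePerm t)
  have h3 := R.gain_nonneg (O := O) (R.facePerm (R.facePerm t))
  unfold triangleGain
  linarith

/-- The vertex in `O` gives $1/2$. The other half comes from a large neighbour or, if there is none,
the triangle is special and receives $1/3$ at each of its two other corners. -/
theorem one_le_triangleGain_of_one {t : G.Dart} (h : R.faceSize t = 3) (ha : t.fst ∉ O)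
    (hb : t.snd ∉ O) (hc : (R.facePerm t).snd ∈ O) : 1 ≤ R.triangleGain O t := by
  have s1 : R.faceSize (R.facePerm t) = 3 := by rwa [faceSize_facePerm]
  have s2 : R.faceSize (R.facePerm (R.facePerm t)) = 3 := by rwa [faceSize_facePerm]
  have f1 := R.facePerm_fst t
  have f2 := R.facePerm_fst (R.facePerm t)
  have f3 := facePerm_two_snd h
  have e3 := M.outerPay_eq (e := R.facePerm (R.facePerm t)) (by rwa [f2])
    (R.facePerm (R.facePerm t)).adj (by rwa [f3]) fun ho => by
      have := ho.2.2.1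
      rw [f3] at this
      exact ha this
  have g1 := R.pay_le_gain (O := O) t
  have g2 := R.pay_le_gain (O := O) (R.facePerm t)
  have g3 := R.outerPay_le_gain (O := O) (R.facePerm (R.facePerm t))
  have n1 := R.gain_nonneg (O := O) t
  have n2 := R.gain_nonneg (O := O) (R.facePerm t)
  unfold triangleGain
  by_cases b2 : 7 ≤ R.faceSize (R.facePerm t).symm
  · rw [pay_of_touching s1 b2 (Or.inr hc)] at g2
    linarith
  by_cases b3 : 7 ≤ R.faceSize (R.facePerm (R.facePerm t)).symm
  · have p3 := pay_of_touching s2 b3 (O := O) (Or.inl (by rwa [f2]))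
    have h1 := R.oppositePay_nonneg (O := O)
      (R.rot.symm (R.rot.symm (R.facePerm (R.facePerm t))))
    have : 1 ≤ R.gain O (R.facePerm (R.facePerm t)) := by
      unfold gain
      split_ifs <;> linarith
    linarith
  by_cases b1 : 7 ≤ R.faceSize t.symm
  · rw [pay, if_pos ⟨h, b1⟩, if_neg (not_or.2 ⟨ha, hb⟩), if_pos hc, if_neg (not_or.2 ⟨b2, b3⟩)] at g1
    linarith
  have hs := M.special_of_small h ha hb (M.le_four h b1 fun hx => ha hx.1)
    (M.le_four s1 b2 fun hx => by
      rw [f1] at hx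
      exact hb hx.1)
    (M.le_four s2 b3 fun hx => by
      rw [f3] at hx
      exact ha hx.2)
  have := M.third_le_gain_of_special hs ha
  have := M.third_le_gain_of_special hs.rotate (by rwa [f1])
  linarith

/-- One large neighbour pays 1, two pay $1/2$ each. Three pay $1/3$ each, or $0,\frac12,\frac12$ if
one of the edges is bad. -/
theorem sum_pay {t : G.Dart} (h : R.faceSize t = 3) (hN : R.Nontouching O t)
    (hb : 7 ≤ R.faceSize t.symm ∨ 7 ≤ R.faceSize (R.facePerm t).symm ∨
      7 ≤ R.faceSize (R.facePerm (R.facePerm t)).symm) :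
    R.pay O t + R.pay O (R.facePerm t) + R.pay O (R.facePerm (R.facePerm t)) = 1 := by
  have s1 : R.faceSize (R.facePerm t) = 3 := by rwa [faceSize_facePerm]
  have s2 : R.faceSize (R.facePerm (R.facePerm t)) = 3 := by rwa [faceSize_facePerm]
  have N1 := hN.rotate h
  have N2 := N1.rotate s1
  -- A triangle has at most one bad edge, as bad edges lie on full faces.
  have key : ∀ s, R.faceSize s = 3 → R.Bad O s.symm →
      ¬ R.Bad O (R.facePerm s).symm ∧ ¬ R.Bad O (R.facePerm (R.facePerm s)).symm := by
    intro s hs hbad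
    have hl := M.not_full_of_bad_left hbad
    have hr := M.not_full_of_bad_right hbad
    rw [SimpleGraph.Dart.symm_symm] at hl hr
    exact ⟨fun hx => hr hx.1, fun hx => hl hx.1⟩
  have k0 := key t h
  have k1 := key _ s1
  have k2 := key _ s2
  obtain ⟨a, b, c⟩ := hN
  obtain ⟨a1, -, c1⟩ := N1
  obtain ⟨a2, -, -⟩ := N2
  simp only [pay, facePerm_three h, h, s1, s2, true_and, a, b, c, a1, c1, a2, or_self,
    if_false] at k0 k1 k2 ⊢
  by_cases q1 : R.Bad O t.symm
  all_goals by_cases q2 : R.Bad O (R.facePerm t).symm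
  all_goals by_cases q3 : R.Bad O (R.facePerm (R.facePerm t)).symm
  all_goals simp only [q1, q2, q3, not_true_eq_false, not_false_eq_true, and_self, and_true,
    and_false, imp_false, imp_self, or_self, or_true, if_true, if_false, or_false] at k0 k1 k2 ⊢
  all_goals split_ifs
  all_goals first | (norm_num; done) | omega

theorem one_le_triangleGain_of_zero {t : G.Dart} (h : R.faceSize t = 3) (hN : R.Nontouching O t) :
    1 ≤ R.triangleGain O t := by
  have s1 : R.faceSize (R.facePerm t) = 3 := by rwa [faceSize_facePerm]
  have s2 : R.faceSize (R.facePerm (R.facePerm t)) = 3 := by rwa [faceSize_facePerm]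
  have N1 := hN.rotate h
  have N2 := N1.rotate s1
  unfold triangleGain
  by_cases hb : 7 ≤ R.faceSize t.symm ∨ 7 ≤ R.faceSize (R.facePerm t).symm ∨
      7 ≤ R.faceSize (R.facePerm (R.facePerm t)).symm
  · rw [← M.sum_pay h hN hb]
    exact add_le_add (add_le_add (pay_le_gain _) (pay_le_gain _)) (pay_le_gain _)
  · push Not at hb
    have hs := M.special_of_small h hN.1 hN.2.1 (M.le_four h (by omega) fun hx => hN.1 hx.1)
      (M.le_four s1 (by omega) fun hx => N1.1 hx.1) (M.le_four s2 (by omega) fun hx => N2.1 hx.1)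
    have := M.third_le_gain_of_special hs hN.1
    have := M.third_le_gain_of_special hs.rotate N1.1
    have := M.third_le_gain_of_special hs.rotate.rotate N2.1
    linarith

theorem one_le_triangleGain {t : G.Dart} (h : R.faceSize t = 3) : 1 ≤ R.triangleGain O t := by
  have s1 : R.faceSize (R.facePerm t) = 3 := by rwa [faceSize_facePerm]
  have f1 := R.facePerm_fst t
  have f2 := R.facePerm_fst (R.facePerm t)
  have f3 := facePerm_two_snd h
  have r1 := triangleGain_facePerm (O := O) h
  have r2 := triangleGain_facePerm (O := O) s1
  have s2 : R.faceSize (R.facePerm (R.facePerm t)) = 3 := by rwa [faceSize_facePerm]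
  by_cases a : t.fst ∈ O <;> by_cases b : t.snd ∈ O <;> by_cases c : (R.facePerm t).snd ∈ O
  · have ho : R.Outer O t := ⟨h, a, b, c⟩
    have := third_le_gain_of_outer ho
    have := third_le_gain_of_outer ho.rotate
    have := third_le_gain_of_outer ho.rotate.rotate
    unfold triangleGain
    linarith
  · exact M.one_le_triangleGain_of_two h a b c
  · rw [← r1, ← r2]
    exact M.one_le_triangleGain_of_two s2 (by rwa [f2]) (by rwa [f3])
      (by rwa [facePerm_three h])
  · rw [← r1]
    exact M.one_le_triangleGain_of_one s1 (by rwa [f1]) c (by rwa [f3])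
  · rw [← r1]
    exact M.one_le_triangleGain_of_two s1 (by rwa [f1]) c (by rwa [f3])
  · rw [← r1, ← r2]
    exact M.one_le_triangleGain_of_one s2 (by rwa [f2]) (by rwa [f3])
      (by rwa [facePerm_three h])
  · exact M.one_le_triangleGain_of_one h a b c
  · exact M.one_le_triangleGain_of_zero h ⟨a, b, c⟩

end Tame

end RotationSystem

/-! ### Vertices give away at most their charge -/

namespace RotationSystem

open Function

section

variable {V : Type*} {G : SimpleGraph V} [Fintype V] {R : RotationSystem G} {O : Finset V}

theorem of_innerPay_pos {e : G.Dart} (h : 0 < R.innerPay O e) :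
    (R.ReliefL O e ∨ R.ReliefR O e ∨ R.GiveSpecial O e) ∧ R.faceSize e = 3 ∨
      R.GiveBetween O e := by
  by_contra hne
  have h1 : ¬ R.ReliefL O e := fun h => hne (Or.inl ⟨Or.inl h, h.2.1⟩)
  have h2 : ¬ R.ReliefR O e := fun h => hne (Or.inl ⟨Or.inr (Or.inl h), h.2.1⟩)
  have h3 : ¬ R.GiveSpecial O e := fun h => hne (Or.inl ⟨Or.inr (Or.inr h), h.2.2.1⟩)
  have h4 : ¬ R.GiveBetween O e := fun h => hne (Or.inr h)
  rw [innerPay, if_neg h1, if_neg h2, if_neg h3, if_neg h4] at h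
  norm_num at h

theorem degree_of_innerPay_pos {e : G.Dart} (h : 0 < R.innerPay O e) :
    e.fst ∉ O ∧ 5 ≤ G.degree e.fst := by
  rcases of_innerPay_pos h with ⟨h | h | h, -⟩ | h
  · exact ⟨h.2.2.1.1, h.1⟩
  · exact ⟨h.2.2.1.1, h.1⟩
  · exact ⟨h.1, h.2.1⟩
  · exact ⟨h.1, h.2.1⟩

theorem GiveSpecial.faceSize {e : G.Dart} (h : R.GiveSpecial O e) :
    R.faceSize e = 3 ∧ R.faceSize (R.rot e) = 4 ∧ R.faceSize (R.rot.symm e) = 4 := by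
  obtain ⟨-, -, h1, h2, h3, h4⟩ := h
  rw [facePerm_two_symm h1] at h4
  exact ⟨h1, by rwa [faceSize_rot], h4⟩

/-- The four rules have incompatible face sizes at and next to the corner, so at most one applies.
-/
theorem innerPay_le_half (e : G.Dart) : R.innerPay O e ≤ 1 / 2 := by
  have h12 : R.ReliefL O e → ¬ R.ReliefR O e := fun h h' => by
    have := h.2.2.2.2.2
    have := h'.2.2.2.1
    omega
  have h13 : R.ReliefL O e → ¬ R.GiveSpecial O e := fun h h' => by
    have := h.2.2.2.1
    have := h'.faceSize.2.2
    omega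
  have h14 : R.ReliefL O e → ¬ R.GiveBetween O e := fun h h' => by
    have := h.2.1
    have := h'.2.2.1
    omega
  have h23 : R.ReliefR O e → ¬ R.GiveSpecial O e := fun h h' => by
    have := h.2.2.2.1
    have := h'.faceSize.2.1
    omega
  have h24 : R.ReliefR O e → ¬ R.GiveBetween O e := fun h h' => by
    have := h.2.1
    have := h'.2.2.1
    omega
  have h34 : R.GiveSpecial O e → ¬ R.GiveBetween O e := fun h h' => by
    have := h.2.2.1
    have := h'.2.2.1
    omega
  unfold innerPay
  split_ifs
  all_goals first | (norm_num; done) | (exfalso; tauto)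

/-- Two adjacent corners both pay only if they are two triangles, each relieving the large face on
its outer side; the other combinations contradict the face sizes or the exclusions in `GiveBetween`.
-/
theorem relief_of_innerPay_pos {e : G.Dart} (h : 0 < R.innerPay O e)
    (h' : 0 < R.innerPay O (R.rot e)) : R.ReliefL O e ∧ R.ReliefR O (R.rot e) := by
  rcases of_innerPay_pos h with ⟨a, s⟩ | a
  · rcases of_innerPay_pos h' with ⟨b, s'⟩ | b
    · have hL : R.ReliefL O e := by
        rcases a with a | a | a
        · exact a
        · have := a.2.2.2.1
          omega
        · have := a.faceSize.2.1
          omega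
      refine ⟨hL, ?_⟩
      rcases b with b | b | b
      · have := b.2.2.2.1
        rw [Equiv.symm_apply_apply] at this
        omega
      · exact b
      · have := b.faceSize.2.2
        rw [Equiv.symm_apply_apply] at this
        omega
    · have h7 := b.2.2.1
      rcases a with a | a | a
      · have := a.2.2.2.2.2
        omega
      · have := b.2.2.2.2.2.2
        rw [Equiv.symm_apply_apply] at this
        exact absurd a this
      · have := a.faceSize.2.1
        omega
  · rcases of_innerPay_pos h' with ⟨b, s'⟩ | b
    · have h7 := a.2.2.1
      rcases b with b | b | b
      · exact absurd b a.2.2.2.2.2.1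
      · have := b.2.2.2.2.2
        rw [Equiv.symm_apply_apply] at this
        omega
      · have := b.faceSize.2.2
        rw [Equiv.symm_apply_apply] at this
        omega
    · have := a.2.2.2.1
      have := b.2.2.1
      omega

theorem not_innerPay_pos_three {e : G.Dart} (h : 0 < R.innerPay O e)
    (h1 : 0 < R.innerPay O (R.rot e)) (h2 : 0 < R.innerPay O (R.rot (R.rot e))) : False := by
  have a := (relief_of_innerPay_pos h h1).2.2.2.2.1
  have b := (relief_of_innerPay_pos h1 h2).1.2.2.2.2.2
  omega

/-- At degree five, the corner facing two adjacent paying corners is a small face between two large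
ones, where no rule applies. -/
theorem not_innerPay_pos_opposite {e : G.Dart} (hd : R.rot^[5] e = e) (h : 0 < R.innerPay O e)
    (h1 : 0 < R.innerPay O (R.rot e)) (h3 : 0 < R.innerPay O (R.rot (R.rot (R.rot e)))) :
    False := by
  obtain ⟨hL, hR⟩ := relief_of_innerPay_pos h h1
  have a := hL.2.2.2.1
  have b := hR.2.2.2.1
  have c := hR.2.2.2.2.1
  have e4 : R.rot.symm e = R.rot (R.rot (R.rot (R.rot e))) := by
    rw [Equiv.symm_apply_eq]
    exact hd.symm
  rw [e4] at a
  rcases of_innerPay_pos h3 with ⟨p | p | p, -⟩ | p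
  · have := p.2.2.2.2.2
    omega
  · have := p.2.2.2.2.2
    rw [Equiv.symm_apply_apply] at this
    omega
  · have := p.faceSize.2.1
    omega
  · have := p.2.2.1
    omega

theorem innerPay_triple (e : G.Dart) :
    R.innerPay O e + R.innerPay O (R.rot e) + R.innerPay O (R.rot (R.rot e)) ≤ 1 := by
  have h0 := R.innerPay_le_half (O := O) e
  have h1 := R.innerPay_le_half (O := O) (R.rot e)
  have h2 := R.innerPay_le_half (O := O) (R.rot (R.rot e))
  by_cases p0 : 0 < R.innerPay O e
  · by_cases p1 : 0 < R.innerPay O (R.rot e)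
    · by_cases p2 : 0 < R.innerPay O (R.rot (R.rot e))
      · exact (not_innerPay_pos_three p0 p1 p2).elim
      · linarith
    · linarith
  · linarith

/-- Three positions on a 5-cycle are consecutive or of the form $i,i+1,i+3$. Both are excluded, so
at most two values are positive. -/
theorem sum_le_one_of_five {x0 x1 x2 x3 x4 : ℚ} (h0 : x0 ≤ 1 / 2) (h1 : x1 ≤ 1 / 2)
    (h2 : x2 ≤ 1 / 2) (h3 : x3 ≤ 1 / 2) (h4 : x4 ≤ 1 / 2)
    (c0 : 0 < x0 → 0 < x1 → 0 < x2 → False) (c1 : 0 < x1 → 0 < x2 → 0 < x3 → False)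
    (c2 : 0 < x2 → 0 < x3 → 0 < x4 → False) (c3 : 0 < x3 → 0 < x4 → 0 < x0 → False)
    (c4 : 0 < x4 → 0 < x0 → 0 < x1 → False) (d0 : 0 < x0 → 0 < x1 → 0 < x3 → False)
    (d1 : 0 < x1 → 0 < x2 → 0 < x4 → False) (d2 : 0 < x2 → 0 < x3 → 0 < x0 → False)
    (d3 : 0 < x3 → 0 < x4 → 0 < x1 → False) (d4 : 0 < x4 → 0 < x0 → 0 < x2 → False) :
    x0 + x1 + x2 + x3 + x4 ≤ 1 := by
  by_cases p0 : 0 < x0 <;> by_cases p1 : 0 < x1 <;> by_cases p2 : 0 < x2 <;>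
    by_cases p3 : 0 < x3 <;> by_cases p4 : 0 < x4
  all_goals first
    | exact (c0 p0 p1 p2).elim
    | exact (c1 p1 p2 p3).elim
    | exact (c2 p2 p3 p4).elim
    | exact (c3 p3 p4 p0).elim
    | exact (c4 p4 p0 p1).elim
    | exact (d0 p0 p1 p3).elim
    | exact (d1 p1 p2 p4).elim
    | exact (d2 p2 p3 p0).elim
    | exact (d3 p3 p4 p1).elim
    | exact (d4 p4 p0 p2).elim
    | linarith

end

namespace Tame

variable {V : Type*} {G : SimpleGraph V} [Fintype V] {R : RotationSystem G} {O : Finset V}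
  (M : R.Tame O)

include M

/-- Degree four gives nothing, degree five at most 1, and degree at least six at most $\frac13\deg
v\le\deg v-4$. -/
theorem sum_innerPay_le {v : V} (hv : v ∉ O) :
    ∑ d : G.Dart with d.fst = v, R.innerPay O d ≤ G.degree v - 4 := by
  have h4 := M.four_le v hv
  rcases h4.eq_or_lt with h4 | h5
  · rw [← h4]
    refine (Finset.sum_nonpos fun d hd => ?_).trans (by norm_num)
    rw [Finset.mem_filter] at hd
    by_contra hp
    have := (degree_of_innerPay_pos (not_le.1 hp)).2
    rw [hd.2] at this
    omega
  rcases (show 5 ≤ G.degree v from h5).eq_or_lt with h5 | h6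
  · obtain ⟨d, rfl⟩ := exists_dart_fst (show 0 < G.degree v by omega)
    rw [R.sum_darts_at, ← h5]
    have hper := R.iterate_degree d
    rw [← h5] at hper
    have hper1 : R.rot^[5] (R.rot d) = R.rot d := congrArg R.rot hper
    have hper2 : R.rot^[5] (R.rot (R.rot d)) = R.rot (R.rot d) := congrArg R.rot hper1
    have hper3 : R.rot^[5] (R.rot (R.rot (R.rot d))) = R.rot (R.rot (R.rot d)) :=
      congrArg R.rot hper2
    have hper4 : R.rot^[5] (R.rot (R.rot (R.rot (R.rot d)))) = R.rot (R.rot (R.rot (R.rot d))) :=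
      congrArg R.rot hper3
    simp only [Finset.sum_range_succ, Finset.sum_range_zero, iterate_succ_apply', iterate_zero, id,
      zero_add]
    change R.rot (R.rot (R.rot (R.rot (R.rot d)))) = d at hper
    have c3 := not_innerPay_pos_three (R := R) (O := O) (e := R.rot (R.rot (R.rot d)))
    have c4 := not_innerPay_pos_three (R := R) (O := O) (e := R.rot (R.rot (R.rot (R.rot d))))
    have d2 := not_innerPay_pos_opposite (O := O) hper2
    have d3 := not_innerPay_pos_opposite (O := O) hper3
    have d4 := not_innerPay_pos_opposite (O := O) hper4
    rw [hper] at c3 c4 d2 d3 d4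
    refine (sum_le_one_of_five (innerPay_le_half _) (innerPay_le_half _) (innerPay_le_half _)
      (innerPay_le_half _) (innerPay_le_half _) not_innerPay_pos_three not_innerPay_pos_three
      not_innerPay_pos_three c3 c4 (not_innerPay_pos_opposite hper)
      (not_innerPay_pos_opposite hper1) d2 d3 d4).trans (by norm_num)
  · have h3 := R.sum_darts_at_le_of_triple (R.innerPay_triple (O := O)) v
    have : (6 : ℚ) ≤ G.degree v := by exact_mod_cast h6
    linarith

theorem exists_tri {v : V} (hv : v ∈ O) : ∃ b ∈ O, ∃ c ∈ O, R.Tri v b c := by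
  rcases M.card_O with h | h
  · simp [h] at hv
  obtain ⟨x, y, z, hxy, hxz, hyz, rfl⟩ := Finset.card_eq_three.1 h
  have hx : x ∈ ({x, y, z} : Finset V) := by simp
  have hy : y ∈ ({x, y, z} : Finset V) := by simp
  have hz : z ∈ ({x, y, z} : Finset V) := by simp
  have ht := M.facial x y z (M.clique x hx y hy hxy) (M.clique y hy z hz hyz)
    (M.clique z hz x hx hxz.symm)
  simp only [Finset.mem_insert, Finset.mem_singleton] at hv
  rcases ht with t | t <;> rcases hv with rfl | rfl | rfl
  · exact ⟨y, hy, z, hz, t⟩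
  · exact ⟨z, hz, x, hx, t.rotate⟩
  · exact ⟨x, hx, y, hy, t.rotate.rotate⟩
  · exact ⟨z, hz, y, hy, t.rotate.rotate⟩
  · exact ⟨x, hx, z, hz, t.rotate⟩
  · exact ⟨y, hy, x, hx, t⟩

/-- The corner of the outer triangle gets nothing, so the sum is at most $\frac12(\deg v-1)\le\deg
v-2$ once the degree is at least three; degree two gives nothing. -/
theorem sum_outerPay_le {v : V} (hv : v ∈ O) :
    ∑ d : G.Dart with d.fst = v, R.outerPay O d ≤ G.degree v - 2 := by
  have h2 := M.two_le v
  rcases h2.eq_or_lt with h2 | h3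
  · rw [← h2]
    refine (Finset.sum_nonpos fun d hd => ?_).trans (by norm_num)
    rw [Finset.mem_filter] at hd
    refine (if_neg fun hp => ?_).le
    have := hp.2.1
    rw [hd.2] at this
    omega
  · obtain ⟨b, hb, c, hc, ht⟩ := M.exists_tri hv
    have ho : R.Outer O ⟨(v, b), ht.1.adj_left⟩ :=
      ⟨R.faceSize_of_tri (c := c) ht, hv, hb, by rwa [(R.turn_iff _ c).1 ht.1]⟩
    have hmem : (⟨(v, b), ht.1.adj_left⟩ : G.Dart) ∈ ({d : G.Dart | d.fst = v} : Finset G.Dart) := by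
      simp
    have h0 : R.outerPay O ⟨(v, b), ht.1.adj_left⟩ = 0 := if_neg fun h => h.2.2 ho
    rw [← Finset.add_sum_erase _ _ hmem, h0]
    have hle : ∀ d ∈ ({d : G.Dart | d.fst = v} : Finset G.Dart).erase ⟨(v, b), ht.1.adj_left⟩,
        R.outerPay O d ≤ 1 / 2 := fun d _ => by
      unfold outerPay
      split_ifs <;> norm_num
    have := Finset.sum_le_card_nsmul _ _ _ hle
    rw [Finset.card_erase_of_mem hmem, card_darts_at, nsmul_eq_mul,
      Nat.cast_sub (by omega)] at this
    have h3' : (3 : ℚ) ≤ G.degree v := by exact_mod_cast h3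
    push_cast at this
    linarith

theorem sum_vertex_le (v : V) :
    ∑ d : G.Dart with d.fst = v, (R.innerPay O d + R.outerPay O d) ≤
      G.degree v - 4 + (if v ∈ O then 2 else 0) := by
  rw [Finset.sum_add_distrib]
  by_cases hv : v ∈ O
  · have h1 : ∑ d : G.Dart with d.fst = v, R.innerPay O d ≤ 0 :=
      Finset.sum_nonpos fun d hd => by
        rw [Finset.mem_filter] at hd
        by_contra hp
        have := (degree_of_innerPay_pos (not_le.1 hp)).1
        rw [hd.2] at this
        exact this hv
    have := M.sum_outerPay_le hv
    rw [if_pos hv]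
    linarith
  · have h1 : ∑ d : G.Dart with d.fst = v, R.outerPay O d ≤ 0 :=
      Finset.sum_nonpos fun d hd => by
        rw [Finset.mem_filter] at hd
        refine (if_neg fun hp => ?_).le
        have := hp.1
        rw [hd.2] at this
        exact hv this
    have := M.sum_innerPay_le hv
    rw [if_neg hv]
    linarith

/-- If `O` were facial in both orientations, all three of its vertices would have degree two, which
`three_le` excludes. So only one triangular face has all its vertices in `O`. -/
theorem eq_of_outer {x y z : V} (hx : x ∈ O) (hy : y ∈ O) (hz : z ∈ O) (ht : R.Tri x y z)
    {d : G.Dart} (hd : R.Outer O d) :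
    d.toProd = (x, y) ∨ d.toProd = (y, z) ∨ d.toProd = (z, x) := by
  obtain ⟨h3, h1, h2, h4⟩ := hd
  have t := R.tri_of_faceSize h3
  have xy := ht.1.adj_left.ne
  have yz := ht.1.adj_right.ne
  have xz := M.ne ht.1
  have q := fun {w} hw => M.eq_of_mem (x := w) hx hy hz hw xy xz yz
  have big : ¬ (R.Tri y x z) := by
    intro u
    have a1 := R.degree_le_of_turn_two ht.1 u.2.2
    have a2 := R.degree_le_of_turn_two ht.2.1 u.2.1
    have a3 := R.degree_le_of_turn_two ht.2.2 u.1
    obtain ⟨v, hv, hv3⟩ := M.three_le ⟨x, hx⟩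
    rcases q hv with rfl | rfl | rfl <;> omega
  have n1 := t.1.adj_left.ne
  have n2 := t.1.adj_right.ne
  have n3 := M.ne t.1
  obtain ⟨⟨a, b⟩, hab⟩ := d
  simp only at *
  generalize (R.facePerm ⟨(a, b), hab⟩).snd = c at *
  rcases q h1 with rfl | rfl | rfl <;> rcases q h2 with rfl | rfl | rfl <;>
    rcases q h4 with rfl | rfl | rfl
  all_goals first
    | exact absurd rfl n1
    | exact absurd rfl n2
    | exact absurd rfl n3
    | exact absurd t big
    | exact absurd t.rotate big
    | exact absurd t.rotate.rotate big
    | simp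

theorem sum_outer_le : ∑ d : G.Dart, (if R.Outer O d then (1 : ℚ) else 0) ≤ 3 := by
  rw [Finset.sum_boole]
  rcases O.eq_empty_or_nonempty with h0 | ⟨v, hv⟩
  · rw [Finset.filter_false_of_mem fun d _ hd => by
      have := hd.2.1
      rw [h0] at this
      simp at this]
    norm_num
  obtain ⟨b, hb, c, hc, ht⟩ := M.exists_tri hv
  have : Finset.card {d : G.Dart | R.Outer O d} ≤ ({(v, b), (b, c), (c, v)} : Finset (V × V)).card :=
    Finset.card_le_card_of_injOn (fun d => d.toProd) (fun d hd => by
      have := M.eq_of_outer hv hb hc ht (by simpa using hd : R.Outer O d)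
      simpa using this) fun d _ e _ h => SimpleGraph.Dart.ext _ _ h
  exact_mod_cast this.trans Finset.card_le_three

end Tame

end RotationSystem

/-! ### Final charges -/

namespace RotationSystem

open Function

section

variable {V : Type*} {G : SimpleGraph V} [Fintype V] {R : RotationSystem G} {O : Finset V}

theorem load_le (d : G.Dart) : R.load O d ≤ R.pay O d.symm + R.oppositePay O d := by
  unfold load
  split_ifs <;> linarith

theorem load_nonpos {d : G.Dart} (h : R.faceSize d < 5) : R.load O d ≤ 0 := by
  refine (load_le_pay fun hp => ?_).trans (pay_of_lt (by rw [SimpleGraph.Dart.symm_symm]; omega)).le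
  unfold oppositePay at hp
  rw [if_neg (by omega)] at hp
  exact lt_irrefl _ hp

/-- The final charge of the face of `d`, distributed over the darts of the face. -/
noncomputable def finalCharge (R : RotationSystem G) (O : Finset V) (d : G.Dart) : ℚ :=
  (1 - 4 * (1 / R.faceSize d)) - R.load O d + R.gain O d +
    1 / 2 * (if R.GiveBetween O d then 1 else 0)

/-- Transfers between faces cancel after reindexing along `symm` and `rot`. What remains are the
gifts of the vertices and the $1/3$ created at each corner of the outer triangle. -/
theorem sum_finalCharge :
    ∑ d, R.finalCharge O d = ∑ d : G.Dart, (1 - 4 * (1 / (R.faceSize d : ℚ))) +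
      ∑ d, (R.innerPay O d + R.outerPay O d) +
        1 / 3 * ∑ d : G.Dart, (if R.Outer O d then (1 : ℚ) else 0) := by
  have e1 : ∑ d : G.Dart, R.pay O d.symm = ∑ d, R.pay O d :=
    Equiv.sum_comp (SimpleGraph.Dart.symm_involutive.toPerm : Equiv.Perm G.Dart) (R.pay O)
  have e2 : ∑ d : G.Dart, R.oppositePay O (R.rot.symm (R.rot.symm d)) =
      ∑ d, R.oppositePay O d := by
    rw [Equiv.sum_comp R.rot.symm fun d => R.oppositePay O (R.rot.symm d), Equiv.sum_comp]
  have e3 : ∑ d : G.Dart, (if R.ReliefL O (R.rot d) then (1 : ℚ) else 0) =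
      ∑ d : G.Dart, (if R.ReliefL O d then (1 : ℚ) else 0) :=
    Equiv.sum_comp R.rot fun d => if R.ReliefL O d then (1 : ℚ) else 0
  have e4 : ∑ d : G.Dart, (if R.ReliefR O d.symm then (1 : ℚ) else 0) =
      ∑ d : G.Dart, (if R.ReliefR O d then (1 : ℚ) else 0) :=
    Equiv.sum_comp (SimpleGraph.Dart.symm_involutive.toPerm : Equiv.Perm G.Dart)
      fun d => if R.ReliefR O d then (1 : ℚ) else 0
  simp only [finalCharge, load, gain, innerPay, Finset.sum_add_distrib, Finset.sum_sub_distrib,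
    ← Finset.mul_sum, e1, e2, e3, e4]
  ring

theorem neg_load_le_finalCharge (d : G.Dart) :
    (1 - 4 * (1 / R.faceSize d)) - R.load O d ≤ R.finalCharge O d := by
  have := R.gain_nonneg (O := O) d
  unfold finalCharge
  split_ifs <;> linarith

theorem sum_neg_load_le {d : G.Dart} {n : ℕ} (h : R.faceSize d = n) (hn : n ≠ 0) :
    (n : ℚ) - 4 - ∑ i ∈ Finset.range n, R.load O (R.facePerm^[i] d) ≤
      ∑ i ∈ Finset.range n, R.finalCharge O (R.facePerm^[i] d) := by
  refine le_trans ?_ (Finset.sum_le_sum fun i _ => neg_load_le_finalCharge _)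
  simp only [faceSize_iterate, h, Finset.sum_sub_distrib, Finset.sum_const, Finset.card_range,
    nsmul_eq_mul]
  have : (n : ℚ) ≠ 0 := by exact_mod_cast hn
  field_simp
  exact le_refl _

end

namespace Tame

variable {V : Type*} {G : SimpleGraph V} [Fintype V] {R : RotationSystem G} {O : Finset V}
  (M : R.Tame O)

include M

theorem sum_finalCharge_face_nonneg (d : G.Dart) :
    0 ≤ ∑ i ∈ Finset.range (R.faceSize d), R.finalCharge O (R.facePerm^[i] d) := by
  have h3 := M.three_le_faceSize d
  have h6 := M.faceSize_ne_six d
  obtain h | h | h | h | h : R.faceSize d = 3 ∨ R.faceSize d = 4 ∨ R.faceSize d = 5 ∨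
    R.faceSize d = 7 ∨ 8 ≤ R.faceSize d := by omega
  · have key : ∀ e, R.faceSize e = 3 → R.gain O e - 1 / 3 ≤ R.finalCharge O e := by
      intro e he
      have := load_nonpos (O := O) (show R.faceSize e < 5 by omega)
      unfold finalCharge
      rw [he]
      push_cast
      split_ifs <;> linarith
    have k0 := key d h
    have k1 := key (R.facePerm d) (by rwa [faceSize_facePerm])
    have k2 := key (R.facePerm (R.facePerm d)) (by rwa [faceSize_facePerm, faceSize_facePerm])
    have := M.one_le_triangleGain h
    unfold triangleGain at this
    rw [h]
    simp only [Finset.sum_range_succ, Finset.sum_range_zero, iterate_succ_apply', iterate_zero, id]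
    linarith
  · have := sum_neg_load_le (O := O) h (by norm_num)
    have h0 : ∑ i ∈ Finset.range 4, R.load O (R.facePerm^[i] d) ≤ 0 :=
      Finset.sum_nonpos fun i _ => load_nonpos (by rw [faceSize_iterate]; omega)
    rw [h]
    push_cast at this
    linarith
  -- A 5-face has charge 1 and pays only special triangles, at most
  -- $\frac12\cdot5\cdot\frac13=\frac56$.
  · have h1 := sum_neg_load_le (O := O) h (by norm_num)
    have h2 := two_mul_sum_face_le (f := R.oppositePay O) M.oppositePay_add_le d
    have h0 : ∑ i ∈ Finset.range 5, R.load O (R.facePerm^[i] d) ≤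
        ∑ i ∈ Finset.range 5, R.oppositePay O (R.facePerm^[i] d) :=
      Finset.sum_le_sum fun i _ => (load_le _).trans (by
        rw [pay_of_lt (by rw [SimpleGraph.Dart.symm_symm, faceSize_iterate]; omega), zero_add])
    rw [h] at h2 ⊢
    push_cast at h1 h2
    linarith
  · have h1 := M.sum_load_seven h
    rw [h]
    have h2 : ∑ i ∈ Finset.range 7, ((1 - 4 * (1 / 7)) - R.load O (R.facePerm^[i] d) +
        (1 / 2 * (if R.GiveBetween O (R.facePerm^[i] d) then 1 else 0) +
          R.outerPay O (R.facePerm^[i] d))) ≤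
        ∑ i ∈ Finset.range 7, R.finalCharge O (R.facePerm^[i] d) :=
      Finset.sum_le_sum fun i _ => by
        have := R.outerPay_le_gain (O := O) (R.facePerm^[i] d)
        unfold finalCharge
        rw [faceSize_iterate, h]
        push_cast
        linarith
    rw [Finset.sum_add_distrib, Finset.sum_sub_distrib, Finset.sum_const, Finset.card_range] at h2
    norm_num at h2 h1
    linarith
  -- From size 8 on, $\frac12|f|\le|f|-4$.
  · have h1 := sum_neg_load_le (R := R) (O := O) (d := d) rfl (by omega)
    have h2 := two_mul_sum_face_le (f := R.load O) M.load_add_load_le d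
    have h8 : (8 : ℚ) ≤ R.faceSize d := by exact_mod_cast h
    linarith

/-- Tame plane graphs with a vertex do not exist. -/
theorem not_exact [Nonempty G.Dart] : ¬ R.Exact := by
  intro hE
  have h1 := hE.sum_charge_le (p := 1) (q := 4) (r := 1) (by norm_num) (by norm_num)
  have h2 : 0 ≤ ∑ d, R.finalCharge O d :=
    sum_nonneg_of_orbits R.facePerm _ M.sum_finalCharge_face_nonneg
  rw [sum_finalCharge, sum_darts_eq_sum_sum fun d => R.innerPay O d + R.outerPay O d] at h2
  have h3 := M.sum_outer_le
  have h4 := Finset.sum_le_sum fun v (_ : v ∈ (Finset.univ : Finset V)) => M.sum_vertex_le v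
  have h5 : ∑ v : V, (if v ∈ O then (2 : ℚ) else 0) ≤ 6 := by
    rw [Finset.sum_ite_mem, Finset.univ_inter, Finset.sum_const, nsmul_eq_mul]
    rcases M.card_O with h | h
    · rw [h]
      norm_num
    · rw [h]
      norm_num
  rw [Finset.sum_add_distrib (f := fun v : V => (G.degree v : ℚ) - 4)] at h4
  simp only [one_mul] at h1
  -- The initial total is at most $-8$, and at most $6+1$ was added.
  linarith

end Tame

end RotationSystem

namespace RotationSystem

open Function

/-! ### Separating triangles -/

section Separating

variable {V : Type*} {G : SimpleGraph V}

theorem degree_le_degree_induce [Fintype V] {s : Set V} {v : V} (hv : v ∈ s)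
    (h : ∀ w, G.Adj v w → w ∈ s) : G.degree v ≤ (G.induce s).degree ⟨v, hv⟩ := by
  rw [← SimpleGraph.card_neighborFinset_eq_degree, ← SimpleGraph.card_neighborFinset_eq_degree,
    ← Finset.card_map (Embedding.subtype (· ∈ s))]
  refine Finset.card_le_card fun w hw => ?_
  rw [SimpleGraph.mem_neighborFinset] at hw
  simp [h w hw, hw]

theorem two_le_degree_of_mem [Fintype V] {O : Finset V} (h3 : O.card = 3)
    (hO : ∀ a ∈ O, ∀ b ∈ O, a ≠ b → G.Adj a b) {v : V} (hv : v ∈ O) : 2 ≤ G.degree v := by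
  rw [← SimpleGraph.card_neighborFinset_eq_degree]
  have : (O.erase v).card = 2 := by rw [Finset.card_erase_of_mem hv, h3]
  rw [← this]
  refine Finset.card_le_card fun w hw => ?_
  rw [SimpleGraph.mem_neighborFinset]
  exact hO v hv w (Finset.mem_of_mem_erase hw) (Finset.ne_of_mem_erase hw).symm

theorem adj_of_mem_triangle {x y z : V} (hxy : G.Adj x y) (hyz : G.Adj y z) (hzx : G.Adj z x) :
    ∀ v ∈ ({x, y, z} : Finset V), ∀ w ∈ ({x, y, z} : Finset V), v ≠ w → G.Adj v w := by
  intro v hv w hw hne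
  simp only [Finset.mem_insert, Finset.mem_singleton] at hv hw
  rcases hv with rfl | rfl | rfl <;> rcases hw with rfl | rfl | rfl
  all_goals first
    | exact absurd rfl hne
    | assumption
    | (apply SimpleGraph.Adj.symm; assumption)

variable {R : RotationSystem G}

theorem zmod_two_eq : ∀ {p q ε : ZMod 2}, p ≠ ε → p + q = 1 → q = ε := by
  decide

/-- If a two-colouring of the faces changes exactly along the edges of a triangle and one colour
occurs only at this triangle, then the triangle is facial. -/
theorem tri_of_unicolored [Fintype V] (h2 : ∀ v, 2 ≤ G.degree v) {K : Finset V}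
    {c : G.Dart → ZMod 2} (hc : ∀ d, c (R.facePerm d) = c d) {ε : ZMod 2}
    (hε : ∀ d : G.Dart, c d = ε → d.fst ∈ K ∧ d.snd ∈ K) {x y z : V} (hK : K = {x, y, z})
    (hxy : G.Adj x y) (h : c ⟨(x, y), hxy⟩ = ε) (hxz : x ≠ z) (hyz : y ≠ z) : R.Tri x y z := by
  -- The face of a dart of colour `ε` keeps that colour, so it never leaves the triangle and must
  -- turn to the third vertex.
  have step : ∀ {x y z : V}, K = {x, y, z} → ∀ hxy : G.Adj x y, c ⟨(x, y), hxy⟩ = ε →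
      x ≠ z → y ≠ z → R.Turn x y z ∧ ∃ hyz : G.Adj y z, c ⟨(y, z), hyz⟩ = ε := by
    intro x y z hK hxy h hxz hyz
    have h1 := hc ⟨(x, y), hxy⟩
    rw [h] at h1
    have t := R.turn_facePerm ⟨(x, y), hxy⟩
    have hm := (hε _ h1).2
    have hne := t.ne h2
    have hadj := t.adj_right
    have hz : (R.facePerm ⟨(x, y), hxy⟩).snd = z := by
      rw [hK] at hm
      simp only [Finset.mem_insert, Finset.mem_singleton] at hm
      rcases hm with hm | hm | hm
      · exact absurd hm.symm hne
      · exact absurd hm.symm hadj.ne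
      · exact hm
    rw [hz] at t
    refine ⟨t, t.adj_right, ?_⟩
    rw [← h1]
    congr 1
    exact SimpleGraph.Dart.ext _ _ (Prod.ext (R.facePerm_fst ⟨(x, y), hxy⟩).symm hz.symm)
  obtain ⟨t1, a1, c1⟩ := step hK hxy h hxz hyz
  obtain ⟨t2, a2, c2⟩ := step (by rw [hK]; ext; simp; tauto) a1 c1 hxy.ne' hxz.symm
  obtain ⟨t3, -, -⟩ := step (by rw [hK]; ext; simp; tauto) a2 c2 hyz.symm hxy.ne
  exact ⟨t1, t2, t3⟩

/-- The two sides of a triangle that is not facial. -/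
theorem Exact.exists_sides [Fintype V] (hR : R.Exact) (h2 : ∀ v, 2 ≤ G.degree v) {x y z : V}
    (hxy : G.Adj x y) (hyz : G.Adj y z) (hzx : G.Adj z x) (h : ¬ R.Tri x y z) (h' : ¬ R.Tri z y x) :
    ∃ side : V → ZMod 2, (∀ v w, G.Adj v w → v ∉ ({x, y, z} : Finset V) →
      w ∉ ({x, y, z} : Finset V) → side v = side w) ∧
      ∀ ε, ∃ v, v ∉ ({x, y, z} : Finset V) ∧ side v = ε := by
  obtain ⟨K, hK⟩ : ∃ K : Finset V, K = {x, y, z} := ⟨_, rfl⟩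
  rw [← hK]
  have hadjK : ∀ v ∈ K, ∀ w ∈ K, v ≠ w → G.Adj v w := hK ▸ adj_of_mem_triangle hxy hyz hzx
  -- The edges inside `K` form a cycle modulo 2, two at each vertex of `K`, so exactness gives a
  -- two-colouring of the faces that changes exactly across them.
  obtain ⟨c, hc, hcz⟩ := hR (fun d => if d.fst ∈ K ∧ d.snd ∈ K then 1 else 0) (fun d => by
    simp [and_comm]) (fun v => by
    by_cases hv : v ∈ K
    · have hcard : (({d : G.Dart | d.fst = v} : Finset G.Dart).filter
          fun d => d.fst ∈ K ∧ d.snd ∈ K).card = (K.erase v).card := by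
        refine Finset.card_nbij (fun d => d.snd) ?_ ?_ ?_
        · intro d hd
          simp only [Finset.coe_filter, Finset.mem_filter, Finset.mem_univ, true_and,
            Set.mem_ofPred_eq] at hd
          simp only [Finset.coe_erase, Set.mem_sdiff, Finset.mem_coe, Set.mem_singleton_iff]
          exact ⟨hd.2.2, fun h => d.adj.ne (hd.1.trans h.symm)⟩
        · intro d hd e he hde
          simp only [Finset.coe_filter, Finset.mem_filter, Finset.mem_univ, true_and,
            Set.mem_ofPred_eq] at hd he
          exact SimpleGraph.Dart.ext _ _ (Prod.ext (hd.1.trans he.1.symm) hde)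
        · intro w hw
          simp only [Finset.coe_erase, Set.mem_sdiff, Finset.mem_coe, Set.mem_singleton_iff] at hw
          exact ⟨⟨(v, w), hadjK v hv w hw.1 (Ne.symm hw.2)⟩, by simpa using ⟨hv, hw.1⟩, rfl⟩
      rw [Finset.sum_boole, hcard, Finset.card_erase_of_mem hv, hK,
        Finset.card_eq_three.2 ⟨x, y, z, hxy.ne, hzx.ne', hyz.ne, rfl⟩]
      rfl
    · refine Finset.sum_eq_zero fun d hd => if_neg fun h => hv ?_
      rw [Finset.mem_filter] at hd
      exact hd.2 ▸ h.1)
  have hrot : ∀ d, c (R.rot d) = c d + if d.fst ∈ K ∧ d.snd ∈ K then 1 else 0 := by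
    intro d
    rw [← R.facePerm_symm, hc, ← hcz, ← add_assoc, CharTwo.add_self_eq_zero, zero_add]
  -- Away from `K` the colour is constant around a vertex, so it colours the vertex.
  have hsame : ∀ d e : G.Dart, d.fst = e.fst → d.fst ∉ K → c d = c e := by
    intro d e hde hd
    obtain ⟨n, -, rfl⟩ := (R.sameCycle_of_fst_eq d e hde).exists_pow_eq'
    rw [← Equiv.Perm.iterate_eq_pow]
    clear hde
    induction n with
    | zero => rfl
    | succ n ih =>
      rw [iterate_succ_apply', hrot, if_neg, add_zero, ih]
      rw [rot_iterate_fst]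
      exact fun h => hd h.1
  have hsymm : ∀ d : G.Dart, ¬ (d.fst ∈ K ∧ d.snd ∈ K) → c d.symm = c d := by
    intro d hd
    have := hcz d
    rw [if_neg hd] at this
    exact (CharTwo.add_eq_zero.1 this).symm
  have hdart : ∀ v, ∃ d : G.Dart, d.fst = v := fun v => exists_dart_fst (by have := h2 v; omega)
  choose f hf using hdart
  refine ⟨fun v => c (f v), fun v w hvw hv hw => ?_, fun ε => ?_⟩
  · change c (f v) = c (f w)
    rw [hsame (f v) ⟨(v, w), hvw⟩ (hf v) (by rwa [hf]),
      hsame (f w) ⟨(w, v), hvw.symm⟩ (hf w) (by rwa [hf])]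
    exact (hsymm ⟨(v, w), hvw⟩ fun h => hv h.1).symm
  · by_contra hne
    push Not at hne
    have hε : ∀ d : G.Dart, c d = ε → d.fst ∈ K ∧ d.snd ∈ K := by
      intro d hd
      by_contra hdK
      by_cases h1 : d.fst ∈ K
      · have h3 : d.snd ∉ K := fun h3 => hdK ⟨h1, h3⟩
        refine hne _ h3 ?_
        have := hsame (f d.snd) d.symm (hf _) (by rwa [hf])
        rw [this, hsymm d hdK, hd]
      · refine hne _ h1 ?_
        have := hsame (f d.fst) d (hf _) (by rwa [hf])
        rw [this, hd]
    -- The two sides of `xy` have different colours, so one of its darts has colour `ε`; this makes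
    -- the triangle facial in one orientation.
    by_cases h1 : c ⟨(x, y), hxy⟩ = ε
    · exact h (tri_of_unicolored h2 hc hε hK hxy h1 hzx.ne' hyz.ne)
    · refine h' (Tri.rotate (Tri.rotate (tri_of_unicolored h2 hc hε (x := y) (y := x) (z := z)
        (by rw [hK]; ext; simp; tauto) hxy.symm ?_ hyz.ne hzx.ne')))
      have h3 := hcz ⟨(x, y), hxy⟩
      rw [if_pos (by simp [hK])] at h3
      change _ + c ⟨(y, x), hxy.symm⟩ = 1 at h3
      exact zmod_two_eq h1 h3

end Separating

/-! ### Planar graphs without cycles of length six -/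

universe u

/-- There is no plane graph without cycles of length six in which all vertices outside `O` have
degree at least four, where `O` is empty or a triangle and there is a vertex outside `O`. -/
theorem Exact.false_of_noSix (n : ℕ) : ∀ {V : Type u} [Fintype V] {G : SimpleGraph V}
    {R : RotationSystem G} (O : Finset V), Fintype.card V = n → R.Exact →
    ¬ HasCycleOfLength G 6 → (∀ a ∈ O, ∀ b ∈ O, a ≠ b → G.Adj a b) → (O = ∅ ∨ O.card = 3) →
    (∃ v, v ∉ O) → (∀ v, v ∉ O → 4 ≤ G.degree v) → False := by
  induction n using Nat.strong_induction_on with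
  | _ n ih =>
    intro V _ G R O hn hR h6 hcl h3 ⟨v₀, hv₀⟩ h4
    have h2 : ∀ v, 2 ≤ G.degree v := fun v => by
      by_cases hv : v ∈ O
      · rcases h3 with h | h
        · simp [h] at hv
        · exact two_le_degree_of_mem h hcl hv
      · exact le_trans (by norm_num) (h4 v hv)
    -- The induction step: in a proper induced subgraph, the vertices outside the new `O'` must lie
    -- outside `O` and keep all their neighbours.
    have restrict : ∀ (s : Set V) (O' : Finset s), (∃ v, v ∉ s) →
        (∀ a ∈ O', ∀ b ∈ O', a ≠ b → G.Adj a b) → (O' = ∅ ∨ O'.card = 3) → (∃ v, v ∉ O') →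
        (∀ v, v ∉ O' → (v : V) ∉ O ∧ ∀ w, G.Adj v w → w ∈ s) → False := by
      intro s O' ⟨v, hv⟩ hcl' h3' hne' hdeg
      refine ih (Fintype.card s) ?_ (G := G.induce s) (R := R.induce s) O' rfl (hR.induce s)
        (fun h => h6 h.of_induce) (fun a ha b hb hab => hcl' a ha b hb hab) h3' hne' fun v hv => ?_
      · rw [← hn]
        exact Fintype.card_subtype_lt hv
      · exact (h4 _ (hdeg v hv).1).trans (degree_le_degree_induce v.2 (hdeg v hv).2)
    by_cases hfac : ∀ a b c, G.Adj a b → G.Adj b c → G.Adj c a → R.Tri a b c ∨ R.Tri c b a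
    -- If all vertices of `O` have degree at most two, `O` is a component of its own and can be
    -- deleted.
    · by_cases hO : O.Nonempty ∧ ∀ v ∈ O, G.degree v ≤ 2
      · obtain ⟨⟨x, hx⟩, hO⟩ := hO
        refine restrict {v | v ∉ O} ∅ ⟨x, by simpa using hx⟩ (by simp) (Or.inl rfl)
          ⟨⟨v₀, hv₀⟩, by simp⟩ fun v _ => ⟨v.2, fun w hw hwO => ?_⟩
        have hc : O.card = 3 := h3.resolve_left (Finset.ne_empty_of_mem hx)
        have he : O.erase w = G.neighborFinset w := by
          refine Finset.eq_of_subset_of_card_le (fun y hy => ?_) ?_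
          · rw [SimpleGraph.mem_neighborFinset]
            exact hcl w hwO y (Finset.mem_of_mem_erase hy) (Finset.ne_of_mem_erase hy).symm
          · rw [G.card_neighborFinset_eq_degree, Finset.card_erase_of_mem hwO, hc]
            exact hO w hwO
        have := (G.mem_neighborFinset _ _).2 hw.symm
        rw [← he] at this
        exact v.2 (Finset.mem_of_mem_erase this)
      · have M : R.Tame O := by
          refine ⟨h6, hfac, h2, h4, hcl, h3, fun hne => ?_⟩
          by_contra hlt
          push Not at hlt
          exact hO ⟨hne, fun v hv => Nat.le_of_lt_succ (hlt v hv)⟩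
        obtain ⟨d, -⟩ := exists_dart_fst (show 0 < G.degree v₀ by have := h2 v₀; omega)
        have : Nonempty G.Dart := ⟨d⟩
        exact M.not_exact hR
    · push Not at hfac
      obtain ⟨a, b, c, hab, hbc, hca, ht, ht'⟩ := hfac
      obtain ⟨side, hside, hsur⟩ := hR.exists_sides h2 hab hbc hca ht ht'
      obtain ⟨K, hK⟩ : ∃ K : Finset V, K = {a, b, c} := ⟨_, rfl⟩
      rw [← hK] at hside hsur
      -- `O` is a clique, so its vertices outside `K` lie on one side of `K`. The other side, with
      -- `K` as its new outer triangle, inherits the degree condition.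
      obtain ⟨ε, hε⟩ : ∃ ε, ∀ v ∈ O, v ∉ K → side v ≠ ε := by
        by_cases hx : ∃ x ∈ O, x ∉ K
        · obtain ⟨x, hx, hxK⟩ := hx
          refine ⟨side x + 1, fun v hv hvK h => ?_⟩
          have : side v = side x := by
            by_cases hvx : v = x
            · rw [hvx]
            · exact hside v x (hcl v hv x hx hvx) hvK hxK
          rw [this] at h
          simp at h
        · push Not at hx
          exact ⟨0, fun v hv hvK => absurd (hx v hv) hvK⟩
      obtain ⟨w₁, hw₁, hs₁⟩ := hsur ε
      obtain ⟨w₂, hw₂, hs₂⟩ := hsur (ε + 1)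
      have hadjK : ∀ v ∈ K, ∀ w ∈ K, v ≠ w → G.Adj v w := hK ▸ adj_of_mem_triangle hab hbc hca
      refine restrict {v | v ∈ K ∨ side v = ε} (K.subtype _) ⟨w₂, ?_⟩ ?_ (Or.inr ?_)
        ⟨⟨w₁, Or.inr hs₁⟩, by simpa using hw₁⟩ ?_
      · rintro (h | h)
        · exact hw₂ h
        · rw [h] at hs₂
          simp at hs₂
      · intro v hv w hw hne
        rw [Finset.mem_subtype] at hv hw
        exact hadjK v hv w hw fun h => hne (Subtype.ext h)
      · rw [Finset.card_subtype, Finset.filter_true_of_mem (p := (· ∈ {v : V | v ∈ K ∨ side v = ε}))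
          fun v hv => Or.inl hv, hK]
        exact Finset.card_eq_three.2 ⟨a, b, c, hab.ne, hca.ne', hbc.ne, rfl⟩
      · rintro ⟨v, hv⟩ hvK
        rw [Finset.mem_subtype] at hvK
        have hvε := hv.resolve_left hvK
        refine ⟨fun hvO => hε v hvO hvK hvε, fun w hw => ?_⟩
        by_cases hwK : w ∈ K
        · exact Or.inl hwK
        · exact Or.inr ((hside v w hw hvK hwK).symm.trans hvε)

/-- A nonempty plane graph of minimum degree at least four has a cycle of length six. -/
theorem Exact.hasCycleOfLength_six {V : Type*} {G : SimpleGraph V} {R : RotationSystem G}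
    [Fintype V] (h : R.Exact) [Nonempty V] (h4 : ∀ v, 4 ≤ G.degree v) : HasCycleOfLength G 6 := by
  by_contra h6
  exact Exact.false_of_noSix _ ∅ rfl h h6 (by simp) (Or.inl rfl) ⟨Classical.arbitrary V, by simp⟩
    fun v _ => h4 v

end RotationSystem

/-! ### Choosability of degenerate graphs -/

section Degenerate

variable {V : Type*} {G : SimpleGraph V}

/-- Colour `v` last: its at most three neighbours block at most $3b$ of its $a\ge4b$ colours. -/
theorem exists_coloring_of_degenerate {a b : ℕ} (hab : 4 * b ≤ a)
    (h : ∀ s : Finset V, s.Nonempty → ∃ v ∈ s, (s.filter (G.Adj v)).card ≤ 3)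
    {L : V → Finset ℤ} (hL : ∀ v, (L v).card = a) (s : Finset V) :
    ∃ S : V → Finset ℤ, (∀ v ∈ s, (S v).card = b ∧ S v ⊆ L v) ∧
      ∀ u ∈ s, ∀ v ∈ s, G.Adj u v → Disjoint (S u) (S v) := by
  induction s using Finset.strongInduction with
  | _ s ih =>
    rcases s.eq_empty_or_nonempty with rfl | hs
    · exact ⟨fun _ => ∅, by simp, by simp⟩
    obtain ⟨v, hv, hdeg⟩ := h s hs
    obtain ⟨S, hS, hdisj⟩ := ih (s.erase v) (Finset.erase_ssubset hv)
    have hU : ((s.filter (G.Adj v)).biUnion S).card ≤ 3 * b := by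
      refine (Finset.card_biUnion_le_card_mul _ _ b fun u hu => ?_).trans
        (Nat.mul_le_mul_right b hdeg)
      rw [Finset.mem_filter] at hu
      exact (hS u (Finset.mem_erase.2 ⟨hu.2.ne', hu.1⟩)).1.le
    have hcard : b ≤ (L v \ (s.filter (G.Adj v)).biUnion S).card := by
      have := Finset.le_card_sdiff ((s.filter (G.Adj v)).biUnion S) (L v)
      rw [hL] at this
      omega
    obtain ⟨T, hT, hTb⟩ := Finset.exists_subset_card_eq hcard
    have hTdisj : ∀ u ∈ s, G.Adj v u → Disjoint T (S u) := fun u hu huv =>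
      Finset.disjoint_left.2 fun x hx hxu => (Finset.mem_sdiff.1 (hT hx)).2
        (Finset.mem_biUnion.2 ⟨u, Finset.mem_filter.2 ⟨hu, huv⟩, hxu⟩)
    refine ⟨Function.update S v T, fun u hu => ?_, fun u hu w hw huw => ?_⟩
    · by_cases huv : u = v
      · subst huv
        rw [Function.update_self]
        exact ⟨hTb, hT.trans Finset.sdiff_subset⟩
      · rw [Function.update_of_ne huv]
        exact hS u (Finset.mem_erase.2 ⟨huv, hu⟩)
    · by_cases huv : u = v
      · subst huv
        rw [Function.update_self, Function.update_of_ne huw.ne']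
        exact hTdisj w hw huw
      · by_cases hwv : w = v
        · subst hwv
          rw [Function.update_self, Function.update_of_ne huv]
          exact (hTdisj u hu huw.symm).symm
        · rw [Function.update_of_ne huv, Function.update_of_ne hwv]
          exact hdisj u (Finset.mem_erase.2 ⟨huv, hu⟩) w (Finset.mem_erase.2 ⟨hwv, hw⟩) huw

theorem isMultiChoosable_of_degenerate [Finite V] {a b : ℕ} (hab : 4 * b ≤ a)
    (h : ∀ s : Finset V, s.Nonempty → ∃ v ∈ s, (s.filter (G.Adj v)).card ≤ 3) :
    IsMultiChoosable G a b := by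
  intro L hL
  have := Fintype.ofFinite V
  obtain ⟨S, hS, hdisj⟩ := exists_coloring_of_degenerate hab h hL Finset.univ
  exact ⟨S, fun v => (hS v (Finset.mem_univ v)).1, fun v => (hS v (Finset.mem_univ v)).2,
    fun u v => hdisj u (Finset.mem_univ u) v (Finset.mem_univ v)⟩

theorem strongFractionalChoiceNumber_le_four [Finite V]
    (h : ∀ s : Finset V, s.Nonempty → ∃ v ∈ s, (s.filter (G.Adj v)).card ≤ 3) :
    strongFractionalChoiceNumber G ≤ 4 := by
  refine sInf_le ⟨4, fun a b _ hb hab => isMultiChoosable_of_degenerate ?_ h, rfl⟩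
  rw [le_div_iff₀ (by exact_mod_cast hb)] at hab
  exact_mod_cast hab

end Degenerate

theorem card_filter_adj_eq_degree_induce {V : Type*} {G : SimpleGraph V} {s : Finset V}
    {t : Set V} (h : ∀ v, v ∈ t ↔ v ∈ s) [Fintype t] (v : t) :
    (s.filter (G.Adj v)).card = (G.induce t).degree v := by
  rw [← SimpleGraph.card_neighborFinset_eq_degree, ← Finset.card_map (Function.Embedding.subtype _)]
  congr 1
  ext w
  simp [and_comm, h]

/-- It is exactness, not Euler's formula, that is restricted to the subgraph induced on `s`. -/
theorem exists_card_filter_adj_le_three {V : Type} [Finite V] {G : SimpleGraph V} {k : ℕ}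
    (hk : k = 5 ∨ k = 6) (hG : IsPlanar G) (hc : ¬ HasCycleOfLength G k) (s : Finset V)
    (hs : s.Nonempty) : ∃ v ∈ s, (s.filter (G.Adj v)).card ≤ 3 := by
  have := Fintype.ofFinite V
  obtain ⟨R, hR⟩ := hG
  obtain ⟨t, ht⟩ : ∃ t : Set V, ∀ v, v ∈ t ↔ v ∈ s := ⟨s, fun _ => Iff.rfl⟩
  have hE := (R.exact_of_euler hR).induce t
  by_contra! hcon
  obtain ⟨v, hv⟩ := hs
  have : Nonempty t := ⟨v, (ht v).2 hv⟩
  have h4 : ∀ v, 4 ≤ (G.induce t).degree v := fun v => by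
    rw [← card_filter_adj_eq_degree_induce ht]
    exact hcon v ((ht v).1 v.2)
  rcases hk with rfl | rfl
  · exact hc (hE.hasCycleOfLength_five h4).of_induce
  · exact hc (hE.hasCycleOfLength_six h4).of_induce

/-! ### The complete graph on four vertices -/

theorem four_le_of_isStronglyFractionalChoosable {r : ℝ}
    (h : IsStronglyFractionalChoosable (SimpleGraph.completeGraph (Fin 4)) r) : 4 ≤ r := by
  by_contra! hr
  -- The choice of `n` gives $(4n-1)/n=4-\frac1n>r$.
  obtain ⟨n, hn⟩ := exists_nat_gt (1 / (4 - r))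
  have hn0 : 0 < n := by
    have h1 : (0 : ℝ) < 1 / (4 - r) := by
      apply one_div_pos.2
      linarith
    exact_mod_cast h1.trans hn
  have hn0' : (0 : ℝ) < n := by exact_mod_cast hn0
  have hch := h (4 * n - 1) n (by omega) hn0 (by
    rw [le_div_iff₀ hn0']
    push_cast [Nat.cast_sub (show 1 ≤ 4 * n by omega)]
    rw [div_lt_iff₀ (by linarith)] at hn
    linarith)
  obtain ⟨S, hS, hSL, hdisj⟩ := hch (fun _ => (Finset.range (4 * n - 1)).map Nat.castEmbedding)
    (fun _ => by simp)
  have hcard : (Finset.univ.biUnion S).card = 4 * n := by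
    rw [Finset.card_biUnion fun u _ v _ huv => hdisj u v huv]
    simp only [hS]
    simp
  have hle := Finset.card_le_card (Finset.biUnion_subset.2 fun v (_ : v ∈ Finset.univ) => hSL v)
  rw [hcard, Finset.card_map, Finset.card_range] at hle
  omega

theorem not_hasCycleOfLength_completeGraph_four {k : ℕ} (hk : 5 ≤ k) :
    ¬ HasCycleOfLength (SimpleGraph.completeGraph (Fin 4)) k := by
  rintro ⟨v, p, hp, rfl⟩
  have h1 := hp.support_nodup.length_le_card
  rw [List.length_tail, SimpleGraph.Walk.length_support] at h1
  have : Fintype.card (Fin 4) = 4 := rfl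
  omega

theorem exists_card_filter_adj_le_of_card {V : Type*} [Fintype V] {G : SimpleGraph V} {n : ℕ}
    (hn : Fintype.card V ≤ n + 1) (s : Finset V) (hs : s.Nonempty) :
    ∃ v ∈ s, (s.filter (G.Adj v)).card ≤ n := by
  obtain ⟨v, hv⟩ := hs
  refine ⟨v, hv, ?_⟩
  refine (Finset.card_le_card (t := (Finset.univ : Finset V).erase v) fun w hw => ?_).trans ?_
  · rw [Finset.mem_filter] at hw
    exact Finset.mem_erase.2 ⟨hw.2.ne', Finset.mem_univ _⟩
  · rw [Finset.card_erase_of_mem (Finset.mem_univ _), Finset.card_univ]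
    omega

theorem strongFractionalChoiceNumber_completeGraph_four :
    strongFractionalChoiceNumber (SimpleGraph.completeGraph (Fin 4)) = 4 := by
  refine le_antisymm (strongFractionalChoiceNumber_le_four
    (exists_card_filter_adj_le_of_card (by simp))) ?_
  · refine le_sInf ?_
    rintro _ ⟨r, hr, rfl⟩
    exact EReal.coe_le_coe_iff.2 (four_le_of_isStronglyFractionalChoosable hr)

theorem graphK4_mem_planarWithoutCycle {k : ℕ} (hk : 5 ≤ k) : graphK4 ∈ planarWithoutCycle k :=
  ⟨isPlanar_completeGraph_four, not_hasCycleOfLength_completeGraph_four hk⟩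

theorem four_le_classStrongFractionalChoiceNumber {k : ℕ} (hk : 5 ≤ k) :
    4 ≤ classStrongFractionalChoiceNumber (planarWithoutCycle k) :=
  le_sSup ⟨graphK4, graphK4_mem_planarWithoutCycle hk,
    strongFractionalChoiceNumber_completeGraph_four.symm⟩

theorem classStrongFractionalChoiceNumber_le_four {k : ℕ} (hk : k = 5 ∨ k = 6) :
    classStrongFractionalChoiceNumber (planarWithoutCycle k) ≤ 4 := by
  refine sSup_le ?_
  rintro _ ⟨G, hG, rfl⟩
  have := G.finite
  exact strongFractionalChoiceNumber_le_four (exists_card_filter_adj_le_three hk hG.1 hG.2)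

theorem mainTheorem9 :
    (∀ k : ℕ, 5 ≤ k →
      graphK4 ∈ planarWithoutCycle k ∧
      strongFractionalChoiceNumber graphK4.graph = 4 ∧
      4 ≤ classStrongFractionalChoiceNumber (planarWithoutCycle k)) ∧
    (∀ k : ℕ, k = 5 ∨ k = 6 →
      classStrongFractionalChoiceNumber (planarWithoutCycle k) = 4) := by
  refine ⟨fun k hk => ⟨graphK4_mem_planarWithoutCycle hk,
    strongFractionalChoiceNumber_completeGraph_four,
    four_le_classStrongFractionalChoiceNumber hk⟩, fun k hk => ?_⟩
  exact le_antisymm (classStrongFractionalChoiceNumber_le_four hk)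
    (four_le_classStrongFractionalChoiceNumber (by omega))
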